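/- Let $dA(\zeta)=\frac1\pi d^2\zeta$ on $\mathbb C$ and let $Q(\zeta)=|\zeta|^2$. For $N\ge1$ consider the symplectic Ginibre ensemble, i.e. $N$ points in $\mathbb C$ with law $Z_N^{-1}e^{-\mathbf H_N(\zeta)}\prod_{j=1}^N dA(\zeta_j)$, where $$\mathbf H_N(\zeta)=\sum_{j\ne k}\log\frac1{|\zeta_j-\zeta_k||\zeta_j-\bar\zeta_k|}+\sum_{j=1}^N\Big(\log\frac1{|\zeta_j-\bar\zeta_j|^2}+NQ(\zeta_j)\Big),$$ and let $$\mathbf R_{N,k}(\zeta_1,\dots,\zeta_k)=\frac1{Z_N}\frac{N!}{(N-k)!}\int_{\mathbb C^{N-k}}e^{-\mathbf H_N(\zeta)}\prod_{j=k+1}^N dA(\zeta_j)$$ be its $k$-point correlation function ($\mathbf R_{N,k}=0$ for $k>N$). Let $t\in\mathbb R$ and $p_N=\pm\sqrt2\,e^{i\theta_N}$ with $\theta_N=t/\sqrt N$ (one choice of sign for all $N$), let $\nu_N=p_N/|p_N|$ be the outer unit normal at $p_N$ of the disc of radius $\sqrt2$ centred at $0$, and let $r_N>0$ be the micro-scale,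 determined by $\int_{|\zeta-p_N|<r_N}\frac12\partial\bar\partial Q\,dA=\frac1N$ (so $r_N=\sqrt{2/N}$). Let $$R_{N,k}(z_1,\dots,z_k)=r_N^{2k}\,\mathbf R_{N,k}(p_N+\nu_Nr_Nz_1,\dots,p_N+\nu_Nr_Nz_k)$$ be the $k$-point correlation function of the process rescaled at $p_N$. Put $\operatorname{erfc}(z)=1-\frac2{\sqrt\pi}\int_0^ze^{-\xi^2}d\xi$, $f_z(u)=\frac12\operatorname{erfc}(\sqrt2(z-u))$, $W(f,g)=fg'-f'g$, and $$\kappa^{\mathbb R}_{\rm edge}(z,w)=\sqrt\pi\,e^{z^2+w^2}\int_{-\infty}^0W(f_w,f_z)(u)\,du,$$ $$K^t_{\rm edge}(z,w)=e^{-|z+it|^2-|w+it|^2}\begin{pmatrix}\kappa^{\mathbb R}_{\rm edge}(z+it,w+it)&\kappa^{\mathbb R}_{\rm edge}(z+it,\bar w-it)\\ \kappa^{\mathbb R}_{\rm edge}(\bar z-it,w+it)&\kappa^{\mathbb R}_{\rm edge}(\bar z-it,\bar w-it)\end{pmatrix}.$$ Then for every $k$, every choice of sign and every $t\in\mathbb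 R$, as $N\to\infty$, $R_{N,k}(z_1,\dots,z_k)$ converges, uniformly for $z_1,\dots,z_k$ in compact subsets of $\mathbb C$, to $$R^t_k(z_1,\dots,z_k)=\prod_{j=1}^k(\bar z_j-z_j-2it)\;\operatorname{Pf}\big[K^t_{\rm edge}(z_j,z_l)\big]_{j,l=1}^k,$$ where $\operatorname{Pf}$ is the Pfaffian of the $2k\times2k$ skew-symmetric matrix with these $2\times 2$ blocks. Moreover, as $t\to\infty$, $$R^t_k(z_1,\dots,z_k)=\det\big[K^{\mathbb C}_{\rm edge}(z_j,z_l)\big]_{j,l=1}^k\cdot(1+o(1)),\qquad K^{\mathbb C}_{\rm edge}(z,w)=e^{-|z|^2-|w|^2+2z\bar w}\,\tfrac12\operatorname{erfc}(z+\bar w),$$ where the $o(1)$-term is uniform for $z_1,\dots,z_k$ in compact subsets of $\mathbb C$. -/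

import Mathlib

open MeasureTheory Filter
open scoped ComplexConjugate BigOperators

namespace SymplecticGinibre

noncomputable section

/-! ### The planar symplectic ensemble and its correlation functions -/

/-- The area measure `dA(ζ) = d²ζ / π` on `ℂ`. -/
def areaMeasure : Measure ℂ := (NNReal.pi⁻¹ : NNReal) • volume

instance : SigmaFinite areaMeasure := by
  unfold areaMeasure
  infer_instance

/-- The Boltzmann factor `exp (-H_N(ζ))` of a configuration `ζ` indexed by a finite type `ι`, where
`H_N(ζ) = ∑_{j ≠ l} log (1 / (|ζ_j - ζ_l| |ζ_j - conj ζ_l|))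
  + ∑_j (log (1 / |ζ_j - conj ζ_j|²) + N Q(ζ_j))`
(the first sum is over ordered pairs). It is written multiplicatively, so that it vanishes where
`H_N = +∞`. -/
def boltzmann {ι : Type} [Fintype ι] [DecidableEq ι] (Q : ℂ → ℝ) (N : ℕ) (ζ : ι → ℂ) : ℝ :=
  (∏ j, ∏ l ∈ Finset.univ.erase j, ‖ζ j - ζ l‖ * ‖ζ j - conj (ζ l)‖) *
    ∏ j, (‖ζ j - conj (ζ j)‖ ^ 2 * Real.exp (-((N : ℝ) * Q (ζ j))))

/-- The partition function `Z_N`. -/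
def partitionFunction (Q : ℂ → ℝ) (N : ℕ) : ℝ :=
  ∫ ζ : Fin N → ℂ, boltzmann Q N ζ ∂(Measure.pi fun _ => areaMeasure)

/-- The `k`-point correlation function of the `N`-particle ensemble (before rescaling),
`(1 / Z_N) (N! / (N - k)!) ∫_{ℂ^{N-k}} exp (-H_N(z_1, …, z_k, w_1, …, w_{N-k})) ∏ dA(w_j)`.
It is `0` for `k > N`. -/
def correlation (Q : ℂ → ℝ) (N k : ℕ) (z : Fin k → ℂ) : ℝ :=
  (N.descFactorial k : ℝ) / partitionFunction Q N *
    ∫ w : Fin (N - k) → ℂ, boltzmann Q N (Sum.elim z w) ∂(Measure.pi fun _ => areaMeasure)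

/-- `r` is the micro-scale of the `N`-particle ensemble at `p`:
`r > 0` and `∫_{D(p, r)} (∂∂̄Q / 2) dA = 1 / N`, where `∂∂̄` is a quarter of the usual Laplacian. -/
def IsMicroScale (Q : ℂ → ℝ) (N : ℕ) (p : ℂ) (r : ℝ) : Prop :=
  0 < r ∧
    ∫ ζ in Metric.ball p r, (1 / 4 * Laplacian.laplacian Q ζ) / 2 ∂areaMeasure = 1 / (N : ℝ)

/-- The `k`-point correlation function of the rescaled process `z_j = (ζ_j - p) / (ν r)`, where
`ν` is a unit complex number and `r > 0`. -/
def rescaledCorrelation (Q : ℂ → ℝ) (N k : ℕ) (p ν : ℂ) (r : ℝ) (z : Fin k → ℂ) : ℝ :=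
  r ^ (2 * k) * correlation Q N k fun j => p + ν * (r : ℂ) * z j

/-- The Gaussian potential `Q(ζ) = |ζ|²`. -/
def gaussianPotential (ζ : ℂ) : ℝ := ‖ζ‖ ^ 2

/-- The moving edge point `s √2 exp (i t / √N)`, for a sign `s = ±1`. It lies on the boundary of
the droplet of the Gaussian potential, the disc of radius `√2` centred at `0`. -/
def edgePoint (s t : ℝ) (N : ℕ) : ℂ :=
  (s : ℂ) * (Real.sqrt 2 : ℂ) * Complex.exp (Complex.I * ((t / Real.sqrt N : ℝ) : ℂ))

/-- The outer unit normal at a boundary point `p ≠ 0` of a disc centred at `0`. -/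
def discOuterNormal (p : ℂ) : ℂ := p / (‖p‖ : ℂ)

/-! ### Pfaffians -/

/-- The Pfaffian of the `2k × 2k` skew-symmetric matrix made of the `2 × 2` blocks `K j l`,
`Pf = (1 / (2^k k!)) ∑_σ sign σ ∏_j A_{σ(2j-1), σ(2j)}`; the row `2j - 1` (resp. `2j`) of the matrix
`A` is labelled `(j, 0)` (resp. `(j, 1)`). -/
def pfaffian {k : ℕ} (K : Fin k → Fin k → Matrix (Fin 2) (Fin 2) ℂ) : ℂ :=
  1 / ((2 : ℂ) ^ k * (k.factorial : ℂ)) *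
    ∑ σ : Equiv.Perm (Fin k × Fin 2), ((Equiv.Perm.sign σ : ℤ) : ℂ) *
      ∏ j : Fin k, K (σ (j, 0)).1 (σ (j, 1)).1 (σ (j, 0)).2 (σ (j, 1)).2

/-! ### The limiting kernels -/

/-- The entire complementary error function,
`erfc z = 1 - (2 / √π) ∫_0^z exp (-ξ²) dξ`, the integral being along the segment `ξ = x z`. -/
def erfc (z : ℂ) : ℂ :=
  1 - 2 / (Real.sqrt Real.pi : ℂ) * (z * ∫ x in (0 : ℝ)..1, Complex.exp (-((x : ℂ) * z) ^ 2))

/-- `f_z(u) = (1/2) erfc (√2 (z - u))`. -/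
def edgeF (z : ℂ) (u : ℝ) : ℂ := 1 / 2 * erfc ((Real.sqrt 2 : ℂ) * (z - (u : ℂ)))

/-- The Wronskian `W(f, g) = f g' - f' g`. -/
def wronskian (f g : ℝ → ℂ) (u : ℝ) : ℂ := f u * deriv g u - deriv f u * g u

/-- The edge pre-kernel `√π exp (z² + w²) ∫_{-∞}^0 W(f_w, f_z)(u) du`. -/
def kappaEdge (z w : ℂ) : ℂ :=
  (Real.sqrt Real.pi : ℂ) * Complex.exp (z ^ 2 + w ^ 2) *
    ∫ u in Set.Iio (0 : ℝ), wronskian (edgeF w) (edgeF z) u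

/-- The `2 × 2` matrix kernel `K^t_edge(z, w)`; note `conj (z + it) = conj z - it`. -/
def kernelEdge (t : ℝ) (z w : ℂ) : Matrix (Fin 2) (Fin 2) ℂ :=
  ((Real.exp (-‖z + Complex.I * t‖ ^ 2 - ‖w + Complex.I * t‖ ^ 2) : ℝ) : ℂ) •
    !![kappaEdge (z + Complex.I * t) (w + Complex.I * t),
        kappaEdge (z + Complex.I * t) (conj w - Complex.I * t);
       kappaEdge (conj z - Complex.I * t) (w + Complex.I * t),
        kappaEdge (conj z - Complex.I * t) (conj w - Complex.I * t)]

/-- The limiting `k`-point function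
`R_k^t(z_1, …, z_k) = ∏_j (conj z_j - z_j - 2it) Pf [K^t_edge(z_j, z_l)]`. -/
def limitCorrelation (t : ℝ) (k : ℕ) (z : Fin k → ℂ) : ℂ :=
  (∏ j, (conj (z j) - z j - 2 * Complex.I * t)) * pfaffian fun j l => kernelEdge t (z j) (z l)

/-- The complex Ginibre edge kernel
`K^ℂ_edge(z, w) = exp (-|z|² - |w|² + 2 z conj w) (1/2) erfc (z + conj w)`. -/
def kernelEdgeComplex (z w : ℂ) : ℂ :=
  Complex.exp (-(‖z‖ : ℂ) ^ 2 - (‖w‖ : ℂ) ^ 2 + 2 * z * conj w) * (1 / 2 * erfc (z + conj w))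

end

end SymplecticGinibre

/-!
The proof has two independent halves, both resting on the fact that every function involved is a
Pfaffian or determinant of an explicit entire kernel, expressed through
`h(b) = ∫_0^∞ exp (-s² - b s) ds` (`gaussLaplace`), an entire multiple of
`exp (b² / 4) erfc (b / 2)` with `2 h' = b h - 1`.

**Scaling limit.** Since `|ζ - conj ζ|² = -(ζ - conj ζ)²`, the Boltzmann factor is a product of
one-point weights times a Vandermonde determinant in the `2N` points `ζ_j`, `conj ζ_j`. Column
operations put polynomials which are skew-orthogonal for the pairing
`∫ p(ζ) q(conj ζ) (ζ - conj ζ) exp (-N |ζ|²) dA` in its rows; expanding and integrating out `N - k`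
points leaves a Pfaffian of the polynomial kernel (`correlation_eq_pf`). In the coordinates
`ζ = √(2/N) X` this kernel, multiplied by `exp (-X² - Y²)`, vanishes for `X = Y`, and its derivative
in `Y` is a combination of two truncated exponential sums (`hasDerivAt_microKernel`,
`hasDerivAt_dampedKernel`). For `X = √N + x`, `Y = √N + y` these sums are Poisson tails in the window
of the central limit theorem, which extends to complex arguments by dominated convergence in a Gamma
integral together with Stirling's formula (`tendsto_poissonTail`). Integrating back gives the edge
kernel (`tendsto_dampedKernel`). The base point `√2 exp (i t / √N)` differs from `√2` by a tangential
shift of `t` microscopic units, hence the argument `z + i t` in the limit. All limits are taken along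
convergent arguments; this gives uniformity on compact sets
(`tendstoUniformlyOn_of_forall_tendsto_prod`).

**The limit `t → ∞`.** After the Gaussian factors are removed, `t` times the kernel tends to `0` for
two points both shifted by `i t` or both by `-i t`, and to a multiple of `h(2 (z + w))` for one point
of each kind (`tendsto_mul_edgeCore_sub`). So the Pfaffian tends to a determinant
(`pf_offDiagonal`), which up to weights is the determinant of the complex Ginibre edge kernel. This
determinant vanishes where points coincide, so a *relative* error needs two more facts. Write `z` and
`w = conj z` as independent variables: the error is entire and vanishes whenever two `z_j` or two
`w_j` coincide, so by the maximum principle it is at most `ε |Δ(z)| |Δ(w)|`, where `Δ` is the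
Vandermonde determinant (`norm_le_mul_absVandermonde`, `eventually_norm_corePfaffian_sub_le`). On the
other hand the limiting determinant is a Gram determinant of exponentials in `L²(0, ∞)`, and a
comparison with integrals over `k` consecutive short intervals bounds it below by `c |Δ(z)|²`
(`exists_le_norm_det_expGram`).
-/

open scoped Topology

namespace SymplecticGinibre

/-! ### Pfaffian sums -/

/-- In a signed sum over the permutations of `ι × Fin 2`, antisymmetrizing every factor in its two
arguments only contributes a factor `2` each: exchanging the two entries of a pair changes the
sign of the permutation. -/
theorem sum_sign_prod_antisymm {ι : Type*} [Fintype ι] [DecidableEq ι]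
    (B : ι → ι × Fin 2 → ι × Fin 2 → ℂ) :
    ∑ σ : Equiv.Perm (ι × Fin 2), ((Equiv.Perm.sign σ : ℤ) : ℂ) *
        ∏ j, (B j (σ (j, 0)) (σ (j, 1)) - B j (σ (j, 1)) (σ (j, 0))) =
      2 ^ Fintype.card ι * ∑ σ : Equiv.Perm (ι × Fin 2), ((Equiv.Perm.sign σ : ℤ) : ℂ) *
        ∏ j, B j (σ (j, 0)) (σ (j, 1)) := by
  have key : ∀ (j : ι) (a : Fin 2 → ι × Fin 2), B j (a 0) (a 1) - B j (a 1) (a 0) =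
      ∑ ε : Equiv.Perm (Fin 2), ((Equiv.Perm.sign ε : ℤ) : ℂ) * B j (a (ε 0)) (a (ε 1)) := by
    intro j a
    rw [Fintype.sum_eq_add (1 : Equiv.Perm (Fin 2)) (Equiv.swap 0 1) (by decide)]
    · simp [sub_eq_add_neg]
    · intro x hx
      exfalso
      revert x
      decide
  have h1 : ∀ σ : Equiv.Perm (ι × Fin 2), ((Equiv.Perm.sign σ : ℤ) : ℂ) *
        ∏ j, (B j (σ (j, 0)) (σ (j, 1)) - B j (σ (j, 1)) (σ (j, 0))) =
      ∑ ε : ι → Equiv.Perm (Fin 2), ((Equiv.Perm.sign (σ * Equiv.prodCongrRight ε) : ℤ) : ℂ) *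
        ∏ j, B j ((σ * Equiv.prodCongrRight ε) (j, 0)) ((σ * Equiv.prodCongrRight ε) (j, 1)) := by
    intro σ
    have h2 : ∀ j, B j (σ (j, 0)) (σ (j, 1)) - B j (σ (j, 1)) (σ (j, 0)) =
        ∑ ε : Equiv.Perm (Fin 2), ((Equiv.Perm.sign ε : ℤ) : ℂ) *
          B j (σ (j, ε 0)) (σ (j, ε 1)) := fun j => key j fun c => σ (j, c)
    simp_rw [h2]
    rw [Finset.prod_univ_sum, Fintype.piFinset_univ, Finset.mul_sum]
    refine Finset.sum_congr rfl fun ε _ => ?_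
    rw [Finset.prod_mul_distrib, Equiv.Perm.sign_mul, Equiv.Perm.sign_prodCongrRight]
    simp only [Equiv.Perm.coe_mul, Function.comp_apply, Equiv.prodCongrRight_apply]
    push_cast
    ring
  simp_rw [h1]
  rw [Finset.sum_comm]
  have h3 : ∀ ε : ι → Equiv.Perm (Fin 2),
      ∑ σ : Equiv.Perm (ι × Fin 2), ((Equiv.Perm.sign (σ * Equiv.prodCongrRight ε) : ℤ) : ℂ) *
        ∏ j, B j ((σ * Equiv.prodCongrRight ε) (j, 0)) ((σ * Equiv.prodCongrRight ε) (j, 1)) =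
      ∑ σ : Equiv.Perm (ι × Fin 2), ((Equiv.Perm.sign σ : ℤ) : ℂ) *
        ∏ j, B j (σ (j, 0)) (σ (j, 1)) := fun ε =>
    Equiv.sum_comp (Equiv.mulRight (Equiv.prodCongrRight ε : Equiv.Perm (ι × Fin 2)))
      fun σ : Equiv.Perm (ι × Fin 2) => ((Equiv.Perm.sign σ : ℤ) : ℂ) *
        ∏ j, B j (σ (j, 0)) (σ (j, 1))
  simp_rw [h3]
  simp [Finset.card_univ, Fintype.card_pi, Fintype.card_perm]

/-- The Pfaffian of a matrix `A` whose rows are labelled by `Fin k × Fin 2`. As the sum is over all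
permutations, `A` need not be skew-symmetric for this to make sense. -/
noncomputable def pf {k : ℕ} (A : Fin k × Fin 2 → Fin k × Fin 2 → ℂ) : ℂ :=
  1 / ((2 : ℂ) ^ k * (k.factorial : ℂ)) *
    ∑ σ : Equiv.Perm (Fin k × Fin 2), ((Equiv.Perm.sign σ : ℤ) : ℂ) *
      ∏ j : Fin k, A (σ (j, 0)) (σ (j, 1))

theorem pfaffian_eq_pf {k : ℕ} (K : Fin k → Fin k → Matrix (Fin 2) (Fin 2) ℂ) :
    pfaffian K = pf fun a b => K a.1 b.1 a.2 b.2 := rfl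

theorem pf_congr {k : ℕ} {A B : Fin k × Fin 2 → Fin k × Fin 2 → ℂ}
    (h : ∀ a b, a ≠ b → A a b = B a b) : pf A = pf B := by
  unfold pf
  congr 1
  refine Finset.sum_congr rfl fun σ _ => ?_
  congr 1
  refine Finset.prod_congr rfl fun j _ => h _ _ ?_
  simp

theorem pf_smul {k : ℕ} (c : ℂ) (A : Fin k × Fin 2 → Fin k × Fin 2 → ℂ) :
    pf (fun a b => c * A a b) = c ^ k * pf A := by
  unfold pf
  simp_rw [Finset.prod_mul_distrib, Finset.prod_const, Finset.card_univ, Fintype.card_fin]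
  rw [mul_left_comm, Finset.mul_sum (a := c ^ k)]
  congr 1
  exact Finset.sum_congr rfl fun σ _ => by ring

/-- The Pfaffian of `diag W * A * diag W`. -/
theorem pf_weight {k : ℕ} (W : Fin k × Fin 2 → ℂ) (A : Fin k × Fin 2 → Fin k × Fin 2 → ℂ) :
    pf (fun a b => W a * W b * A a b) = (∏ j, W (j, 0) * W (j, 1)) * pf A := by
  have h : ∀ σ : Equiv.Perm (Fin k × Fin 2),
      ∏ j, W (σ (j, 0)) * W (σ (j, 1)) = ∏ j, W (j, 0) * W (j, 1) := by
    intro σ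
    have := Equiv.prod_comp σ W
    rw [Fintype.prod_prod_type, Fintype.prod_prod_type] at this
    simpa [Fin.prod_univ_two] using this
  unfold pf
  simp_rw [Finset.prod_mul_distrib (f := fun j => _ * _)]
  simp_rw [h]
  rw [mul_left_comm, Finset.mul_sum (a := ∏ j, W (j, 0) * W (j, 1))]
  congr 1
  exact Finset.sum_congr rfl fun σ _ => by ring

/-- The Pfaffian vanishes if two rows and the two corresponding columns agree. -/
theorem pf_eq_zero {k : ℕ} {A : Fin k × Fin 2 → Fin k × Fin 2 → ℂ} {a b : Fin k × Fin 2}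
    (hab : a ≠ b) (hl : ∀ c, A a c = A b c) (hr : ∀ c, A c a = A c b) : pf A = 0 := by
  have hl' : ∀ c d, A (Equiv.swap a b c) d = A c d := by
    intro c d
    rcases eq_or_ne c a with rfl | h1
    · rw [Equiv.swap_apply_left, hl]
    rcases eq_or_ne c b with rfl | h2
    · rw [Equiv.swap_apply_right, hl]
    rw [Equiv.swap_apply_of_ne_of_ne h1 h2]
  have hr' : ∀ c d, A c (Equiv.swap a b d) = A c d := by
    intro c d
    rcases eq_or_ne d a with rfl | h1
    · rw [Equiv.swap_apply_left, hr]
    rcases eq_or_ne d b with rfl | h2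
    · rw [Equiv.swap_apply_right, hr]
    rw [Equiv.swap_apply_of_ne_of_ne h1 h2]
  unfold pf
  have := Equiv.sum_comp (Equiv.mulLeft (Equiv.swap a b))
    fun σ : Equiv.Perm (Fin k × Fin 2) => ((Equiv.Perm.sign σ : ℤ) : ℂ) *
      ∏ j : Fin k, A (σ (j, 0)) (σ (j, 1))
  simp only [Equiv.coe_mulLeft, Equiv.Perm.sign_mul, Equiv.Perm.sign_swap hab,
    Equiv.Perm.coe_mul, Function.comp_apply, hl', hr'] at this
  simp only [Units.val_neg, neg_mul, one_mul, Int.cast_neg,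
    Finset.sum_neg_distrib] at this
  rw [self_eq_neg.mp this.symm, mul_zero]

/-- A Pfaffian form of the Cauchy-Binet formula, for a matrix of the form
`A a b = ∑ m, w m * χ m 0 a * χ m 1 b`. -/
theorem sum_sign_prod_eq_sum_det {ι M : Type*} [Fintype ι] [DecidableEq ι] [Fintype M]
    (w : M → ℂ) (χ : M → Fin 2 → ι × Fin 2 → ℂ) :
    ∑ σ : Equiv.Perm (ι × Fin 2), ((Equiv.Perm.sign σ : ℤ) : ℂ) *
        ∏ j, ∑ m, w m * (χ m 0 (σ (j, 0)) * χ m 1 (σ (j, 1))) =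
      ∑ m : ι → M, (∏ j, w (m j)) *
        (Matrix.of fun (b jc : ι × Fin 2) => χ (m jc.1) jc.2 b).det := by
  classical
  simp_rw [Finset.prod_univ_sum, Fintype.piFinset_univ, Finset.mul_sum]
  rw [Finset.sum_comm]
  refine Finset.sum_congr rfl fun m _ => ?_
  rw [Matrix.det_apply', Finset.mul_sum]
  refine Finset.sum_congr rfl fun σ _ => ?_
  rw [Finset.prod_mul_distrib, Fintype.prod_prod_type]
  simp only [Matrix.of_apply, Fin.prod_univ_two]
  ring

/-- The Pfaffian of a sum of elementary skew-symmetric matrices is a sum of determinants. -/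
theorem pf_eq_sum_det {k : ℕ} {M : Type*} [Fintype M] (w : M → ℂ)
    (χ : M → Fin 2 → Fin k × Fin 2 → ℂ) :
    pf (fun a b => ∑ m, w m * (χ m 0 a * χ m 1 b - χ m 1 a * χ m 0 b)) =
      1 / (k.factorial : ℂ) * ∑ m : Fin k → M, (∏ j, w (m j)) *
        (Matrix.of fun (b jc : Fin k × Fin 2) => χ (m jc.1) jc.2 b).det := by
  rw [← sum_sign_prod_eq_sum_det]
  have := sum_sign_prod_antisymm (ι := Fin k)
    fun _ a b => ∑ m, w m * (χ m 0 a * χ m 1 b)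
  unfold pf
  have h : ∀ a b, ∑ m, w m * (χ m 0 a * χ m 1 b - χ m 1 a * χ m 0 b) =
      ∑ m, w m * (χ m 0 a * χ m 1 b) - ∑ m, w m * (χ m 0 b * χ m 1 a) := by
    intro a b
    rw [← Finset.sum_sub_distrib]
    exact Finset.sum_congr rfl fun m _ => by ring
  simp_rw [h, this]
  rw [Fintype.card_fin, ← mul_assoc]
  congr 1
  have : (k.factorial : ℂ) ≠ 0 := by exact_mod_cast k.factorial_ne_zero
  field_simp

/-- Each injective `m : α → α ⊕ β` extends to exactly `|β|!` permutations of `α ⊕ β`. -/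
theorem sum_perm_comp_inl {α β : Type*} [Fintype α] [DecidableEq α] [Fintype β] [DecidableEq β]
    (F : (α → α ⊕ β) → ℂ) (hF : ∀ m, ¬ Function.Injective m → F m = 0) :
    ∑ τ : Equiv.Perm (α ⊕ β), F (τ ∘ Sum.inl) =
      ((Fintype.card β).factorial : ℂ) * ∑ m, F m := by
  have hcard : ∀ m : α → α ⊕ β, Function.Injective m →
      (Finset.univ.filter fun τ : Equiv.Perm (α ⊕ β) => τ ∘ Sum.inl = m).card =
        (Fintype.card β).factorial := by
    intro m hm
    obtain ⟨τ₀, h₀⟩ : ∃ τ₀ : Equiv.Perm (α ⊕ β), τ₀ ∘ Sum.inl = m := by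
      obtain ⟨e⟩ : Nonempty (((Set.range (Sum.inl : α → α ⊕ β))ᶜ : Set (α ⊕ β)) ≃
          ((Set.range m)ᶜ : Set (α ⊕ β))) := by
        apply Fintype.card_eq.mp
        rw [Fintype.card_compl_set, Fintype.card_compl_set,
          Set.card_range_of_injective Sum.inl_injective, Set.card_range_of_injective hm]
      let e₁ : Set.range (Sum.inl : α → α ⊕ β) ≃ Set.range m :=
        (Equiv.ofInjective _ Sum.inl_injective).symm.trans (Equiv.ofInjective _ hm)
      refine ⟨(Equiv.Set.sumCompl _).symm.trans ((e₁.sumCongr e).trans (Equiv.Set.sumCompl _)), ?_⟩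
      funext a
      have : (Equiv.Set.sumCompl (Set.range (Sum.inl : α → α ⊕ β))).symm (Sum.inl a) =
          Sum.inl ⟨Sum.inl a, a, rfl⟩ :=
        Equiv.Set.sumCompl_symm_apply_of_mem (Set.mem_range_self a)
      simp only [Function.comp_apply, Equiv.trans_apply, this, Equiv.sumCongr_apply, Sum.map_inl,
        Equiv.Set.sumCompl_apply_inl]
      have h2 : (Equiv.ofInjective (Sum.inl : α → α ⊕ β) Sum.inl_injective).symm
          ⟨Sum.inl a, a, rfl⟩ = a := by
        rw [Equiv.symm_apply_eq]; rfl
      simp only [e₁, Equiv.trans_apply, h2]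
      rfl
    rw [← Fintype.card_perm, ← Finset.card_univ]
    symm
    refine Finset.card_bij (fun π _ => τ₀ * Equiv.sumCongr (Equiv.refl α) π) ?_ ?_ ?_
    · intro π _
      simp only [Finset.mem_filter, Finset.mem_univ, true_and]
      rw [← h₀]
      rfl
    · intro π _ π' _ h
      have h := mul_left_cancel h
      ext b
      have := congrArg (fun e : Equiv.Perm (α ⊕ β) => e (Sum.inr b)) h
      simpa using this
    · intro τ hτ
      simp only [Finset.mem_filter, Finset.mem_univ, true_and] at hτ
      have hinl : ∀ a, (τ₀⁻¹ * τ) (Sum.inl a) = Sum.inl a := by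
        intro a
        have : τ (Sum.inl a) = τ₀ (Sum.inl a) := (congrFun hτ a).trans (congrFun h₀ a).symm
        simp [this]
      obtain ⟨⟨π₁, π₂⟩, hπ⟩ : τ₀⁻¹ * τ ∈ (Equiv.Perm.sumCongrHom α β).range := by
        refine Equiv.Perm.mem_sumCongrHom_range_of_perm_mapsTo_inl ?_
        rintro _ ⟨a, rfl⟩
        exact ⟨a, (hinl a).symm⟩
      refine ⟨π₂, Finset.mem_univ _, ?_⟩
      have h1 : π₁ = Equiv.refl α := by
        ext a
        have := hinl a
        rw [← hπ] at this
        simpa using this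
      subst h1
      change τ₀ * (Equiv.Perm.sumCongrHom α β) (Equiv.refl α, π₂) = τ
      rw [hπ]
      simp
  rw [← Finset.sum_fiberwise (s := Finset.univ) (g := fun τ : Equiv.Perm (α ⊕ β) => τ ∘ Sum.inl),
    Finset.mul_sum]
  refine Finset.sum_congr rfl fun m _ => ?_
  rw [Finset.sum_congr rfl (g := fun _ => F m)
    (fun τ hτ => by rw [(Finset.mem_filter.mp hτ).2]), Finset.sum_const, nsmul_eq_mul]
  by_cases hm : Function.Injective m
  · rw [hcard m hm]
  · rw [hF m hm, mul_zero, mul_zero]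

/-- Non-injective maps may be added to a sum over permutations if they do not contribute. -/
theorem sum_perm_eq_sum_fun {k : ℕ} (F : (Fin k → Fin k) → ℂ)
    (hF : ∀ m, ¬ Function.Injective m → F m = 0) :
    ∑ τ : Equiv.Perm (Fin k), F τ = ∑ m, F m := by
  refine Finset.sum_bij_ne_zero (fun τ _ _ => (τ : Fin k → Fin k)) (by simp) ?_ ?_ (by simp)
  · intro a _ _ b _ _ h
    exact DFunLike.coe_injective h
  · intro m _ hm
    have : Function.Injective m := by
      by_contra h
      exact hm (hF m h)
    exact ⟨Equiv.ofBijective m (Finite.injective_iff_bijective.mp this), Finset.mem_univ _, hm, rfl⟩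

/-- The Pfaffian of the matrix with blocks `!![0, B j l; -B l j, 0]` is `det B`. -/
theorem pf_offDiagonal {k : ℕ} (B : Matrix (Fin k) (Fin k) ℂ) :
    pf (fun a b => (if a.2 = 0 ∧ b.2 = 1 then B a.1 b.1 else 0) -
      if a.2 = 1 ∧ b.2 = 0 then B b.1 a.1 else 0) = B.det := by
  let χ : Fin k → Fin 2 → Fin k × Fin 2 → ℂ := fun m c a =>
    if a.2 = c then (if c = 0 then (if a.1 = m then 1 else 0) else B m a.1) else 0
  have h := pf_eq_sum_det (k := k) (fun _ : Fin k => (1 : ℂ)) χ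
  have h1 : (fun a b : Fin k × Fin 2 => (if a.2 = 0 ∧ b.2 = 1 then B a.1 b.1 else 0) -
      if a.2 = 1 ∧ b.2 = 0 then B b.1 a.1 else 0) =
      fun a b => ∑ m, (1 : ℂ) * (χ m 0 a * χ m 1 b - χ m 1 a * χ m 0 b) := by
    funext a b
    simp only [one_mul, χ, Finset.sum_sub_distrib]
    congr 1
    · by_cases ha : a.2 = 0 <;> by_cases hb : b.2 = 1 <;> simp [ha, hb]
    · by_cases ha : a.2 = 1 <;> by_cases hb : b.2 = 0 <;> simp [ha, hb]
  rw [h1, h]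
  simp only [Finset.prod_const_one, one_mul]
  let G : (Fin k → Fin k) → Fin 2 → Matrix (Fin k) (Fin k) ℂ := fun m c =>
    Matrix.of fun b j => if c = 0 then (if b = m j then 1 else 0) else B (m j) b
  have h2 : ∀ m : Fin k → Fin k,
      (Matrix.of fun (b jc : Fin k × Fin 2) => χ (m jc.1) jc.2 b).det =
        (G m 0).det * (G m 1).det := by
    intro m
    have : (Matrix.of fun (b jc : Fin k × Fin 2) => χ (m jc.1) jc.2 b) =
        Matrix.blockDiagonal (G m) := by
      ext ⟨b, d⟩ ⟨j, c⟩
      by_cases hdc : d = c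
      · subst hdc
        simp [Matrix.blockDiagonal_apply, χ, G]
      · simp [Matrix.blockDiagonal_apply, χ, G, hdc]
    rw [this, Matrix.det_blockDiagonal, Fin.prod_univ_two]
  simp_rw [h2]
  rw [← sum_perm_eq_sum_fun]
  · have h3 : ∀ τ : Equiv.Perm (Fin k), (G τ 0).det * (G τ 1).det = B.det := by
      intro τ
      have e0 : G τ 0 = (1 : Matrix (Fin k) (Fin k) ℂ).submatrix id τ := by
        ext b j
        simp [G, Matrix.one_apply]
      have e1 : G τ 1 = (B.transpose).submatrix id τ := by
        ext b j
        simp [G]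
      rw [e0, e1, Matrix.det_permute', Matrix.det_permute', Matrix.det_one, Matrix.det_transpose]
      rw [mul_one, ← mul_assoc, ← Int.cast_mul, ← Units.val_mul, Int.units_mul_self]
      simp
    simp_rw [h3]
    have : (k.factorial : ℂ) ≠ 0 := by exact_mod_cast k.factorial_ne_zero
    simp [Fintype.card_perm, this]
  · intro m hm
    simp only [Function.Injective, not_forall] at hm
    obtain ⟨i, j, hij, hne⟩ := hm
    rw [Matrix.det_zero_of_column_eq hne (M := G m 0) fun b => by simp [G, hij], zero_mul]

theorem sum_perm_comp_inr {α β : Type*} [Fintype α] [DecidableEq α] [Fintype β] [DecidableEq β]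
    (F : (β → α ⊕ β) → ℂ) (hF : ∀ m, ¬ Function.Injective m → F m = 0) :
    ∑ τ : Equiv.Perm (α ⊕ β), F (τ ∘ Sum.inr) =
      ((Fintype.card α).factorial : ℂ) * ∑ m, F m := by
  have h := sum_perm_comp_inl (α := β) (β := α) (fun m => F (Equiv.sumComm β α ∘ m)) fun m hm =>
    hF _ fun h => hm h.of_comp
  rw [Equiv.sum_comp (Equiv.arrowCongr (Equiv.refl β) (Equiv.sumComm β α)) F |>.symm]
  refine Eq.trans ?_ h
  refine (Equiv.sum_comp (Equiv.permCongr (Equiv.sumComm β α)) _).symm.trans ?_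
  refine Finset.sum_congr rfl fun τ _ => congrArg F ?_
  funext b
  simp [Equiv.permCongr_apply]

/-- Integrating out the variables of a Pfaffian point process, at the level of finite sums: the
positions `β` carry the Gram matrix `h` of a skew-orthogonal family with norms `r`, and the
positions `α` carry the values `q`. -/
theorem sum_sign_prod_mul_prod_skew {α β : Type*} [Fintype α] [DecidableEq α] [Fintype β]
    [DecidableEq β] (r : α ⊕ β → ℂ) (hr : ∀ m, r m ≠ 0)
    (q : (α ⊕ β) × Fin 2 → α × Fin 2 → ℂ) (h : (α ⊕ β) × Fin 2 → (α ⊕ β) × Fin 2 → ℂ)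
    (hh : ∀ a b, h a b =
      ∑ m, r m * ((if a = (m, 0) then 1 else 0) * (if b = (m, 1) then 1 else 0)) -
        ∑ m, r m * ((if b = (m, 0) then 1 else 0) * (if a = (m, 1) then 1 else 0))) :
    ∑ σ : Equiv.Perm ((α ⊕ β) × Fin 2), ((Equiv.Perm.sign σ : ℤ) : ℂ) *
        ((∏ i : α, q (σ (Sum.inl i, 0)) (i, 0) * q (σ (Sum.inl i, 1)) (i, 1)) *
          ∏ j : β, h (σ (Sum.inr j, 0)) (σ (Sum.inr j, 1))) =
      2 ^ Fintype.card β * ((Fintype.card β).factorial : ℂ) * (∏ m, r m) *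
        (1 / ((Fintype.card α).factorial : ℂ) * ∑ m : α → α ⊕ β, (∏ i, (r (m i))⁻¹) *
          (Matrix.of fun (b jc : α × Fin 2) => q (m jc.1, jc.2) b).det) := by
  let C : (α ⊕ β) × Fin 2 → (α ⊕ β) × Fin 2 → ℂ := fun a b =>
    ∑ m, r m * ((if a = (m, 0) then 1 else 0) * (if b = (m, 1) then 1 else 0))
  have hC : ∀ a b, h a b = C a b - C b a := hh
  -- only the part `C` of the antisymmetric matrix `h = C - Cᵀ` needs to be kept.
  have h_antisymm : ∑ σ : Equiv.Perm ((α ⊕ β) × Fin 2), ((Equiv.Perm.sign σ : ℤ) : ℂ) *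
        ((∏ i : α, q (σ (Sum.inl i, 0)) (i, 0) * q (σ (Sum.inl i, 1)) (i, 1)) *
          ∏ j : β, h (σ (Sum.inr j, 0)) (σ (Sum.inr j, 1))) =
      2 ^ Fintype.card β * ∑ σ : Equiv.Perm ((α ⊕ β) × Fin 2), ((Equiv.Perm.sign σ : ℤ) : ℂ) *
        ((∏ i : α, q (σ (Sum.inl i, 0)) (i, 0) * q (σ (Sum.inl i, 1)) (i, 1)) *
          ∏ j : β, C (σ (Sum.inr j, 0)) (σ (Sum.inr j, 1))) := by
    have e1 := sum_sign_prod_antisymm (ι := α ⊕ β)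
      (Sum.elim (fun i a b => q a (i, 0) * q b (i, 1)) fun _ a b => h a b)
    have e2 := sum_sign_prod_antisymm (ι := α ⊕ β)
      (Sum.elim (fun i a b => q a (i, 0) * q b (i, 1)) fun _ a b => C a b)
    simp only [Fintype.prod_sum_type, Sum.elim_inl, Sum.elim_inr] at e1 e2
    have e3 : ∀ a b, h a b - h b a = 2 * (C a b - C b a) := by
      intro a b; rw [hC, hC]; ring
    simp_rw [e3, Finset.prod_mul_distrib (f := fun _ : β => (2 : ℂ)), Finset.prod_const,
      Finset.card_univ] at e1
    have e4 : (2 : ℂ) ^ Fintype.card (α ⊕ β) ≠ 0 := pow_ne_zero _ two_ne_zero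
    refine mul_left_cancel₀ e4 ?_
    rw [← e1, mul_left_comm, ← e2, Finset.mul_sum]
    exact Finset.sum_congr rfl fun σ _ => by ring
  -- the columns of the integrated positions `β` become unit vectors
  let D : (β → α ⊕ β) → Matrix ((α ⊕ β) × Fin 2) ((α ⊕ β) × Fin 2) ℂ := fun μ =>
    Matrix.of fun a jc => Sum.elim (fun j => q a (j, jc.2))
      (fun j => if a = (μ j, jc.2) then 1 else 0) jc.1
  have h_expand : ∑ σ : Equiv.Perm ((α ⊕ β) × Fin 2), ((Equiv.Perm.sign σ : ℤ) : ℂ) *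
        ((∏ i : α, q (σ (Sum.inl i, 0)) (i, 0) * q (σ (Sum.inl i, 1)) (i, 1)) *
          ∏ j : β, C (σ (Sum.inr j, 0)) (σ (Sum.inr j, 1))) =
      ∑ μ : β → α ⊕ β, (∏ j, r (μ j)) * (D μ).det := by
    simp_rw [C, Finset.prod_univ_sum, Fintype.piFinset_univ, Finset.mul_sum]
    rw [Finset.sum_comm]
    refine Finset.sum_congr rfl fun μ _ => ?_
    rw [Matrix.det_apply', Finset.mul_sum]
    refine Finset.sum_congr rfl fun σ _ => ?_
    rw [Finset.prod_mul_distrib (f := fun j => r (μ j)), Fintype.prod_prod_type,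
      Fintype.prod_sum_type]
    simp only [D, Matrix.of_apply, Fin.prod_univ_two, Sum.elim_inl, Sum.elim_inr]
    ring
  have h_perm : ∑ μ : β → α ⊕ β, (∏ j, r (μ j)) * (D μ).det =
      1 / ((Fintype.card α).factorial : ℂ) *
        ∑ τ : Equiv.Perm (α ⊕ β), (∏ j, r (τ (Sum.inr j))) * (D (τ ∘ Sum.inr)).det := by
    have := sum_perm_comp_inr (α := α) (β := β) (fun μ => (∏ j, r (μ j)) * (D μ).det) ?_
    · simp only [Function.comp_apply] at this
      rw [this]
      have : ((Fintype.card α).factorial : ℂ) ≠ 0 := by exact_mod_cast Nat.factorial_ne_zero _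
      field_simp
    · intro m hm
      simp only [Function.Injective, not_forall] at hm
      obtain ⟨i, j, hij, hne⟩ := hm
      rw [Matrix.det_zero_of_column_eq (M := D m) (i := (Sum.inr i, 0)) (j := (Sum.inr j, 0))
        (by simpa using hne) fun b => by simp [D, hij], mul_zero]
  have h_minor : ∀ τ : Equiv.Perm (α ⊕ β), (D (τ ∘ Sum.inr)).det =
      (Matrix.of fun (b jc : α × Fin 2) => q (τ (Sum.inl jc.1), jc.2) b).det := by
    intro τ
    have hs : Equiv.Perm.sign (Equiv.prodCongrLeft fun _ : Fin 2 => τ) = 1 := by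
      rw [Equiv.Perm.sign_prodCongrLeft, Fin.prod_univ_two, Int.units_mul_self]
    have e1 := Matrix.det_permute (Equiv.prodCongrLeft fun _ : Fin 2 => τ) (D (τ ∘ Sum.inr))
    rw [hs] at e1
    simp only [Units.val_one, Int.cast_one, one_mul] at e1
    rw [← e1]
    rw [← Matrix.det_submatrix_equiv_self (Equiv.sumProdDistrib α β (Fin 2)).symm]
    have e2 : (((D (τ ∘ Sum.inr)).submatrix (Equiv.prodCongrLeft fun _ : Fin 2 => τ) id).submatrix
        (Equiv.sumProdDistrib α β (Fin 2)).symm (Equiv.sumProdDistrib α β (Fin 2)).symm) =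
        Matrix.fromBlocks (Matrix.of fun (b jc : α × Fin 2) => q (τ (Sum.inl b.1), b.2) jc) 0
          (Matrix.of fun (b : β × Fin 2) (jc : α × Fin 2) => q (τ (Sum.inr b.1), b.2) jc) 1 := by
      ext a b
      rcases a with ⟨i, c⟩ | ⟨i, c⟩ <;> rcases b with ⟨j, d⟩ | ⟨j, d⟩ <;>
        simp [D, Matrix.one_apply]
    rw [e2, Matrix.det_fromBlocks_zero₁₂, Matrix.det_one, mul_one, ← Matrix.det_transpose]
    rfl
  rw [h_antisymm, h_expand, h_perm]
  have h_sum : ∑ τ : Equiv.Perm (α ⊕ β), (∏ j, r (τ (Sum.inr j))) * (D (τ ∘ Sum.inr)).det =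
      ((Fintype.card β).factorial : ℂ) * ((∏ m, r m) * ∑ m : α → α ⊕ β, (∏ i, (r (m i))⁻¹) *
          (Matrix.of fun (b jc : α × Fin 2) => q (m jc.1, jc.2) b).det) := by
    rw [mul_left_comm, ← sum_perm_comp_inl, Finset.mul_sum]
    · refine Finset.sum_congr rfl fun τ _ => ?_
      rw [h_minor, ← Equiv.prod_comp τ r, Fintype.prod_sum_type]
      simp only [Function.comp_apply, Finset.prod_inv_distrib]
      have : ∏ i, r (τ (Sum.inl i)) ≠ 0 := Finset.prod_ne_zero_iff.mpr fun i _ => hr _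
      field_simp
    · intro m hm
      simp only [Function.Injective, not_forall] at hm
      obtain ⟨i, j, hij, hne⟩ := hm
      rw [Matrix.det_zero_of_column_eq (i := (i, (0 : Fin 2))) (j := (j, (0 : Fin 2)))
        (by simpa using hne) fun b => by simp [hij], mul_zero]
  rw [h_sum]
  ring

/-! ### Skew-orthogonal polynomials -/

theorem areaMeasure_integral (f : ℂ → ℂ) :
    ∫ ζ, f ζ ∂areaMeasure = (Real.pi : ℂ)⁻¹ * ∫ ζ, f ζ := by
  rw [areaMeasure, integral_smul_nnreal_measure, NNReal.smul_def, Complex.real_smul]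
  simp [NNReal.coe_real_pi]

theorem integral_exp_int_mul_angle (n : ℤ) :
    ∫ θ in Set.Ioo (-Real.pi) Real.pi, Complex.exp (n * Complex.I * θ) =
      if n = 0 then (2 * Real.pi : ℂ) else 0 := by
  rw [← integral_Ioc_eq_integral_Ioo,
    ← intervalIntegral.integral_of_le (by linarith [Real.pi_pos])]
  split_ifs with h
  · subst h
    simp
    ring
  · have hn : (n : ℂ) * Complex.I ≠ 0 := mul_ne_zero (by exact_mod_cast h) Complex.I_ne_zero
    rw [integral_exp_mul_complex hn, div_eq_zero_iff]
    left
    rw [sub_eq_zero, Complex.exp_eq_exp_iff_exists_int]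
    exact ⟨n, by push_cast; ring⟩

theorem integral_pow_mul_exp_neg_mul_sq {c : ℝ} (hc : 0 < c) (a : ℕ) :
    ∫ r in Set.Ioi (0 : ℝ), r ^ (2 * a + 1) * Real.exp (-c * r ^ 2) =
      a.factorial / (2 * c ^ (a + 1)) := by
  have h := integral_rpow_mul_exp_neg_mul_rpow (p := 2) (q := 2 * a + 1) (b := c) two_pos
    (by linarith [(Nat.cast_nonneg a : (0 : ℝ) ≤ a)]) hc
  have e : ((2 * (a : ℝ) + 1 + 1) / 2) = a + 1 := by ring
  rw [neg_div, e, Real.Gamma_nat_eq_factorial, Real.rpow_neg hc.le] at h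
  rw [show ((a : ℝ) + 1) = ((a + 1 : ℕ) : ℝ) by push_cast; ring, Real.rpow_natCast] at h
  rw [show (a.factorial : ℝ) / (2 * c ^ (a + 1)) = (c ^ (a + 1))⁻¹ * (1 / 2) * a.factorial by
    field_simp, ← h]
  refine setIntegral_congr_fun measurableSet_Ioi fun r _ => ?_
  rw [show (2 * (a : ℝ) + 1) = ((2 * a + 1 : ℕ) : ℝ) by push_cast; ring, Real.rpow_natCast]
  norm_num

/-- The Gaussian moments `∫ ζ^a conj(ζ)^b exp (-c |ζ|²) dA`. -/
theorem gaussian_moment {c : ℝ} (hc : 0 < c) (a b : ℕ) :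
    ∫ ζ : ℂ, ζ ^ a * conj ζ ^ b * (Real.exp (-(c * ‖ζ‖ ^ 2)) : ℂ) ∂areaMeasure =
      if a = b then (a.factorial : ℂ) / (c : ℂ) ^ (a + 1) else 0 := by
  rw [areaMeasure_integral, ← Complex.integral_comp_polarCoord_symm, polarCoord_target]
  have h1 : ∀ p ∈ Set.Ioi (0 : ℝ) ×ˢ Set.Ioo (-Real.pi) Real.pi,
      p.1 • (Complex.polarCoord.symm p ^ a * conj (Complex.polarCoord.symm p) ^ b *
        (Real.exp (-(c * ‖Complex.polarCoord.symm p‖ ^ 2)) : ℂ)) =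
      (((p.1 ^ (a + b + 1) * Real.exp (-c * p.1 ^ 2) : ℝ) : ℂ)) *
        Complex.exp (((a : ℤ) - (b : ℤ) : ℤ) * Complex.I * p.2) := by
    rintro ⟨r, θ⟩ ⟨hr, -⟩
    have hr : 0 < r := hr
    have e1 : Complex.polarCoord.symm (r, θ) = r * Complex.exp (θ * Complex.I) := by
      rw [Complex.polarCoord_symm_apply, Complex.exp_mul_I]
      push_cast
      rfl
    have e2 : ‖Complex.polarCoord.symm (r, θ)‖ = r := by
      rw [Complex.norm_polarCoord_symm, abs_of_pos hr]
    have e3 : conj (Complex.exp (θ * Complex.I)) = Complex.exp (-(θ * Complex.I)) := by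
      rw [← Complex.exp_conj]; simp
    rw [e2, e1, map_mul, Complex.conj_ofReal, e3, mul_pow, mul_pow, ← Complex.exp_nat_mul,
      ← Complex.exp_nat_mul, Complex.real_smul]
    have e4 : Complex.exp (((a : ℤ) - (b : ℤ) : ℤ) * Complex.I * θ) =
        Complex.exp (a * (θ * Complex.I)) * Complex.exp (b * -(θ * Complex.I)) := by
      rw [← Complex.exp_add]; push_cast; ring_nf
    simp only
    rw [e4]
    push_cast
    ring_nf
  rw [setIntegral_congr_fun (measurableSet_Ioi.prod measurableSet_Ioo) h1]
  rw [Measure.volume_eq_prod, setIntegral_prod_mul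
    (fun r : ℝ => ((r ^ (a + b + 1) * Real.exp (-c * r ^ 2) : ℝ) : ℂ))
    (fun θ : ℝ => Complex.exp (((a : ℤ) - (b : ℤ) : ℤ) * Complex.I * θ)),
    integral_exp_int_mul_angle, integral_complex_ofReal]
  by_cases hab : a = b
  · subst hab
    rw [show a + a + 1 = 2 * a + 1 by ring, integral_pow_mul_exp_neg_mul_sq hc]
    have : (Real.pi : ℂ) ≠ 0 := by exact_mod_cast Real.pi_ne_zero
    have hc' : (c : ℂ) ≠ 0 := by exact_mod_cast hc.ne'
    simp only [sub_self, if_true]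
    push_cast
    field_simp
  · rw [if_neg (by omega), if_neg hab]
    simp

/-- For `a = b` integrability is read off from the value of the integral, which is not `0`. -/
theorem integrable_moment {c : ℝ} (hc : 0 < c) (a b : ℕ) :
    Integrable (fun ζ : ℂ => ζ ^ a * conj ζ ^ b * (Real.exp (-(c * ‖ζ‖ ^ 2)) : ℂ))
      areaMeasure := by
  have h0 : ∀ n : ℕ, Integrable (fun ζ : ℂ => ζ ^ n * conj ζ ^ n *
      (Real.exp (-(c * ‖ζ‖ ^ 2)) : ℂ)) areaMeasure := by
    intro n
    by_contra h
    have := integral_undef h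
    rw [gaussian_moment hc, if_pos rfl, div_eq_zero_iff] at this
    rcases this with h | h
    · exact n.factorial_ne_zero (by exact_mod_cast h)
    · exact hc.ne' (by exact_mod_cast (pow_eq_zero_iff (by omega)).mp h)
  refine ((h0 0).norm.add (h0 (a + b)).norm).mono' ?_ (Eventually.of_forall fun ζ => ?_)
  · exact Continuous.aestronglyMeasurable (by fun_prop)
  · simp only [Pi.add_apply, norm_mul, norm_pow, Complex.norm_conj, pow_zero, one_mul]
    rw [← pow_add, ← pow_add, ← one_add_mul]
    refine mul_le_mul_of_nonneg_right ?_ (norm_nonneg _)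
    rcases le_total ‖ζ‖ 1 with h | h
    · exact (pow_le_one₀ (norm_nonneg _) h).trans (le_add_of_nonneg_right (by positivity))
    · exact (pow_le_pow_right₀ h (by omega)).trans (le_add_of_nonneg_left zero_le_one)

open Polynomial in
theorem integrable_eval_mul_eval_conj {c : ℝ} (hc : 0 < c) (p q : ℂ[X]) :
    Integrable (fun ζ : ℂ => p.eval ζ * q.eval (conj ζ) * (Real.exp (-(c * ‖ζ‖ ^ 2)) : ℂ))
      areaMeasure := by
  induction p using Polynomial.induction_on' with
  | add p₁ p₂ h₁ h₂ =>
    refine (h₁.add h₂).congr (Eventually.of_forall fun ζ => ?_)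
    simp only [Pi.add_apply, eval_add, add_mul]
  | monomial n a =>
    induction q using Polynomial.induction_on' with
    | add q₁ q₂ h₁ h₂ =>
      refine (h₁.add h₂).congr (Eventually.of_forall fun ζ => ?_)
      simp only [Pi.add_apply, eval_add, add_mul, mul_add]
    | monomial m b =>
      refine ((integrable_moment hc n m).const_mul (a * b)).congr (Eventually.of_forall fun ζ => ?_)
      simp only [eval_monomial]
      ring

open Polynomial in
/-- The pairing `∫ p(ζ) q(conj ζ) (ζ - conj ζ) exp (-c |ζ|²) dA`, which is antisymmetric. -/
noncomputable def skewPairing (c : ℝ) (p q : ℂ[X]) : ℂ :=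
  ∫ ζ : ℂ, p.eval ζ * q.eval (conj ζ) * ((ζ - conj ζ) * (Real.exp (-(c * ‖ζ‖ ^ 2)) : ℂ))
    ∂areaMeasure

open Polynomial in
theorem integrable_skewPairing {c : ℝ} (hc : 0 < c) (p q : ℂ[X]) :
    Integrable (fun ζ : ℂ => p.eval ζ * q.eval (conj ζ) *
      ((ζ - conj ζ) * (Real.exp (-(c * ‖ζ‖ ^ 2)) : ℂ))) areaMeasure := by
  refine ((integrable_eval_mul_eval_conj hc (p * X) q).sub
    (integrable_eval_mul_eval_conj hc p (q * X))).congr (Eventually.of_forall fun ζ => ?_)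
  simp only [eval_mul, eval_X, Pi.sub_apply]
  ring

open Polynomial in
theorem skewPairing_add_left {c : ℝ} (hc : 0 < c) (p p' q : ℂ[X]) :
    skewPairing c (p + p') q = skewPairing c p q + skewPairing c p' q := by
  unfold skewPairing
  rw [← integral_add (integrable_skewPairing hc p q) (integrable_skewPairing hc p' q)]
  simp only [eval_add, add_mul]

open Polynomial in
theorem skewPairing_C_mul_left (c : ℝ) (a : ℂ) (p q : ℂ[X]) :
    skewPairing c (C a * p) q = a * skewPairing c p q := by
  unfold skewPairing
  rw [← integral_const_mul]
  simp only [eval_mul, eval_C, mul_assoc]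

open Polynomial in
theorem skewPairing_swap (c : ℝ) (p q : ℂ[X]) : skewPairing c p q = -skewPairing c q p := by
  unfold skewPairing
  rw [areaMeasure_integral, areaMeasure_integral, ← mul_neg, ← integral_neg]
  congr 1
  have hmp : MeasurePreserving (Complex.conjLIE : ℂ → ℂ) volume volume :=
    Complex.conjLIE.measurePreserving
  rw [← hmp.integral_comp Complex.conjLIE.toHomeomorph.measurableEmbedding]
  refine integral_congr_ae (Eventually.of_forall fun ζ => ?_)
  simp only [Complex.conjLIE_apply, Complex.conj_conj, Complex.norm_conj]
  ring

open Polynomial in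
theorem skewPairing_X_pow {c : ℝ} (hc : 0 < c) (a b : ℕ) :
    skewPairing c (X ^ a) (X ^ b) =
      (if a + 1 = b then ((a + 1).factorial : ℂ) / (c : ℂ) ^ (a + 2) else 0) -
        if a = b + 1 then (a.factorial : ℂ) / (c : ℂ) ^ (a + 1) else 0 := by
  rw [← gaussian_moment hc, ← gaussian_moment hc,
    ← integral_sub (integrable_moment hc _ _) (integrable_moment hc _ _)]
  refine integral_congr_ae (Eventually.of_forall fun ζ => ?_)
  simp only [eval_pow, eval_X]
  ring

open Polynomial in
/-- The even skew-orthogonal polynomials of the symplectic Ginibre ensemble, for the weight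
`exp (-c |ζ|²)`. -/
noncomputable def evenPoly (c : ℝ) : ℕ → ℂ[X]
  | 0 => 1
  | m + 1 => X ^ (2 * m + 2) + C ((2 * (m + 1) : ℂ) / c) * evenPoly c m

open Polynomial in
/-- The monic skew-orthogonal polynomials: those of odd degree are monomials; `skewPoly c m 0` has
degree `2m` and `skewPoly c m 1` has degree `2m + 1`. -/
noncomputable def skewPoly (c : ℝ) (m : ℕ) (d : Fin 2) : ℂ[X] :=
  if d = 0 then evenPoly c m else X ^ (2 * m + 1)

open Polynomial in
theorem evenPoly_degree_monic (c : ℝ) (m : ℕ) :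
    (evenPoly c m).Monic ∧ (evenPoly c m).natDegree = 2 * m := by
  induction m with
  | zero => simp [evenPoly]
  | succ m ih =>
    have h : (C ((2 * (m + 1) : ℂ) / c) * evenPoly c m).degree < ((2 * m + 2 : ℕ) : WithBot ℕ) := by
      refine degree_le_natDegree.trans_lt ?_
      exact_mod_cast (natDegree_C_mul_le _ _).trans_lt (by omega)
    refine ⟨monic_X_pow_add h, ?_⟩
    rw [evenPoly, natDegree_add_eq_left_of_degree_lt (by rwa [degree_X_pow]), natDegree_X_pow]
    ring

theorem skewPairing_even_odd {c : ℝ} (hc : 0 < c) (m l : ℕ) :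
    skewPairing c (evenPoly c m) (Polynomial.X ^ (2 * l + 1)) =
      if m = l then ((2 * m + 1).factorial : ℂ) / (c : ℂ) ^ (2 * m + 2) else 0 := by
  have hc' : (c : ℂ) ≠ 0 := by exact_mod_cast hc.ne'
  induction m with
  | zero =>
    have := skewPairing_X_pow hc 0 (2 * l + 1)
    rw [pow_zero] at this
    rw [evenPoly, this]
    by_cases h : l = 0
    · subst h; simp
    · rw [if_neg (by omega), if_neg (by omega), if_neg (by omega)]; simp
  | succ m ih =>
    rw [evenPoly, skewPairing_add_left hc, skewPairing_C_mul_left, ih, skewPairing_X_pow hc]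
    by_cases h1 : m = l
    · subst h1
      rw [if_neg (by omega), if_pos (by omega), if_pos rfl, if_neg (by omega),
        Nat.factorial_succ (2 * m + 1)]
      push_cast
      field_simp
      ring
    · by_cases h2 : m + 1 = l
      · subst h2
        rw [if_pos (by omega), if_neg (by omega), if_neg (by omega), if_pos rfl]
        simp only [mul_zero, sub_zero, add_zero]
        rw [show 2 * m + 2 + 1 = 2 * (m + 1) + 1 by ring, show 2 * m + 2 + 2 = 2 * (m + 1) + 2 by ring]
      · rw [if_neg (by omega), if_neg (by omega), if_neg h1, if_neg h2]
        simp

theorem skewPairing_even_even {c : ℝ} (hc : 0 < c) (m l : ℕ) :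
    skewPairing c (evenPoly c m) (evenPoly c l) = 0 := by
  have h1 : ∀ m l : ℕ, skewPairing c (evenPoly c m) (Polynomial.X ^ (2 * l)) = 0 := by
    intro m l
    induction m with
    | zero =>
      have := skewPairing_X_pow hc 0 (2 * l)
      rw [pow_zero, if_neg (by omega), if_neg (by omega)] at this
      rw [evenPoly, this, sub_zero]
    | succ m ih =>
      rw [evenPoly, skewPairing_add_left hc, skewPairing_C_mul_left, ih, skewPairing_X_pow hc,
        if_neg (by omega), if_neg (by omega)]
      simp
  induction l with
  | zero => simpa [evenPoly] using h1 m 0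
  | succ l ih =>
    rw [skewPairing_swap, evenPoly, skewPairing_add_left hc, skewPairing_C_mul_left,
      skewPairing_swap, skewPairing_swap c _ (evenPoly c m), ih]
    simpa [mul_add] using h1 m (l + 1)

theorem skewPairing_odd_odd {c : ℝ} (hc : 0 < c) (m l : ℕ) :
    skewPairing c (Polynomial.X ^ (2 * m + 1)) (Polynomial.X ^ (2 * l + 1)) = 0 := by
  rw [skewPairing_X_pow hc, if_neg (by omega), if_neg (by omega), sub_zero]

/-! ### Correlation functions for finitely many particles -/

/-- The family `(j, 0) ↦ ζ_j`, `(j, 1) ↦ conj ζ_j`. -/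
noncomputable def conjPair {ι : Type*} (ζ : ι → ℂ) (b : ι × Fin 2) : ℂ :=
  if b.2 = 0 then ζ b.1 else conj (ζ b.1)

theorem conjPair_zero {ι : Type*} (ζ : ι → ℂ) (j : ι) : conjPair ζ (j, 0) = ζ j := if_pos rfl

theorem conjPair_one {ι : Type*} (ζ : ι → ℂ) (j : ι) : conjPair ζ (j, 1) = conj (ζ j) :=
  if_neg one_ne_zero

/-- The one-point factor `(ζ - conj ζ) exp (-N |ζ|²)`. -/
noncomputable def skewWeight (N : ℕ) (ζ : ℂ) : ℂ :=
  (ζ - conj ζ) * (Real.exp (-((N : ℝ) * ‖ζ‖ ^ 2)) : ℂ)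

/-- The Vandermonde determinant of the `2n` points `ζ_j`, `conj ζ_j`, with the monomials replaced by
the monic polynomials `skewPoly`, as a product over pairs `j < l`. -/
theorem det_conjPair_eq (n : ℕ) (c : ℝ) (ζ : Fin n → ℂ) :
    (Matrix.of fun a b : Fin n × Fin 2 => (skewPoly c a.1 a.2).eval (conjPair ζ b)).det =
      ∏ j, ∏ l, (if j < l then
          (ζ l - ζ j) * (conj (ζ l) - ζ j) * ((ζ l - conj (ζ j)) * (conj (ζ l) - conj (ζ j)))
        else if j = l then conj (ζ j) - ζ j else 1) := by
  have hq : ∀ i : Fin (n * 2),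
      (skewPoly c (finProdFinEquiv.symm i).1 (finProdFinEquiv.symm i).2).natDegree = i ∧
      (skewPoly c (finProdFinEquiv.symm i).1 (finProdFinEquiv.symm i).2).Monic := by
    intro i
    obtain ⟨⟨j, d⟩, rfl⟩ := finProdFinEquiv.surjective i
    rw [Equiv.symm_apply_apply]
    unfold skewPoly
    fin_cases d
    · simpa using (evenPoly_degree_monic c j).symm
    · simp only [Fin.mk_one, Fin.isValue, one_ne_zero, if_false, Polynomial.natDegree_X_pow]
      refine ⟨?_, Polynomial.monic_X_pow _⟩
      simp [finProdFinEquiv]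
      ring
  have h := Matrix.det_eval_matrixOfPolynomials_eq_det_vandermonde
    (fun i : Fin (n * 2) => conjPair ζ (finProdFinEquiv.symm i)) _ (fun i => (hq i).1)
    (fun i => (hq i).2)
  rw [← Matrix.det_transpose, ← Matrix.det_submatrix_equiv_self finProdFinEquiv.symm]
  refine (h.symm.trans ?_)
  rw [Matrix.det_vandermonde]
  have h1 : ∀ i : Fin (n * 2), ∏ j ∈ Finset.Ioi i,
      (conjPair ζ (finProdFinEquiv.symm j) - conjPair ζ (finProdFinEquiv.symm i)) =
      ∏ j, if i < j then
        (conjPair ζ (finProdFinEquiv.symm j) - conjPair ζ (finProdFinEquiv.symm i)) else 1 := by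
    intro i
    rw [← Finset.prod_filter]
    congr 1
    ext; simp
  simp_rw [h1]
  rw [← Equiv.prod_comp finProdFinEquiv, Fintype.prod_prod_type]
  refine Finset.prod_congr rfl fun j _ => ?_
  rw [Fin.prod_univ_two, ← Equiv.prod_comp finProdFinEquiv, ← Equiv.prod_comp finProdFinEquiv,
    Fintype.prod_prod_type, Fintype.prod_prod_type, ← Finset.prod_mul_distrib]
  refine Finset.prod_congr rfl fun l _ => ?_
  simp only [Fin.prod_univ_two, Equiv.symm_apply_apply, conjPair, Fin.isValue, if_true,
    one_ne_zero, if_false, Fin.lt_def, finProdFinEquiv_apply_val, Fin.val_zero, Fin.val_one,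
    Fin.ext_iff]
  rcases lt_trichotomy (j : ℕ) l with h | h | h
  · rw [if_pos (by omega), if_pos (by omega), if_pos (by omega), if_pos (by omega), if_pos h]
  · rw [if_neg (by omega), if_pos (by omega), if_neg (by omega), if_neg (by omega),
      if_neg (by omega), if_pos h, Fin.ext h]
    ring
  · rw [if_neg (by omega), if_neg (by omega), if_neg (by omega), if_neg (by omega),
      if_neg (by omega), if_neg (by omega)]
    ring

theorem boltzmann_eq_det_fin (n N : ℕ) (c : ℝ) (ζ : Fin n → ℂ) :
    (boltzmann gaussianPotential N ζ : ℂ) = (∏ j, skewWeight N (ζ j)) *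
      (Matrix.of fun a b : Fin n × Fin 2 => (skewPoly c a.1 a.2).eval (conjPair ζ b)).det := by
  rw [det_conjPair_eq]
  have hns : ∀ z : ℂ, (‖z‖ : ℂ) ^ 2 = z * conj z := fun z => by
    rw [Complex.mul_conj, Complex.normSq_eq_norm_sq]; push_cast; rfl
  -- the product over ordered pairs is the square of the product over unordered pairs
  have h1 : ∏ j, ∏ l ∈ Finset.univ.erase j, ‖ζ j - ζ l‖ * ‖ζ j - conj (ζ l)‖ =
      ∏ j, ∏ l, if j < l then (‖ζ j - ζ l‖ * ‖ζ j - conj (ζ l)‖) ^ 2 else 1 := by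
    have hs : ∀ j l, ‖ζ j - ζ l‖ * ‖ζ j - conj (ζ l)‖ = ‖ζ l - ζ j‖ * ‖ζ l - conj (ζ j)‖ := by
      intro j l
      rw [norm_sub_rev (ζ j) (ζ l), ← Complex.norm_conj (ζ j - conj (ζ l)), map_sub,
        Complex.conj_conj, norm_sub_rev (conj (ζ j))]
    have e1 : ∀ j, ∏ l ∈ Finset.univ.erase j, ‖ζ j - ζ l‖ * ‖ζ j - conj (ζ l)‖ =
        (∏ l, if j < l then ‖ζ j - ζ l‖ * ‖ζ j - conj (ζ l)‖ else 1) *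
          ∏ l, if l < j then ‖ζ j - ζ l‖ * ‖ζ j - conj (ζ l)‖ else 1 := by
      intro j
      rw [← Finset.prod_mul_distrib, ← Finset.prod_erase (a := j) Finset.univ (by simp)]
      refine Finset.prod_congr rfl fun l hl => ?_
      rcases lt_or_gt_of_ne (Finset.ne_of_mem_erase hl) with h | h
      · rw [if_neg h.not_gt, if_pos h, one_mul]
      · rw [if_pos h, if_neg h.not_gt, mul_one]
    simp_rw [e1]
    rw [Finset.prod_mul_distrib, Finset.prod_comm (f := fun j l =>
      if l < j then ‖ζ j - ζ l‖ * ‖ζ j - conj (ζ l)‖ else 1), ← Finset.prod_mul_distrib]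
    refine Finset.prod_congr rfl fun j _ => ?_
    rw [← Finset.prod_mul_distrib]
    refine Finset.prod_congr rfl fun l _ => ?_
    split_ifs
    · rw [hs l j, sq]
    · rw [one_mul]
  have h2 : ∀ j, ∏ l, (if j < l then
          (ζ l - ζ j) * (conj (ζ l) - ζ j) * ((ζ l - conj (ζ j)) * (conj (ζ l) - conj (ζ j)))
        else if j = l then conj (ζ j) - ζ j else 1) =
      (∏ l, if j < l then ((‖ζ j - ζ l‖ * ‖ζ j - conj (ζ l)‖) ^ 2 : ℂ) else 1) *
        (conj (ζ j) - ζ j) := by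
    intro j
    have e1 : conj (ζ j) - ζ j = ∏ l, if j = l then conj (ζ j) - ζ j else 1 := by simp
    conv_rhs => rw [e1]
    rw [← Finset.prod_mul_distrib]
    refine Finset.prod_congr rfl fun l _ => ?_
    by_cases h : j < l
    · rw [if_pos h, if_pos h, if_neg h.ne, mul_one, mul_pow, hns, hns]
      simp only [map_sub, Complex.conj_conj]
      ring
    · rw [if_neg h, if_neg h, one_mul]
  unfold boltzmann
  rw [h1]
  simp_rw [h2]
  push_cast
  conv_rhs => rw [Finset.prod_mul_distrib, mul_left_comm, ← Finset.prod_mul_distrib]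
  congr 1
  · refine Finset.prod_congr rfl fun j _ => Finset.prod_congr rfl fun l _ => ?_
    split_ifs <;> simp
  · refine Finset.prod_congr rfl fun j _ => ?_
    rw [hns, skewWeight, gaussianPotential]
    simp only [map_sub, Complex.conj_conj]
    push_cast
    ring

theorem boltzmann_comp_equiv {ι κ : Type} [Fintype ι] [DecidableEq ι] [Fintype κ] [DecidableEq κ]
    (Q : ℂ → ℝ) (N : ℕ) (e : κ ≃ ι) (ζ : ι → ℂ) : boltzmann Q N (ζ ∘ e) = boltzmann Q N ζ := by
  unfold boltzmann
  rw [← Equiv.prod_comp e, ← Equiv.prod_comp e (fun j => ‖ζ j - conj (ζ j)‖ ^ 2 * _)]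
  congr 1
  refine Finset.prod_congr rfl fun j _ => ?_
  refine Finset.prod_bij' (fun l _ => e l) (fun l _ => e.symm l) ?_ ?_ ?_ ?_ ?_ <;>
    simp [Equiv.symm_apply_eq]

/-- The Boltzmann factor as a determinant. The points may be indexed by any type `ι`, in particular
by `Fin k ⊕ Fin m`, the fixed points and those which are integrated out. -/
theorem boltzmann_eq_det {ι : Type} [Fintype ι] [DecidableEq ι] {n : ℕ} (e : ι ≃ Fin n) (N : ℕ)
    (c : ℝ) (ζ : ι → ℂ) :
    (boltzmann gaussianPotential N ζ : ℂ) = (∏ j, skewWeight N (ζ j)) *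
      (Matrix.of fun a b : ι × Fin 2 => (skewPoly c (e a.1) a.2).eval (conjPair ζ b)).det := by
  rw [← boltzmann_comp_equiv _ N e.symm, boltzmann_eq_det_fin n N c, ← Equiv.prod_comp e,
    ← Matrix.det_submatrix_equiv_self (e.prodCongr (Equiv.refl (Fin 2)))]
  congr 2
  · funext j; simp
  · ext a b
    simp [conjPair]

/-- The skew norm of `skewPoly c m`, that is, the pairing of its even and its odd member. -/
noncomputable def skewNorm (c : ℝ) (m : ℕ) : ℂ := ((2 * m + 1).factorial : ℂ) / (c : ℂ) ^ (2 * m + 2)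

theorem skewNorm_ne_zero {c : ℝ} (hc : 0 < c) (m : ℕ) : skewNorm c m ≠ 0 :=
  div_ne_zero (by exact_mod_cast Nat.factorial_ne_zero _)
    (pow_ne_zero _ (by exact_mod_cast hc.ne'))

/-- The Gram matrix of the polynomials `skewPoly` is block diagonal with blocks
`!![0, r; -r, 0]`, `r = skewNorm c m`. -/
theorem skewPairing_skewPoly {c : ℝ} (hc : 0 < c) {ι : Type*} [Fintype ι] [DecidableEq ι]
    (e : ι → ℕ) (he : Function.Injective e) (a b : ι × Fin 2) :
    skewPairing c (skewPoly c (e a.1) a.2) (skewPoly c (e b.1) b.2) =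
      ∑ m, skewNorm c (e m) * ((if a = (m, 0) then 1 else 0) * (if b = (m, 1) then 1 else 0)) -
        ∑ m, skewNorm c (e m) *
          ((if b = (m, 0) then 1 else 0) * (if a = (m, 1) then 1 else 0)) := by
  have key : ∀ i j : ι, ∑ m, skewNorm c (e m) *
      ((if i = m then (1 : ℂ) else 0) * (if j = m then 1 else 0)) =
      if i = j then skewNorm c (e i) else 0 := by
    intro i j
    rcases eq_or_ne i j with h | h <;> simp [h]
  obtain ⟨i, d⟩ := a
  obtain ⟨j, d'⟩ := b
  fin_cases d <;> fin_cases d' <;>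
    simp only [skewPoly, Fin.zero_eta, Fin.mk_one, Fin.isValue, if_true, one_ne_zero, if_false,
      Prod.mk.injEq, and_true, and_false, zero_ne_one, mul_zero, zero_mul, Finset.sum_const_zero,
      sub_zero, zero_sub, sub_self, key]
  · exact skewPairing_even_even hc _ _
  · rw [skewPairing_even_odd hc]
    simp only [he.eq_iff, skewNorm]
  · rw [skewPairing_swap, skewPairing_even_odd hc]
    simp only [he.eq_iff, skewNorm]
  · exact skewPairing_odd_odd hc _ _

/-- The kernel built from the first `n` pairs of skew-orthogonal polynomials. -/
noncomputable def skewKernel (c : ℝ) (n : ℕ) (x y : ℂ) : ℂ :=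
  ∑ m ∈ Finset.range n, (skewNorm c m)⁻¹ *
    ((skewPoly c m 0).eval x * (skewPoly c m 1).eval y -
      (skewPoly c m 1).eval x * (skewPoly c m 0).eval y)

/-- Integrating `m` of the `k + m` points out of the Boltzmann factor. The case `k = 0` is the
partition function. -/
theorem integral_boltzmann {N : ℕ} (hN : 1 ≤ N) (k m : ℕ) (z : Fin k → ℂ) :
    ∫ w : Fin m → ℂ, (boltzmann gaussianPotential N (Sum.elim z w) : ℂ)
        ∂(Measure.pi fun _ => areaMeasure) =
      2 ^ m * (m.factorial : ℂ) * (∏ i ∈ Finset.range (k + m), skewNorm N i) *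
        ((∏ i, skewWeight N (z i)) *
          pf fun a b => skewKernel N (k + m) (conjPair z a) (conjPair z b)) := by
  have hc : (0 : ℝ) < N := by exact_mod_cast hN
  set e : Fin k ⊕ Fin m ≃ Fin (k + m) := finSumFinEquiv with he
  let p : (Fin k ⊕ Fin m) × Fin 2 → Polynomial ℂ := fun a => skewPoly N (e a.1) a.2
  let I : Equiv.Perm ((Fin k ⊕ Fin m) × Fin 2) → Fin m → ℂ → ℂ := fun σ j w =>
    (p (σ (Sum.inr j, 0))).eval w * (p (σ (Sum.inr j, 1))).eval (conj w) * skewWeight N w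
  have h1 : ∀ w : Fin m → ℂ, (boltzmann gaussianPotential N (Sum.elim z w) : ℂ) =
      ∑ σ : Equiv.Perm ((Fin k ⊕ Fin m) × Fin 2), (∏ i, skewWeight N (z i)) *
        (((Equiv.Perm.sign σ : ℤ) : ℂ) * ∏ i, (p (σ (Sum.inl i, 0))).eval (conjPair z (i, 0)) *
          (p (σ (Sum.inl i, 1))).eval (conjPair z (i, 1))) * ∏ j, I σ j (w j) := by
    intro w
    rw [boltzmann_eq_det e N N, Matrix.det_apply', Finset.mul_sum]
    refine Finset.sum_congr rfl fun σ _ => ?_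
    rw [Fintype.prod_prod_type, Fintype.prod_sum_type, Fintype.prod_sum_type]
    simp only [I, Fin.prod_univ_two, Matrix.of_apply, Sum.elim_inl, Sum.elim_inr, conjPair,
      Finset.prod_mul_distrib, p, if_true, Fin.isValue, one_ne_zero, if_false]
    ring
  have h2 : ∀ σ j, Integrable (I σ j) areaMeasure := fun σ j => integrable_skewPairing hc _ _
  have h3 : ∀ σ j, ∫ w, I σ j w ∂areaMeasure =
      skewPairing N (p (σ (Sum.inr j, 0))) (p (σ (Sum.inr j, 1))) := fun σ j => rfl
  simp_rw [h1]
  rw [integral_finsetSum _ fun σ _ => (Integrable.fintype_prod (h2 σ)).const_mul _]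
  simp_rw [integral_const_mul, integral_fintype_prod_eq_prod, h3, mul_assoc, ← Finset.mul_sum]
  have hinj : Function.Injective fun i : Fin k ⊕ Fin m => ((e i : Fin (k + m)) : ℕ) :=
    Fin.val_injective.comp e.injective
  have h4 := sum_sign_prod_mul_prod_skew (α := Fin k) (β := Fin m)
    (fun i => skewNorm N (e i)) (fun i => skewNorm_ne_zero hc _)
    (fun a b => (p a).eval (conjPair z b)) (fun a b => skewPairing N (p a) (p b))
    (fun a b => skewPairing_skewPoly hc _ hinj a b)
  rw [h4]
  have h5 := pf_eq_sum_det (k := k) (fun i : Fin k ⊕ Fin m => (skewNorm N (e i))⁻¹)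
    (fun i c b => (skewPoly N (e i) c).eval (conjPair z b))
  simp only [Fintype.card_fin]
  rw [← h5]
  have h6 : ∀ f : ℕ → ℂ, ∑ i : Fin k ⊕ Fin m, f (e i) = ∑ i ∈ Finset.range (k + m), f i := by
    intro f
    rw [Equiv.sum_comp e fun i => f i, Fin.sum_univ_eq_sum_range]
  have h7 : ∏ i : Fin k ⊕ Fin m, skewNorm N (e i) =
      ∏ i ∈ Finset.range (k + m), skewNorm N i := by
    rw [Equiv.prod_comp e fun i => skewNorm N i, Fin.prod_univ_eq_prod_range]
  have h8 : (fun a b => ∑ i : Fin k ⊕ Fin m, (skewNorm N (e i))⁻¹ *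
      ((skewPoly N (e i) 0).eval (conjPair z a) * (skewPoly N (e i) 1).eval (conjPair z b) -
        (skewPoly N (e i) 1).eval (conjPair z a) * (skewPoly N (e i) 0).eval (conjPair z b))) =
      fun a b => skewKernel N (k + m) (conjPair z a) (conjPair z b) := by
    funext a b
    exact h6 fun i => (skewNorm N i)⁻¹ *
      ((skewPoly N i 0).eval (conjPair z a) * (skewPoly N i 1).eval (conjPair z b) -
        (skewPoly N i 1).eval (conjPair z a) * (skewPoly N i 0).eval (conjPair z b))
  rw [h7, h8]
  ring

/-- The symplectic Ginibre ensemble is a Pfaffian point process. -/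
theorem correlation_eq_pf {N k : ℕ} (hN : 1 ≤ N) (hk : k ≤ N) (z : Fin k → ℂ) :
    (correlation gaussianPotential N k z : ℂ) = (∏ i, skewWeight N (z i) / 2) *
      pf fun a b => skewKernel N N (conjPair z a) (conjPair z b) := by
  have hc : (0 : ℝ) < N := by exact_mod_cast hN
  have hZ : (partitionFunction gaussianPotential N : ℂ) =
      2 ^ N * (N.factorial : ℂ) * ∏ i ∈ Finset.range N, skewNorm N i := by
    have h := integral_boltzmann hN 0 N Fin.elim0
    have h0 : ∀ w : Fin N → ℂ, boltzmann gaussianPotential N (Sum.elim Fin.elim0 w) =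
        boltzmann gaussianPotential N w := fun w =>
      boltzmann_comp_equiv _ N (Equiv.emptySum (Fin 0) (Fin N)) w ▸ by
        congr 1
        funext x
        rcases x with x | x
        · exact x.elim0
        · rfl
    simp_rw [h0] at h
    rw [integral_complex_ofReal] at h
    rw [partitionFunction, h]
    simp [pf]
  obtain ⟨m, rfl⟩ := Nat.exists_eq_add_of_le hk
  have h := integral_boltzmann hN k m z
  rw [integral_complex_ofReal] at h
  unfold correlation
  push_cast
  rw [show k + m - k = m by omega, h, hZ]
  have hd : ((k + m).descFactorial k : ℂ) * (m.factorial : ℂ) = ((k + m).factorial : ℂ) := by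
    have := Nat.factorial_mul_descFactorial (n := k + m) (k := k) (by omega)
    rw [show k + m - k = m by omega] at this
    rw [← this]
    push_cast
    ring
  have hp : (∏ i ∈ Finset.range (k + m), skewNorm ((k + m : ℕ) : ℝ) i) ≠ 0 :=
    Finset.prod_ne_zero_iff.mpr fun i _ => skewNorm_ne_zero hc i
  have hf : ((k + m).factorial : ℂ) ≠ 0 := by exact_mod_cast Nat.factorial_ne_zero _
  rw [Finset.prod_div_distrib, Finset.prod_const, Finset.card_univ, Fintype.card_fin, ← hd] at *
  have hf1 := left_ne_zero_of_mul hf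
  have hf2 := right_ne_zero_of_mul hf
  push_cast at hp ⊢
  field_simp
  ring

/-! ### Microscopic coordinates -/

theorem laplacian_gaussianPotential (ζ : ℂ) : Laplacian.laplacian gaussianPotential ζ = 4 := by
  rw [InnerProductSpace.laplacian_eq_iteratedFDeriv_complexPlane]
  have h1 : ∀ z v : ℂ, fderiv ℝ gaussianPotential z v = 2 * (z.re * v.re + z.im * v.im) := by
    intro z v
    have : HasFDerivAt gaussianPotential (2 • (innerSL ℝ z)) z := by
      have := (hasStrictFDerivAt_norm_sq z).hasFDerivAt
      exact this
    rw [this.fderiv]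
    simp [Complex.inner]
    ring
  have h2 : ∀ v : ℂ, iteratedFDeriv ℝ 2 gaussianPotential ζ ![v, v] =
      2 * (v.re * v.re + v.im * v.im) := by
    intro v
    rw [iteratedFDeriv_two_apply]
    have hd : ContDiff ℝ 2 gaussianPotential := contDiff_norm_sq ℝ
    have hdd : DifferentiableAt ℝ (fderiv ℝ gaussianPotential) ζ :=
      (hd.fderiv_right (m := 1) (by norm_num)).differentiable (by norm_num) ζ
    have e : fderiv ℝ (fderiv ℝ gaussianPotential) ζ v v =
        fderiv ℝ (fun z => fderiv ℝ gaussianPotential z v) ζ v := by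
      rw [fderiv_clm_apply hdd (by fun_prop)]
      simp
    simp only [Matrix.cons_val_zero, Matrix.cons_val_one]
    rw [e]
    simp_rw [h1]
    have h3 : HasFDerivAt (fun z : ℂ => 2 * (z.re * v.re + z.im * v.im))
        ((2 : ℝ) • (v.re • Complex.reCLM + v.im • Complex.imCLM)) ζ := by
      have := (((Complex.reCLM.hasFDerivAt (x := ζ)).mul_const v.re).add
        ((Complex.imCLM.hasFDerivAt (x := ζ)).mul_const v.im)).const_mul 2
      exact this
    rw [h3.fderiv]
    simp
    ring
  simp [h2]
  norm_num

theorem IsMicroScale.sq_eq {N : ℕ} {p : ℂ} {r : ℝ} (h : IsMicroScale gaussianPotential N p r) :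
    r ^ 2 = 2 / N := by
  obtain ⟨hr, h⟩ := h
  simp_rw [laplacian_gaussianPotential] at h
  rw [setIntegral_const, areaMeasure] at h
  simp only [Measure.real, Measure.smul_apply, Complex.volume_ball] at h
  rw [ENNReal.smul_def, smul_eq_mul, smul_eq_mul, ENNReal.toReal_mul, ENNReal.toReal_mul,
    ENNReal.toReal_pow, ENNReal.toReal_ofReal hr.le] at h
  simp at h
  have := Real.pi_ne_zero
  field_simp at h
  exact h

/-- The truncated exponential series `∑_{l < n} X^{2l} / l!`. -/
noncomputable def truncExpSq (n : ℕ) (X : ℂ) : ℂ :=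
  ∑ l ∈ Finset.range n, X ^ (2 * l) / (l.factorial : ℂ)

/-- The coefficient `4^m m! / (2m + 1)!` of the kernel in microscopic coordinates. -/
noncomputable def oddCoeff (m : ℕ) : ℂ := 4 ^ m * (m.factorial : ℂ) / ((2 * m + 1).factorial : ℂ)

/-- The skew-orthogonal polynomial kernel in the microscopic coordinates `ζ = √(2/N) X`, up to
a factor; see `skewKernel_eq_microKernel`. -/
noncomputable def microKernel (n : ℕ) (X Y : ℂ) : ℂ :=
  ∑ m ∈ Finset.range n, oddCoeff m *
    (truncExpSq (m + 1) X * Y ^ (2 * m + 1) - X ^ (2 * m + 1) * truncExpSq (m + 1) Y)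

theorem evenPoly_eval {N : ℕ} (hN : 1 ≤ N) {ρ : ℂ} (hρ : ρ ^ 2 = 2 / N) (m : ℕ) (X : ℂ) :
    (evenPoly N m).eval (ρ * X) =
      (m.factorial : ℂ) * (2 / N) ^ m * truncExpSq (m + 1) X := by
  have hN' : (N : ℂ) ≠ 0 := by exact_mod_cast (by omega : N ≠ 0)
  induction m with
  | zero => simp [evenPoly, truncExpSq]
  | succ m ih =>
    have e : (ρ * X) ^ (2 * m + 2) = (2 / N) ^ (m + 1) * X ^ (2 * (m + 1)) := by
      rw [mul_pow, ← hρ, ← pow_mul]; ring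
    have hf : ((m + 1).factorial : ℂ) ≠ 0 := by exact_mod_cast Nat.factorial_ne_zero _
    rw [evenPoly, Polynomial.eval_add, Polynomial.eval_mul, Polynomial.eval_pow, Polynomial.eval_X,
      Polynomial.eval_C, ih, e, truncExpSq, truncExpSq, Finset.sum_range_succ _ (m + 1)]
    have e2 : ((m + 1).factorial : ℂ) = (m + 1) * m.factorial := by
      rw [Nat.factorial_succ]; push_cast; rfl
    generalize ∑ l ∈ Finset.range (m + 1), X ^ (2 * l) / (l.factorial : ℂ) = S
    have e3 : ((m + 1).factorial : ℂ) * (2 / N) ^ (m + 1) *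
        (S + X ^ (2 * (m + 1)) / ((m + 1).factorial : ℂ)) =
        ((m + 1).factorial : ℂ) * (2 / N) ^ (m + 1) * S + (2 / N) ^ (m + 1) * X ^ (2 * (m + 1)) := by
      field_simp
    rw [e3, e2]
    push_cast
    ring

theorem skewKernel_eq_microKernel {N : ℕ} (hN : 1 ≤ N) {ρ : ℂ} (hρ : ρ ^ 2 = 2 / N) (X Y : ℂ) :
    skewKernel N N (ρ * X) (ρ * Y) = ρ * N ^ 2 * microKernel N X Y := by
  have hN' : (N : ℂ) ≠ 0 := by exact_mod_cast (by omega : N ≠ 0)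
  unfold skewKernel microKernel
  rw [Finset.mul_sum]
  refine Finset.sum_congr rfl fun m _ => ?_
  have e : ∀ Z : ℂ, (skewPoly N m 1).eval (ρ * Z) = ρ * (2 / N) ^ m * Z ^ (2 * m + 1) := by
    intro Z
    rw [← hρ]
    simp only [skewPoly, Fin.isValue, one_ne_zero, if_false, Polynomial.eval_pow,
      Polynomial.eval_X]
    ring
  rw [e, e]
  simp only [skewPoly, if_true]
  rw [evenPoly_eval hN hρ, evenPoly_eval hN hρ, skewNorm, oddCoeff]
  have h4 : (4 : ℂ) ^ m = 2 ^ m * 2 ^ m := by rw [← mul_pow]; norm_num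
  have hf : ((2 * m + 1).factorial : ℂ) ≠ 0 := by exact_mod_cast Nat.factorial_ne_zero _
  rw [h4]
  push_cast
  simp only [div_pow]
  field_simp
  ring

/-- Because of this symmetry both signs of the base point lead to the same limit. -/
theorem microKernel_mul {s : ℂ} (hs : s ^ 2 = 1) (n : ℕ) (X Y : ℂ) :
    microKernel n (s * X) (s * Y) = s * microKernel n X Y := by
  have h1 : ∀ (Z : ℂ) (l : ℕ), (s * Z) ^ (2 * l) = Z ^ (2 * l) := fun Z l => by
    rw [mul_pow, pow_mul, hs, one_pow, one_mul]
  have h2 : ∀ (Z : ℂ) (l : ℕ), (s * Z) ^ (2 * l + 1) = s * Z ^ (2 * l + 1) := fun Z l => by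
    rw [pow_succ, h1]; ring
  unfold microKernel truncExpSq
  simp_rw [h1, h2]
  rw [Finset.mul_sum]
  exact Finset.sum_congr rfl fun m _ => by ring

/-- The kernel `exp (-X² - Y²) microKernel n X Y`. Unlike `microKernel` it has a limit at
`X = √n + x`, `Y = √n + y`. -/
noncomputable def dampedKernel (n : ℕ) (X Y : ℂ) : ℂ :=
  Complex.exp (-X ^ 2 - Y ^ 2) * microKernel n X Y

/-- The rescaled correlation function at a point `p` with normal `ν`, where the rescaled points are
`p + ν r z_j = ± r X_j`. -/
theorem rescaledCorrelation_eq {N k : ℕ} (hN : 1 ≤ N) (hk : k ≤ N) {p ν : ℂ} {r s : ℝ}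
    (hr : r ^ 2 = 2 / N) (hs : s ^ 2 = 1) (z X : Fin k → ℂ)
    (hX : ∀ j, p + ν * r * z j = r * (s * X j)) :
    (rescaledCorrelation gaussianPotential N k p ν r z : ℂ) =
      (∏ j, 2 * (X j - conj (X j)) * Complex.exp ((X j - conj (X j)) ^ 2)) *
        pf fun a b => dampedKernel N (conjPair X a) (conjPair X b) := by
  have hN' : (N : ℂ) ≠ 0 := by exact_mod_cast (by omega : N ≠ 0)
  have hr' : (r : ℂ) ^ 2 = 2 / N := by rw [← Complex.ofReal_pow, hr]; push_cast; rfl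
  have hs' : (s : ℂ) ^ 2 = 1 := by rw [← Complex.ofReal_pow, hs]; push_cast; rfl
  have e1 : ∀ a, conjPair (fun j => p + ν * r * z j) a = r * (s * conjPair X a) := by
    intro a
    unfold conjPair
    split_ifs <;> simp [hX]
  have e2 : (pf fun a b => skewKernel N N (conjPair (fun j => p + ν * r * z j) a)
      (conjPair (fun j => p + ν * r * z j) b)) =
      (r * N ^ 2 * s : ℂ) ^ k * ((∏ j, Complex.exp (X j ^ 2 + conj (X j) ^ 2)) *
        pf fun a b => dampedKernel N (conjPair X a) (conjPair X b)) := by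
    have := pf_weight (k := k) (fun a => Complex.exp (conjPair X a ^ 2))
      fun a b => dampedKernel N (conjPair X a) (conjPair X b)
    simp only [conjPair_zero, conjPair_one, ← Complex.exp_add] at this
    rw [← this, ← pf_smul]
    refine pf_congr fun a b _ => ?_
    rw [e1, e1, skewKernel_eq_microKernel hN hr', microKernel_mul hs', dampedKernel,
      ← mul_assoc (Complex.exp _), ← Complex.exp_add,
      show conjPair X a ^ 2 + conjPair X b ^ 2 + (-conjPair X a ^ 2 - conjPair X b ^ 2) = 0 by ring,
      Complex.exp_zero]
    ring
  have e3 : ∀ j, (r : ℂ) ^ 2 * (skewWeight N (p + ν * r * z j) / 2) * (r * N ^ 2 * s) *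
      Complex.exp (X j ^ 2 + conj (X j) ^ 2) =
      2 * (X j - conj (X j)) * Complex.exp ((X j - conj (X j)) ^ 2) := by
    intro j
    have hn : (N : ℝ) * ‖(r * (s * X j) : ℂ)‖ ^ 2 = 2 * ‖X j‖ ^ 2 := by
      have hN'' : (N : ℝ) ≠ 0 := by exact_mod_cast (by omega : N ≠ 0)
      rw [norm_mul, norm_mul, mul_pow, mul_pow, Complex.norm_real, Complex.norm_real,
        Real.norm_eq_abs, Real.norm_eq_abs, sq_abs, sq_abs, hr, hs]
      field_simp
    have hx : (‖X j‖ : ℂ) ^ 2 = X j * conj (X j) := by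
      rw [Complex.mul_conj, Complex.normSq_eq_norm_sq]; push_cast; rfl
    have he : Complex.exp ((X j - conj (X j)) ^ 2) =
        Complex.exp (-(2 * (X j * conj (X j)))) * Complex.exp (X j ^ 2 + conj (X j) ^ 2) := by
      rw [← Complex.exp_add]; ring_nf
    rw [he, hX, skewWeight, hn]
    push_cast
    rw [hx]
    simp only [map_mul, Complex.conj_ofReal]
    have h4 : (r : ℂ) ^ 2 * (r * (s * X j) - r * (s * conj (X j))) / 2 * (r * N ^ 2 * s) =
        2 * (X j - conj (X j)) := by
      calc _ = ((r : ℂ) ^ 2) ^ 2 * N ^ 2 / 2 * (s : ℂ) ^ 2 * (X j - conj (X j)) := by ring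
        _ = _ := by rw [hr', hs']; field_simp
    rw [← h4]
    ring
  simp_rw [← e3]
  unfold rescaledCorrelation
  push_cast
  rw [correlation_eq_pf hN hk, e2]
  simp only [Finset.prod_mul_distrib, Finset.prod_const, Finset.card_univ, Fintype.card_fin]
  rw [pow_mul]
  ring

/-! ### The complementary error function as a Laplace transform -/

theorem integrableOn_pow_mul_exp {k : ℝ} (hk : 0 < k) (c : ℝ) (n : ℕ) :
    IntegrableOn (fun u : ℝ => u ^ n * Real.exp (-k * u ^ 2 + c * u)) (Set.Ioi 0) := by
  have h0 : Integrable fun u : ℝ => (n.factorial : ℝ) * Real.exp (-k * u ^ 2 + (c + 1) * u) := by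
    refine Integrable.const_mul ?_ _
    have := (integrable_cexp_quadratic (b := (k : ℂ)) (by simpa using hk) ((c + 1 : ℝ) : ℂ) 0).norm
    refine this.congr (Eventually.of_forall fun u => ?_)
    simp only [Complex.norm_exp]
    congr 1
    simp [← Complex.ofReal_pow]
  refine h0.integrableOn.mono' (Continuous.aestronglyMeasurable (by fun_prop)) ?_
  refine (ae_restrict_mem measurableSet_Ioi).mono fun u hu => ?_
  have hu : (0 : ℝ) < u := hu
  rw [Real.norm_of_nonneg (by positivity)]
  have h1 := Real.pow_div_factorial_le_exp u hu.le n
  rw [div_le_iff₀ (by positivity)] at h1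
  calc u ^ n * Real.exp (-k * u ^ 2 + c * u)
      ≤ (Real.exp u * n.factorial) * Real.exp (-k * u ^ 2 + c * u) := by gcongr
    _ = n.factorial * Real.exp (-k * u ^ 2 + (c + 1) * u) := by
        rw [show -k * u ^ 2 + (c + 1) * u = u + (-k * u ^ 2 + c * u) by ring, Real.exp_add u]
        ring

/-- The function `h(b) = ∫_0^∞ exp (-s² - b s) ds`, which is a multiple of
`exp (b² / 4) erfc (b / 2)`. -/
noncomputable def gaussLaplace (b : ℂ) : ℂ :=
  ∫ s in Set.Ioi (0 : ℝ), Complex.exp (-(s : ℂ) ^ 2 - b * s)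

theorem norm_exp_neg_sq_sub (b : ℂ) (s : ℝ) :
    ‖Complex.exp (-(s : ℂ) ^ 2 - b * s)‖ = Real.exp (-1 * s ^ 2 + -b.re * s) := by
  rw [Complex.norm_exp]
  congr 1
  simp [← Complex.ofReal_pow, sub_eq_add_neg]

theorem integrableOn_pow_mul_cexp (b : ℂ) (n : ℕ) :
    IntegrableOn (fun s : ℝ => (s : ℂ) ^ n * Complex.exp (-(s : ℂ) ^ 2 - b * s)) (Set.Ioi 0) := by
  refine (integrableOn_pow_mul_exp one_pos (-b.re) n).mono'
    (Continuous.aestronglyMeasurable (by fun_prop)) ?_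
  refine (ae_restrict_mem measurableSet_Ioi).mono fun u hu => ?_
  have hu : (0 : ℝ) < u := hu
  rw [norm_mul, norm_pow, Complex.norm_real, Real.norm_of_nonneg hu.le, norm_exp_neg_sq_sub]

theorem tendsto_exp_neg_sq_add (k : ℝ) (hk : 0 < k) (c : ℝ) (n : ℕ) :
    Tendsto (fun u : ℝ => u ^ n * Real.exp (-k * u ^ 2 + c * u)) atTop (𝓝 0) := by
  have h1 := Real.tendsto_pow_mul_exp_neg_atTop_nhds_zero n
  refine tendsto_of_tendsto_of_tendsto_of_le_of_le' tendsto_const_nhds h1 ?_ ?_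
  · filter_upwards [eventually_ge_atTop 0] with u hu
    positivity
  · filter_upwards [eventually_ge_atTop 0, eventually_ge_atTop ((c + 1) / k)] with u hu h2
    rw [div_le_iff₀ hk] at h2
    gcongr
    nlinarith

/-- Integration by parts in the integral defining `gaussLaplace`. -/
theorem mul_gaussLaplace (b : ℂ) :
    b * gaussLaplace b =
      1 + 2 * ∫ s in Set.Ioi (0 : ℝ), -(s : ℂ) * Complex.exp (-(s : ℂ) ^ 2 - b * s) := by
  have h2 : ∫ s in Set.Ioi (0 : ℝ), (-2 * (s : ℂ) - b) * Complex.exp (-(s : ℂ) ^ 2 - b * s) =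
      0 - Complex.exp (-((0 : ℝ) : ℂ) ^ 2 - b * (0 : ℝ)) := by
    refine integral_Ioi_of_hasDerivAt_of_tendsto'
      (f := fun s : ℝ => Complex.exp (-(s : ℂ) ^ 2 - b * s)) (fun s _ => ?_) ?_ ?_
    · have h := ((((hasDerivAt_id (s : ℂ)).pow 2).neg).sub
        ((hasDerivAt_id (s : ℂ)).const_mul b)).cexp.comp_ofReal
      simpa [mul_comm] using h
    · refine (((integrableOn_pow_mul_cexp b 1).const_mul (-2)).sub
        ((integrableOn_pow_mul_cexp b 0).const_mul b)).congr (Eventually.of_forall fun s => ?_)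
      simp only [Pi.sub_apply]
      ring
    · rw [tendsto_zero_iff_norm_tendsto_zero]
      simp_rw [norm_exp_neg_sq_sub]
      simpa using tendsto_exp_neg_sq_add 1 one_pos (-b.re) 0
  have h3 : ∫ s in Set.Ioi (0 : ℝ), (-2 * (s : ℂ) - b) * Complex.exp (-(s : ℂ) ^ 2 - b * s) =
      2 * (∫ s in Set.Ioi (0 : ℝ), -(s : ℂ) * Complex.exp (-(s : ℂ) ^ 2 - b * s)) -
        b * gaussLaplace b := by
    rw [gaussLaplace, ← integral_const_mul, ← integral_const_mul, ← integral_sub]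
    · congr 1
      funext s
      ring
    · refine ((integrableOn_pow_mul_cexp b 1).const_mul (-2)).congr
        (Eventually.of_forall fun s => ?_)
      simp only
      ring
    · simpa using (integrableOn_pow_mul_cexp b 0).const_mul b
  rw [h2] at h3
  simp only [Complex.ofReal_zero, mul_zero, sub_zero, zero_sub, ne_eq, OfNat.ofNat_ne_zero,
    not_false_eq_true, zero_pow, neg_zero, Complex.exp_zero] at h3
  linear_combination h3

/-- `2 h'(b) = b h(b) - 1`. -/
theorem hasDerivAt_gaussLaplace (b : ℂ) :
    HasDerivAt gaussLaplace ((b * gaussLaplace b - 1) / 2) b := by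
  have h1 : HasDerivAt gaussLaplace
      (∫ s in Set.Ioi (0 : ℝ), -(s : ℂ) * Complex.exp (-(s : ℂ) ^ 2 - b * s)) b := by
    refine (hasDerivAt_integral_of_dominated_loc_of_deriv_le (μ := volume.restrict (Set.Ioi 0))
      (s := Metric.ball b 1) (F := fun b (s : ℝ) => Complex.exp (-(s : ℂ) ^ 2 - b * s))
      (F' := fun b (s : ℝ) => -(s : ℂ) * Complex.exp (-(s : ℂ) ^ 2 - b * s))
      (bound := fun s => s ^ 1 * Real.exp (-1 * s ^ 2 + (-b.re + 1) * s))
      (Metric.ball_mem_nhds b one_pos) ?_ ?_ ?_ ?_ ?_ ?_).2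
    · exact Eventually.of_forall fun b => Continuous.aestronglyMeasurable (by fun_prop)
    · simpa [IntegrableOn] using integrableOn_pow_mul_cexp b 0
    · exact Continuous.aestronglyMeasurable (by fun_prop)
    · refine (ae_restrict_mem measurableSet_Ioi).mono fun u hu x hx => ?_
      have hu : (0 : ℝ) < u := hu
      rw [norm_mul, norm_neg, Complex.norm_real, Real.norm_of_nonneg hu.le, norm_exp_neg_sq_sub,
        pow_one]
      have h2 : |(x - b).re| ≤ 1 :=
        (Complex.abs_re_le_norm _).trans (by simpa [dist_eq_norm] using (Metric.mem_ball.mp hx).le)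
      rw [Complex.sub_re, abs_le] at h2
      gcongr
      linarith [h2.1]
    · exact integrableOn_pow_mul_exp one_pos _ 1
    · refine Eventually.of_forall fun u x _ => ?_
      have := (((hasDerivAt_id x).mul_const (u : ℂ)).const_sub (-(u : ℂ) ^ 2)).cexp
      simpa [mul_comm] using this
  rwa [mul_gaussLaplace, add_sub_cancel_left, mul_div_cancel_left₀ _ two_ne_zero]

theorem differentiable_gaussLaplace : Differentiable ℂ gaussLaplace := fun b =>
  (hasDerivAt_gaussLaplace b).differentiableAt

@[fun_prop]
theorem continuous_gaussLaplace : Continuous gaussLaplace :=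
  differentiable_gaussLaplace.continuous

theorem norm_gaussLaplace_le {c : ℝ} {b : ℂ} (h : c ≤ b.re) :
    ‖gaussLaplace b‖ ≤ ∫ s in Set.Ioi (0 : ℝ), Real.exp (-1 * s ^ 2 + -c * s) := by
  refine norm_integral_le_of_norm_le (by simpa [IntegrableOn] using integrableOn_pow_mul_exp one_pos (-c) 0) ?_
  refine (ae_restrict_mem measurableSet_Ioi).mono fun u hu => ?_
  have hu : (0 : ℝ) < u := hu
  rw [norm_exp_neg_sq_sub]
  gcongr

theorem gaussLaplace_zero : gaussLaplace 0 = (Real.sqrt Real.pi : ℂ) / 2 := by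
  have := integral_gaussian_Ioi 1
  rw [div_one] at this
  unfold gaussLaplace
  rw [show (Real.sqrt Real.pi : ℂ) / 2 = ((Real.sqrt Real.pi / 2 : ℝ) : ℂ) by push_cast; rfl, ← this,
    ← integral_complex_ofReal]
  congr 1
  funext s
  push_cast
  simp

theorem hasDerivAt_exp_mul_gaussLaplace (z : ℂ) :
    HasDerivAt (fun z => Complex.exp (-z ^ 2) * gaussLaplace (2 * z)) (-Complex.exp (-z ^ 2)) z := by
  have h1 := ((hasDerivAt_id z).pow 2).neg.cexp
  have h2 := (hasDerivAt_gaussLaplace (2 * z)).comp z ((hasDerivAt_id z).const_mul 2)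
  have := h1.mul h2
  refine this.congr_deriv ?_
  simp
  ring

/-- The right-hand side is `1` at `0` and has the derivative `-(2 / √π) exp (-z²)`, which is
integrated along the segment from `0` to `z`. -/
theorem erfc_eq (z : ℂ) :
    erfc z = 2 / (Real.sqrt Real.pi : ℂ) * (Complex.exp (-z ^ 2) * gaussLaplace (2 * z)) := by
  have hpi : (Real.sqrt Real.pi : ℂ) ≠ 0 := by
    exact_mod_cast (Real.sqrt_pos.mpr Real.pi_pos).ne'
  have h1 : ∫ x in (0 : ℝ)..1, -Complex.exp (-((x : ℂ) * z) ^ 2) * z =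
      Complex.exp (-((1 : ℝ) * z : ℂ) ^ 2) * gaussLaplace (2 * ((1 : ℝ) * z)) -
        Complex.exp (-((0 : ℝ) * z : ℂ) ^ 2) * gaussLaplace (2 * ((0 : ℝ) * z)) := by
    refine intervalIntegral.integral_eq_sub_of_hasDerivAt
      (f := fun x : ℝ => Complex.exp (-((x : ℂ) * z) ^ 2) * gaussLaplace (2 * ((x : ℂ) * z)))
      (fun x _ => ?_) (Continuous.intervalIntegrable (by fun_prop) _ _)
    have := (hasDerivAt_exp_mul_gaussLaplace ((x : ℂ) * z)).comp (x : ℂ)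
      ((hasDerivAt_id (x : ℂ)).mul_const z)
    simpa using this.comp_ofReal
  rw [intervalIntegral.integral_mul_const, intervalIntegral.integral_neg] at h1
  simp only [Complex.ofReal_one, one_mul, Complex.ofReal_zero, zero_mul, mul_zero,
    gaussLaplace_zero, ne_eq, OfNat.ofNat_ne_zero, not_false_eq_true, zero_pow, neg_zero,
    Complex.exp_zero] at h1
  unfold erfc
  have h2 : Complex.exp (-z ^ 2) * gaussLaplace (2 * z) = (Real.sqrt Real.pi : ℂ) / 2 -
      z * ∫ x in (0 : ℝ)..1, Complex.exp (-((x : ℂ) * z) ^ 2) := by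
    linear_combination -h1
  rw [h2]
  field_simp

theorem hasDerivAt_erfc (z : ℂ) :
    HasDerivAt erfc (-(2 / (Real.sqrt Real.pi : ℂ) * Complex.exp (-z ^ 2))) z := by
  have := (hasDerivAt_exp_mul_gaussLaplace z).const_mul (2 / (Real.sqrt Real.pi : ℂ))
  rw [mul_neg] at this
  exact this.congr_of_eventuallyEq (Eventually.of_forall erfc_eq)

/-! ### The edge kernel -/

theorem sqrt_two_sq : (Real.sqrt 2 : ℂ) ^ 2 = 2 := by
  rw [← Complex.ofReal_pow, Real.sq_sqrt zero_le_two]; norm_num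

theorem sqrt_pi_sq : (Real.sqrt Real.pi : ℂ) ^ 2 = Real.pi := by
  rw [← Complex.ofReal_pow, Real.sq_sqrt Real.pi_pos.le]

theorem sqrt_pi_ne_zero : (Real.sqrt Real.pi : ℂ) ≠ 0 := by
  exact_mod_cast (Real.sqrt_pos.mpr Real.pi_pos).ne'

theorem edgeF_eq (z : ℂ) (u : ℝ) :
    edgeF z u = 1 / (Real.sqrt Real.pi : ℂ) *
      (Complex.exp (-2 * (z - u) ^ 2) * gaussLaplace (2 * Real.sqrt 2 * (z - u))) := by
  rw [edgeF, erfc_eq, mul_pow, sqrt_two_sq]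
  ring_nf

theorem hasDerivAt_edgeF (z : ℂ) (u : ℝ) :
    HasDerivAt (edgeF z) (Real.sqrt 2 / Real.sqrt Real.pi * Complex.exp (-2 * (z - u) ^ 2)) u := by
  have h1 := (hasDerivAt_erfc (Real.sqrt 2 * (z - u))).comp (u : ℂ)
    (((hasDerivAt_id (u : ℂ)).const_sub z).const_mul (Real.sqrt 2 : ℂ))
  have h2 := (h1.const_mul (1 / 2)).comp_ofReal
  refine h2.congr_deriv ?_
  rw [mul_pow, sqrt_two_sq]
  ring_nf

/-- The edge pre-kernel without its exponential factor; see `kappaEdge_eq`. -/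
noncomputable def edgePhi (z w : ℂ) : ℂ :=
  Real.sqrt 2 / Real.sqrt Real.pi * ∫ u in Set.Ioi (0 : ℝ),
    Complex.exp (-2 * (z + u) ^ 2 - 2 * (w + u) ^ 2) *
      (gaussLaplace (2 * Real.sqrt 2 * (w + u)) - gaussLaplace (2 * Real.sqrt 2 * (z + u)))

theorem kappaEdge_eq (z w : ℂ) : kappaEdge z w = Complex.exp (z ^ 2 + w ^ 2) * edgePhi z w := by
  have h1 : ∀ u : ℝ, wronskian (edgeF w) (edgeF z) u = Real.sqrt 2 / Real.pi *
      (Complex.exp (-2 * (z - u) ^ 2 - 2 * (w - u) ^ 2) *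
      (gaussLaplace (2 * Real.sqrt 2 * (w - u)) - gaussLaplace (2 * Real.sqrt 2 * (z - u)))) := by
    intro u
    rw [wronskian, (hasDerivAt_edgeF z u).deriv, (hasDerivAt_edgeF w u).deriv, edgeF_eq, edgeF_eq,
      sub_eq_add_neg (-2 * (z - (u : ℂ)) ^ 2), Complex.exp_add, ← sqrt_pi_sq]
    have := sqrt_pi_ne_zero
    field_simp
  have h2 := integral_comp_neg_Ioi (0 : ℝ) (wronskian (edgeF w) (edgeF z))
  rw [neg_zero, integral_Iic_eq_integral_Iio] at h2
  rw [kappaEdge, edgePhi, ← h2]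
  simp_rw [h1]
  rw [integral_const_mul, ← sqrt_pi_sq]
  push_cast
  simp only [sub_neg_eq_add]
  have := sqrt_pi_ne_zero
  field_simp

/-- The part of `edgePhi` which remains after the Gaussian factors are removed. -/
noncomputable def edgeCore (z w : ℂ) : ℂ :=
  ∫ u in Set.Ioi (0 : ℝ), Complex.exp (-4 * (u : ℂ) ^ 2 - 4 * (z + w) * u) *
    (gaussLaplace (2 * Real.sqrt 2 * (w + u)) - gaussLaplace (2 * Real.sqrt 2 * (z + u)))

theorem edgePhi_eq (z w : ℂ) : edgePhi z w =
    Real.sqrt 2 / Real.sqrt Real.pi * (Complex.exp (-2 * z ^ 2 - 2 * w ^ 2) * edgeCore z w) := by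
  rw [edgePhi, edgeCore, ← integral_const_mul (Complex.exp _)]
  congr 2
  funext u
  rw [← mul_assoc, ← Complex.exp_add]
  ring_nf

theorem edgePhi_swap (z w : ℂ) : edgePhi w z = -edgePhi z w := by
  rw [edgePhi, edgePhi, ← mul_neg, ← integral_neg]
  congr 2
  funext u
  rw [show -2 * (w + (u : ℂ)) ^ 2 - 2 * (z + u) ^ 2 = -2 * (z + u) ^ 2 - 2 * (w + u) ^ 2 by ring]
  ring

theorem edgePhi_self (z : ℂ) : edgePhi z z = 0 := by
  simp [edgePhi]

/-- A uniform bound for `gaussLaplace` on the half-plane `c ≤ Re b`. -/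
noncomputable def gaussLaplaceBound (c : ℝ) : ℝ :=
  ∫ s in Set.Ioi (0 : ℝ), Real.exp (-1 * s ^ 2 + -c * s)

theorem norm_gaussLaplace_shift_le (z : ℂ) {u : ℝ} (hu : 0 < u) :
    ‖gaussLaplace (2 * Real.sqrt 2 * (z + u))‖ ≤ gaussLaplaceBound (2 * Real.sqrt 2 * z.re) := by
  refine norm_gaussLaplace_le ?_
  have : (2 * Real.sqrt 2 * (z + u) : ℂ).re = 2 * Real.sqrt 2 * (z.re + u) := by
    rw [show (2 * Real.sqrt 2 * (z + u) : ℂ) = ((2 * Real.sqrt 2 : ℝ) : ℂ) * (z + u) by push_cast; rfl,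
      Complex.re_ofReal_mul]
    simp
  rw [this]
  gcongr
  linarith

theorem gaussLaplaceBound_nonneg (c : ℝ) : 0 ≤ gaussLaplaceBound c :=
  integral_nonneg fun _ => (Real.exp_pos _).le

theorem norm_exp_edge (z w : ℂ) (u : ℝ) :
    ‖Complex.exp (-2 * (z + u) ^ 2 - 2 * (w + u) ^ 2)‖ =
      Real.exp (-2 * z ^ 2 - 2 * w ^ 2 : ℂ).re *
        Real.exp (-4 * u ^ 2 + -4 * (z + w).re * u) := by
  rw [Complex.norm_exp, ← Real.exp_add]
  congr 1
  have : (-2 * (z + u) ^ 2 - 2 * (w + u) ^ 2 : ℂ) =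
      (-2 * z ^ 2 - 2 * w ^ 2) + ((-4 * u ^ 2 : ℝ) + (z + w) * ((-4 * u : ℝ) : ℂ)) := by
    push_cast; ring
  rw [this, Complex.add_re, Complex.add_re, Complex.ofReal_re, Complex.re_mul_ofReal]
  ring

theorem integrable_edgePhi (z w : ℂ) : IntegrableOn (fun u : ℝ =>
    Complex.exp (-2 * (z + u) ^ 2 - 2 * (w + u) ^ 2) *
      (gaussLaplace (2 * Real.sqrt 2 * (w + u)) - gaussLaplace (2 * Real.sqrt 2 * (z + u))))
    (Set.Ioi 0) := by
  have h := (integrableOn_pow_mul_exp (k := 4) (by norm_num) (-4 * (z + w).re) 0).const_mul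
    (Real.exp (-2 * z ^ 2 - 2 * w ^ 2 : ℂ).re * (gaussLaplaceBound (2 * Real.sqrt 2 * w.re) +
      gaussLaplaceBound (2 * Real.sqrt 2 * z.re)))
  refine h.mono' (Continuous.aestronglyMeasurable (by fun_prop)) ?_
  refine (ae_restrict_mem measurableSet_Ioi).mono fun u hu => ?_
  rw [norm_mul, norm_exp_edge, pow_zero, one_mul, mul_right_comm]
  gcongr
  exact (norm_sub_le _ _).trans
    (add_le_add (norm_gaussLaplace_shift_le w hu) (norm_gaussLaplace_shift_le z hu))

theorem integral_exp_edge (b : ℂ) :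
    ∫ u in Set.Ioi (0 : ℝ), Complex.exp (-4 * (u : ℂ) ^ 2 - 4 * b * u) =
      gaussLaplace (2 * b) / 2 := by
  have := integral_comp_mul_left_Ioi (fun s : ℝ => Complex.exp (-(s : ℂ) ^ 2 - 2 * b * s)) 0
    (b := 2) two_pos
  rw [mul_zero] at this
  rw [gaussLaplace]
  have h2 : ∀ u : ℝ, Complex.exp (-4 * (u : ℂ) ^ 2 - 4 * b * u) =
      Complex.exp (-((2 * u : ℝ) : ℂ) ^ 2 - 2 * b * (2 * u : ℝ)) := by
    intro u; push_cast; ring_nf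
  simp_rw [h2]
  rw [this, Complex.real_smul]
  push_cast
  ring

theorem integrable_exp_edge (b : ℂ) (n : ℕ) :
    IntegrableOn (fun u : ℝ => (u : ℂ) ^ n * Complex.exp (-4 * (u : ℂ) ^ 2 - 4 * b * u))
      (Set.Ioi 0) := by
  refine (integrableOn_pow_mul_exp (k := 4) (by norm_num) (-4 * b.re) n).mono'
    (Continuous.aestronglyMeasurable (by fun_prop)) ?_
  refine (ae_restrict_mem measurableSet_Ioi).mono fun u hu => ?_
  have hu : (0 : ℝ) < u := hu
  have := norm_exp_edge b 0 u
  have e : Complex.exp (-4 * (u : ℂ) ^ 2 - 4 * b * u) = Complex.exp (2 * b ^ 2) *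
      Complex.exp (-2 * (b + u) ^ 2 - 2 * (0 + u) ^ 2) := by
    rw [← Complex.exp_add]; ring_nf
  rw [norm_mul, norm_pow, Complex.norm_real, Real.norm_of_nonneg hu.le, e, norm_mul, this,
    ← mul_assoc ‖_‖, Complex.norm_exp, ← Real.exp_add]
  simp

/-- The integrand depends on `z` in a complicated way, but its derivative in `z` is the sum of a
derivative in `u` and of a Gaussian, so that the integral can be evaluated. -/
theorem hasDerivAt_edgePhi (z w : ℂ) :
    HasDerivAt (fun z => edgePhi z w) (Real.sqrt 2 / Real.sqrt Real.pi *
      (Complex.exp (-2 * z ^ 2 - 2 * w ^ 2) *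
        (Real.sqrt 2 * gaussLaplace (2 * (z + w)) - gaussLaplace (2 * Real.sqrt 2 * w)))) z := by
  let F' : ℂ → ℝ → ℂ := fun z u => Complex.exp (-2 * (z + u) ^ 2 - 2 * (w + u) ^ 2) *
    (Real.sqrt 2 - 4 * (z + u) * gaussLaplace (2 * Real.sqrt 2 * (w + u)))
  set B := gaussLaplaceBound (2 * Real.sqrt 2 * w.re) with hB
  have hB0 : 0 ≤ B := gaussLaplaceBound_nonneg _
  have hbound : ∀ x : ℂ, ∀ u : ℝ, 0 < u → ‖F' x u‖ ≤
      Real.exp (-2 * x ^ 2 - 2 * w ^ 2 : ℂ).re * Real.exp (-4 * u ^ 2 + -4 * (x + w).re * u) *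
        (Real.sqrt 2 + 4 * (‖x‖ + u) * B) := by
    intro x u hu
    rw [norm_mul, norm_exp_edge]
    gcongr
    refine (norm_sub_le _ _).trans (add_le_add ?_ ?_)
    · rw [Complex.norm_real, Real.norm_of_nonneg (Real.sqrt_nonneg _)]
    · rw [norm_mul, norm_mul, Complex.norm_ofNat]
      gcongr
      · refine (norm_add_le _ _).trans ?_
        rw [Complex.norm_real, Real.norm_of_nonneg hu.le]
      · exact norm_gaussLaplace_shift_le w hu
  have h1 : HasDerivAt (fun z => ∫ u in Set.Ioi (0 : ℝ),
      Complex.exp (-2 * (z + u) ^ 2 - 2 * (w + u) ^ 2) *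
      (gaussLaplace (2 * Real.sqrt 2 * (w + u)) - gaussLaplace (2 * Real.sqrt 2 * (z + u))))
      (∫ u in Set.Ioi (0 : ℝ), F' z u) z := by
    set R := ‖z‖ + 1 with hR
    refine (hasDerivAt_integral_of_dominated_loc_of_deriv_le (μ := volume.restrict (Set.Ioi 0))
      (s := Metric.ball z 1) (bound := fun u =>
        Real.exp (2 * R ^ 2 + 2 * ‖w‖ ^ 2) * (Real.sqrt 2 + 4 * R * B) *
          (u ^ 0 * Real.exp (-4 * u ^ 2 + 4 * (R + ‖w‖) * u)) +
        Real.exp (2 * R ^ 2 + 2 * ‖w‖ ^ 2) * (4 * B) *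
          (u ^ 1 * Real.exp (-4 * u ^ 2 + 4 * (R + ‖w‖) * u)))
      (Metric.ball_mem_nhds z one_pos) ?_ ?_ ?_ ?_ ?_ ?_).2
    · exact Eventually.of_forall fun b => Continuous.aestronglyMeasurable (by fun_prop)
    · exact integrable_edgePhi z w
    · exact Continuous.aestronglyMeasurable (by fun_prop)
    · refine (ae_restrict_mem measurableSet_Ioi).mono fun u hu x hx => ?_
      have hu : (0 : ℝ) < u := hu
      have hx' : ‖x‖ ≤ R := by
        have := norm_le_norm_add_norm_sub' x z
        rw [Metric.mem_ball, dist_eq_norm] at hx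
        linarith
      have hxr : -R ≤ x.re := (abs_le.mp ((Complex.abs_re_le_norm x).trans hx')).1
      have hwr : -‖w‖ ≤ w.re := (abs_le.mp (Complex.abs_re_le_norm w)).1
      have e1 : (-2 * x ^ 2 - 2 * w ^ 2 : ℂ).re ≤ 2 * R ^ 2 + 2 * ‖w‖ ^ 2 := by
        refine (Complex.re_le_norm _).trans ((norm_sub_le _ _).trans ?_)
        rw [norm_mul, norm_mul, norm_pow, norm_pow, norm_neg, Complex.norm_ofNat]
        gcongr
      have e2 : -4 * (x + w).re ≤ 4 * (R + ‖w‖) := by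
        rw [Complex.add_re]; linarith
      calc ‖F' x u‖ ≤ _ := hbound x u hu
        _ ≤ Real.exp (2 * R ^ 2 + 2 * ‖w‖ ^ 2) * Real.exp (-4 * u ^ 2 + 4 * (R + ‖w‖) * u) *
            (Real.sqrt 2 + 4 * (R + u) * B) := by gcongr
        _ = _ := by ring
    · exact ((integrableOn_pow_mul_exp (by norm_num) _ 0).const_mul _).add
        ((integrableOn_pow_mul_exp (by norm_num) _ 1).const_mul _)
    · refine Eventually.of_forall fun u x _ => ?_
      have d1 := ((((hasDerivAt_id x).add_const (u : ℂ)).pow 2).const_mul (-2)).sub_const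
        (2 * (w + u) ^ 2) |>.cexp
      have d2 := ((hasDerivAt_gaussLaplace (2 * Real.sqrt 2 * (x + u))).comp x
        (((hasDerivAt_id x).add_const (u : ℂ)).const_mul (2 * (Real.sqrt 2 : ℂ)))).const_sub
        (gaussLaplace (2 * Real.sqrt 2 * (w + u)))
      refine (d1.mul d2).congr_deriv ?_
      simp only [F', id, Function.comp_apply, Pi.pow_apply]
      have := sqrt_two_sq
      generalize gaussLaplace (2 * Real.sqrt 2 * (w + u)) = hw
      generalize gaussLaplace (2 * Real.sqrt 2 * (x + u)) = hx
      generalize Complex.exp (-2 * (x + u) ^ 2 - 2 * (w + u) ^ 2) = e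
      push_cast
      linear_combination (-2) * e * (x + u) * hx * this
  -- `F' z u` is a derivative in `u` up to a Gaussian term
  have hP : ∀ u : ℝ, HasDerivAt (fun u : ℝ => Complex.exp (-2 * (z + u) ^ 2 - 2 * (w + u) ^ 2) *
      gaussLaplace (2 * Real.sqrt 2 * (w + u))) (F' z u - 2 * Real.sqrt 2 *
        Complex.exp (-2 * (z + u) ^ 2 - 2 * (w + u) ^ 2)) u := by
    intro u
    have d1 := (((((hasDerivAt_id (u : ℂ)).const_add z).pow 2).const_mul (-2)).sub
      ((((hasDerivAt_id (u : ℂ)).const_add w).pow 2).const_mul 2)).cexp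
    have d2 := ((hasDerivAt_gaussLaplace (2 * Real.sqrt 2 * (w + u))).comp (u : ℂ)
        (((hasDerivAt_id (u : ℂ)).const_add w).const_mul (2 * (Real.sqrt 2 : ℂ))))
    refine (d1.mul d2).comp_ofReal.congr_deriv ?_
    simp only [F', id, Function.comp_apply, Pi.pow_apply]
    have := sqrt_two_sq
    generalize gaussLaplace (2 * Real.sqrt 2 * (w + u)) = hw
    generalize Complex.exp (-2 * (z + u) ^ 2 - 2 * (w + u) ^ 2) = e
    push_cast
    linear_combination 2 * e * (w + u) * hw * this
  have hint2 : IntegrableOn (fun u : ℝ => Complex.exp (-2 * (z + u) ^ 2 - 2 * (w + u) ^ 2))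
      (Set.Ioi 0) := by
    refine ((integrable_exp_edge (z + w) 0).const_mul
      (Complex.exp (-2 * z ^ 2 - 2 * w ^ 2))).congr (Eventually.of_forall fun u => ?_)
    simp only [pow_zero, one_mul, ← Complex.exp_add]
    ring_nf
  have hint1 : IntegrableOn (F' z) (Set.Ioi 0) := by
    refine (((integrableOn_pow_mul_exp (k := 4) (by norm_num) (-4 * (z + w).re) 0).const_mul
      (Real.exp (-2 * z ^ 2 - 2 * w ^ 2 : ℂ).re * (Real.sqrt 2 + 4 * ‖z‖ * B))).add
      ((integrableOn_pow_mul_exp (k := 4) (by norm_num) (-4 * (z + w).re) 1).const_mul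
      (Real.exp (-2 * z ^ 2 - 2 * w ^ 2 : ℂ).re * (4 * B)))).mono'
      (Continuous.aestronglyMeasurable (by fun_prop)) ?_
    refine (ae_restrict_mem measurableSet_Ioi).mono fun u hu => (hbound z u hu).trans_eq ?_
    simp only [Pi.add_apply]
    ring
  have h2 : ∫ u in Set.Ioi (0 : ℝ), (F' z u - 2 * Real.sqrt 2 *
        Complex.exp (-2 * (z + u) ^ 2 - 2 * (w + u) ^ 2)) =
      0 - Complex.exp (-2 * (z + (0 : ℝ)) ^ 2 - 2 * (w + (0 : ℝ)) ^ 2) *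
        gaussLaplace (2 * Real.sqrt 2 * (w + (0 : ℝ))) := by
    refine integral_Ioi_of_hasDerivAt_of_tendsto' (fun u _ => hP u)
      (hint1.sub (hint2.const_mul _)) ?_
    have := ((tendsto_exp_neg_sq_add 4 (by norm_num) (-4 * (z + w).re) 0).const_mul
      (Real.exp (-2 * z ^ 2 - 2 * w ^ 2 : ℂ).re)).mul_const B
    rw [mul_zero, zero_mul] at this
    refine squeeze_zero_norm' ?_ this
    filter_upwards [eventually_gt_atTop 0] with u hu
    rw [norm_mul, norm_exp_edge, pow_zero, one_mul]
    gcongr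
    exact norm_gaussLaplace_shift_le w hu
  rw [integral_sub hint1 (hint2.const_mul _), integral_const_mul] at h2
  have h3 : ∫ u in Set.Ioi (0 : ℝ), Complex.exp (-2 * (z + u) ^ 2 - 2 * (w + u) ^ 2) =
      Complex.exp (-2 * z ^ 2 - 2 * w ^ 2) * (gaussLaplace (2 * (z + w)) / 2) := by
    rw [← integral_exp_edge, ← integral_const_mul]
    congr 1
    funext u
    rw [← Complex.exp_add]
    ring_nf
  rw [h3, Complex.ofReal_zero, add_zero, add_zero] at h2
  refine (h1.const_mul (Real.sqrt 2 / Real.sqrt Real.pi : ℂ)).congr_deriv ?_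
  linear_combination (Real.sqrt 2 / Real.sqrt Real.pi : ℂ) * h2

theorem differentiable_edgePhi_left (w : ℂ) : Differentiable ℂ fun z => edgePhi z w := fun z =>
  (hasDerivAt_edgePhi z w).differentiableAt

theorem differentiable_edgePhi_right (z : ℂ) : Differentiable ℂ fun w => edgePhi z w := by
  have : (fun w => edgePhi z w) = fun w => -edgePhi w z := by
    funext w; rw [edgePhi_swap]
  rw [this]
  exact (differentiable_edgePhi_left z).neg

/-! ### Uniform convergence on compact sets -/

/-- Continuous convergence implies uniform convergence on compact sets. -/
theorem tendstoUniformlyOn_of_forall_tendsto_prod {ι X Y : Type*} [TopologicalSpace X]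
    [PseudoMetricSpace Y] {l : Filter ι} [NeBot l] {F : ι → X → Y} {f : X → Y}
    (h : ∀ x, Tendsto (fun p : ι × X => F p.1 p.2) (l ×ˢ 𝓝 x) (𝓝 (f x))) {K : Set X}
    (hK : IsCompact K) : TendstoUniformlyOn F f l K := by
  rw [← tendstoLocallyUniformlyOn_iff_tendstoUniformlyOn_of_compact hK]
  refine fun u hu x _ => ?_
  obtain ⟨ε, hε, hu⟩ := Metric.mem_uniformity_dist.mp hu
  have h1 := Metric.tendsto_nhds.mp (h x) (ε / 2) (half_pos hε)
  rw [Filter.eventually_prod_iff] at h1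
  obtain ⟨pa, ha, pb, hb, hab⟩ := h1
  refine ⟨{y | pb y}, mem_nhdsWithin_of_mem_nhds hb, ha.mono fun n hn y hy => hu ?_⟩
  -- the limit at `y` is within `ε / 2` of `f x`, since this holds along the sequence
  have h2 : dist (f y) (f x) ≤ ε / 2 := by
    have h3 : Tendsto (fun n => F n y) l (𝓝 (f y)) :=
      (h y).comp (tendsto_id.prodMk (tendsto_const_pure.mono_right (pure_le_nhds y)))
    exact le_of_tendsto (h3.dist tendsto_const_nhds) (ha.mono fun m hm => (hab hm hy).le)
  calc dist (f y) (F n y) ≤ dist (f y) (f x) + dist (F n y) (f x) := dist_triangle_right _ _ _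
    _ < ε := by linarith [hab hn hy]

/-! ### A differential equation for the polynomial kernel -/

/-- The coefficient `4^n n! / (2n)!`. -/
noncomputable def evenCoeff (n : ℕ) : ℂ := 4 ^ n * (n.factorial : ℂ) / ((2 * n).factorial : ℂ)

theorem hasDerivAt_truncExpSq (n : ℕ) (Y : ℂ) :
    HasDerivAt (truncExpSq (n + 1)) (2 * Y * truncExpSq n Y) Y := by
  induction n with
  | zero =>
    have : truncExpSq 1 = fun _ => 1 := by funext; simp [truncExpSq]
    rw [this]
    simpa [truncExpSq] using hasDerivAt_const Y (1 : ℂ)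
  | succ n ih =>
    have e : truncExpSq (n + 1 + 1) = fun Y => truncExpSq (n + 1) Y +
        Y ^ (2 * (n + 1)) / ((n + 1).factorial : ℂ) := by
      funext Y; simp only [truncExpSq, Finset.sum_range_succ _ (n + 1)]
    rw [e]
    refine (ih.add ((hasDerivAt_pow (2 * (n + 1)) Y).div_const _)).congr_deriv ?_
    have hf : (n.factorial : ℂ) ≠ 0 := by exact_mod_cast Nat.factorial_ne_zero _
    have hn : (n + 1 : ℂ) ≠ 0 := by exact_mod_cast n.succ_ne_zero
    rw [truncExpSq, truncExpSq, Finset.sum_range_succ, Nat.factorial_succ,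
      show 2 * (n + 1) - 1 = 2 * n + 1 by omega]
    push_cast
    field_simp
    ring

/-- The kernel satisfies a first order differential equation of Christoffel-Darboux type. -/
theorem hasDerivAt_microKernel (n : ℕ) (X Y : ℂ) :
    HasDerivAt (microKernel n X) (2 * Y * microKernel n X Y +
      (∑ j ∈ Finset.range (2 * n), (2 * X * Y) ^ j / (j.factorial : ℂ) -
        evenCoeff n * Y ^ (2 * n) * truncExpSq n X)) Y := by
  induction n with
  | zero =>
    have : microKernel 0 X = fun _ => 0 := by funext; simp [microKernel]
    rw [this]
    simpa [truncExpSq] using hasDerivAt_const Y (0 : ℂ)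
  | succ n ih =>
    have e : microKernel (n + 1) X = fun Y => microKernel n X Y + oddCoeff n *
        (truncExpSq (n + 1) X * Y ^ (2 * n + 1) - X ^ (2 * n + 1) * truncExpSq (n + 1) Y) := by
      funext Y; simp only [microKernel, Finset.sum_range_succ]
    rw [e]
    refine (ih.add ((((hasDerivAt_pow (2 * n + 1) Y).const_mul (truncExpSq (n + 1) X)).sub
      ((hasDerivAt_truncExpSq n Y).const_mul (X ^ (2 * n + 1)))).const_mul
        (oddCoeff n))).congr_deriv ?_
    have hf : (n.factorial : ℂ) ≠ 0 := by exact_mod_cast Nat.factorial_ne_zero _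
    have hg : ((2 * n).factorial : ℂ) ≠ 0 := by exact_mod_cast Nat.factorial_ne_zero _
    have hn : (n + 1 : ℂ) ≠ 0 := by exact_mod_cast n.succ_ne_zero
    have hn2 : (2 * n + 1 : ℂ) ≠ 0 := by exact_mod_cast (2 * n).succ_ne_zero
    have c1 : oddCoeff n * (2 * n + 1) = evenCoeff n := by
      rw [oddCoeff, evenCoeff, Nat.factorial_succ]
      push_cast
      field_simp
    have c2 : evenCoeff (n + 1) = 2 * oddCoeff n := by
      rw [oddCoeff, evenCoeff, show 2 * (n + 1) = 2 * n + 1 + 1 by ring,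
        Nat.factorial_succ (2 * n + 1), Nat.factorial_succ (2 * n), Nat.factorial_succ n]
      push_cast
      rw [show (2 * n + 1 + 1 : ℂ) = 2 * (n + 1) by ring]
      field_simp
      ring
    have c3 : (2 * X * Y) ^ (2 * n) / ((2 * n).factorial : ℂ) =
        evenCoeff n * Y ^ (2 * n) * (X ^ (2 * n) / (n.factorial : ℂ)) := by
      rw [evenCoeff, mul_pow, mul_pow, pow_mul 2 2 n]
      norm_num
      field_simp
    have c4 : (2 * X * Y) ^ (2 * n + 1) / ((2 * n + 1).factorial : ℂ) =
        2 * oddCoeff n * Y * X ^ (2 * n + 1) * (Y ^ (2 * n) / (n.factorial : ℂ)) := by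
      rw [oddCoeff, mul_pow, mul_pow, pow_succ 2 (2 * n), pow_succ Y (2 * n), pow_mul 2 2 n]
      norm_num
      field_simp
    have t : ∀ Z, truncExpSq (n + 1) Z = truncExpSq n Z + Z ^ (2 * n) / (n.factorial : ℂ) := by
      intro Z; simp only [truncExpSq, Finset.sum_range_succ]
    rw [show 2 * (n + 1) = 2 * n + 1 + 1 by ring, Finset.sum_range_succ _ (2 * n + 1),
      Finset.sum_range_succ _ (2 * n), c2, c3, c4, ← c1]
    simp only [add_tsub_cancel_right]
    rw [t X, t Y]
    push_cast
    ring

/-- `exp (-ζ) ∑_{j < n} ζ^j / j!`; for real `ζ ≥ 0` the probability that a Poisson variable of mean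
`ζ` is less than `n`. -/
noncomputable def poissonTail (n : ℕ) (ζ : ℂ) : ℂ :=
  Complex.exp (-ζ) * ∑ j ∈ Finset.range n, ζ ^ j / (j.factorial : ℂ)

/-- The derivative of `dampedKernel` in its second variable. -/
noncomputable def dampedDeriv (n : ℕ) (X Y : ℂ) : ℂ :=
  Complex.exp (-(X - Y) ^ 2) * poissonTail (2 * n) (2 * X * Y) -
    evenCoeff n * (Y ^ (2 * n) * Complex.exp (-Y ^ 2)) * poissonTail n (X ^ 2)

theorem hasDerivAt_dampedKernel (n : ℕ) (X Y : ℂ) :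
    HasDerivAt (dampedKernel n X) (dampedDeriv n X Y) Y := by
  have h1 := (((hasDerivAt_pow 2 Y).const_sub (-X ^ 2)).cexp).mul (hasDerivAt_microKernel n X Y)
  refine h1.congr_deriv ?_
  have e1 : Complex.exp (-X ^ 2 - Y ^ 2) =
      Complex.exp (-(X - Y) ^ 2) * Complex.exp (-(2 * X * Y)) := by
    rw [← Complex.exp_add]; ring_nf
  have e2 : Complex.exp (-X ^ 2 - Y ^ 2) = Complex.exp (-Y ^ 2) * Complex.exp (-X ^ 2) := by
    rw [← Complex.exp_add]; ring_nf
  have e3 : truncExpSq n X = ∑ j ∈ Finset.range n, (X ^ 2) ^ j / (j.factorial : ℂ) := by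
    simp only [truncExpSq, pow_mul]
  rw [dampedDeriv, poissonTail, poissonTail, ← e3]
  generalize ∑ j ∈ Finset.range (2 * n), (2 * X * Y) ^ j / (j.factorial : ℂ) = S
  rw [← mul_assoc (Complex.exp (-(X - Y) ^ 2)), ← e1]
  simp only [Nat.cast_ofNat, Nat.add_one_sub_one, pow_one]
  linear_combination (-evenCoeff n * Y ^ (2 * n) * truncExpSq n X) * e2

theorem continuous_dampedDeriv (n : ℕ) (X : ℂ) : Continuous (dampedDeriv n X) := by
  unfold dampedDeriv poissonTail
  fun_prop

/-- The kernel vanishes on the diagonal, so it is the integral of its derivative from `X` to `Y`. -/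
theorem dampedKernel_eq_integral (n : ℕ) (X Y : ℂ) :
    dampedKernel n X Y = ∫ s in (0 : ℝ)..1, dampedDeriv n X (X + s * (Y - X)) * (Y - X) := by
  have h0 : dampedKernel n X X = 0 := by
    simp only [dampedKernel, microKernel]
    rw [Finset.sum_eq_zero fun m _ => by ring, mul_zero]
  have := intervalIntegral.integral_eq_sub_of_hasDerivAt (a := 0) (b := 1)
    (f := fun s : ℝ => dampedKernel n X (X + s * (Y - X)))
    (f' := fun s : ℝ => dampedDeriv n X (X + s * (Y - X)) * (Y - X)) (fun s _ => ?_)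
    (Continuous.intervalIntegrable (by have := continuous_dampedDeriv n X; fun_prop) _ _)
  · rw [this]
    simp [h0]
  · have h1 : HasDerivAt (fun s : ℂ => X + s * (Y - X)) (Y - X) s := by
      simpa using ((hasDerivAt_id (s : ℂ)).mul_const (Y - X)).const_add X
    exact ((hasDerivAt_dampedKernel n X _).comp (s : ℂ) h1).comp_ofReal

theorem integral_pow_mul_exp_neg (i : ℕ) :
    ∫ s in Set.Ioi (0 : ℝ), (s : ℂ) ^ i * Complex.exp (-s) = (i.factorial : ℂ) := by
  have h := Real.Gamma_eq_integral (s := i + 1) (by positivity)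
  rw [Real.Gamma_nat_eq_factorial] at h
  rw [show (i.factorial : ℂ) = ((i.factorial : ℝ) : ℂ) by push_cast; rfl, h,
    ← integral_complex_ofReal]
  refine setIntegral_congr_fun measurableSet_Ioi fun s _ => ?_
  simp [mul_comm]

/-- The incomplete Gamma integral. -/
theorem poissonTail_eq_integral (m : ℕ) (ζ : ℂ) :
    poissonTail (m + 1) ζ = 1 / (m.factorial : ℂ) *
      ∫ s in Set.Ioi (0 : ℝ), (ζ + s) ^ m * Complex.exp (-(ζ + s)) := by
  have h0 : ∀ i : ℕ, IntegrableOn (fun s : ℝ => (s : ℂ) ^ i * Complex.exp (-s)) (Set.Ioi 0) := by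
    intro i
    by_contra h
    have h1 := integral_pow_mul_exp_neg i
    rw [integral_undef h] at h1
    exact i.factorial_ne_zero (by exact_mod_cast h1.symm)
  have h1 : ∀ s : ℝ, (ζ + s) ^ m * Complex.exp (-(ζ + s)) = ∑ j ∈ Finset.range (m + 1),
      (Complex.exp (-ζ) * (ζ ^ j * (m.choose j : ℂ))) * ((s : ℂ) ^ (m - j) * Complex.exp (-s)) := by
    intro s
    rw [add_pow, neg_add, Complex.exp_add, Finset.sum_mul]
    exact Finset.sum_congr rfl fun j _ => by ring
  simp_rw [h1]
  rw [integral_finsetSum _ fun j _ => (h0 _).const_mul _, poissonTail, Finset.mul_sum,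
    Finset.mul_sum]
  refine Finset.sum_congr rfl fun j hj => ?_
  rw [integral_const_mul, integral_pow_mul_exp_neg]
  have hj : j ≤ m := by simpa [Nat.lt_succ_iff] using hj
  have h2 := Nat.choose_mul_factorial_mul_factorial hj
  have hf : (m.factorial : ℂ) ≠ 0 := by exact_mod_cast Nat.factorial_ne_zero _
  have hg : (j.factorial : ℂ) ≠ 0 := by exact_mod_cast Nat.factorial_ne_zero _
  have h3 : (m.choose j : ℂ) * j.factorial * (m - j).factorial = m.factorial := by
    exact_mod_cast h2
  rw [← h3] at hf ⊢
  have hg' := right_ne_zero_of_mul hf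
  have hc := left_ne_zero_of_mul (left_ne_zero_of_mul hf)
  field_simp

/-! ### Poisson tails at complex arguments -/

theorem tendsto_sqrt_natCast_atTop {ι : Type*} {l : Filter ι} {n : ι → ℕ}
    (hn : Tendsto n l atTop) : Tendsto (fun i => Real.sqrt (n i)) l atTop :=
  Real.tendsto_sqrt_atTop.comp (tendsto_natCast_atTop_atTop.comp hn)

theorem tendsto_div_sqrt {ι : Type*} {l : Filter ι} {n : ι → ℕ}
    (hn : Tendsto n l atTop) {b : ι → ℂ} {b₀ : ℂ} (hb : Tendsto b l (𝓝 b₀)) :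
    Tendsto (fun i => b i / (Real.sqrt (n i) : ℂ)) l (𝓝 0) := by
  have h1 : Tendsto (fun i => ((Real.sqrt (n i))⁻¹ : ℝ)) l (𝓝 0) :=
    tendsto_inv_atTop_zero.comp (tendsto_sqrt_natCast_atTop hn)
  have h2 : Tendsto (fun i => (((Real.sqrt (n i))⁻¹ : ℝ) : ℂ)) l (𝓝 ((0 : ℝ) : ℂ)) :=
    (Complex.continuous_ofReal.tendsto _).comp h1
  have := hb.mul h2
  rw [Complex.ofReal_zero, mul_zero] at this
  refine this.congr fun i => ?_
  rw [Complex.ofReal_inv, div_eq_mul_inv]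

/-- `(1 + b/√n)^n exp (-√n b) → exp (-b²/2)`. -/
theorem tendsto_one_add_div_sqrt_pow {ι : Type*} {l : Filter ι} {n : ι → ℕ}
    (hn : Tendsto n l atTop) {b : ι → ℂ} {b₀ : ℂ} (hb : Tendsto b l (𝓝 b₀)) :
    Tendsto (fun i => (1 + b i / (Real.sqrt (n i) : ℂ)) ^ n i *
      Complex.exp (-(Real.sqrt (n i) * b i))) l (𝓝 (Complex.exp (-b₀ ^ 2 / 2))) := by
  have hw := tendsto_div_sqrt hn hb
  have hsmall : ∀ᶠ i in l, ‖b i / (Real.sqrt (n i) : ℂ)‖ < 1 / 2 := by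
    have := hw.norm
    rw [norm_zero] at this
    exact this.eventually_lt_const (by norm_num)
  have hpos : ∀ᶠ i in l, 1 ≤ n i := hn.eventually_ge_atTop 1
  have hdiff : Tendsto (fun i => (n i : ℂ) * (Complex.log (1 + b i / (Real.sqrt (n i) : ℂ)) -
      b i / (Real.sqrt (n i) : ℂ) + (b i / (Real.sqrt (n i) : ℂ)) ^ 2 / 2)) l (𝓝 0) := by
    have hb3 : Tendsto (fun i => ‖b i‖ ^ 2 * ‖b i / (Real.sqrt (n i) : ℂ)‖) l (𝓝 0) := by
      simpa using (hb.norm.pow 2).mul hw.norm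
    refine squeeze_zero_norm' ?_ hb3
    filter_upwards [hsmall, hpos] with i hi hni
    set w := b i / (Real.sqrt (n i) : ℂ) with hwdef
    have h1 := Complex.norm_log_sub_logTaylor_le 2 (z := w) (by linarith)
    have h2 : Complex.logTaylor (2 + 1) w = w - w ^ 2 / 2 := by
      simp [Complex.logTaylor_succ, Complex.logTaylor_zero]
      ring
    rw [h2] at h1
    have h3 : (n i : ℝ) * ‖w‖ ^ 2 = ‖b i‖ ^ 2 := by
      have : (n i : ℝ) ≠ 0 := by positivity
      rw [hwdef, norm_div, div_pow, Complex.norm_real, Real.norm_of_nonneg (Real.sqrt_nonneg _),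
        Real.sq_sqrt (Nat.cast_nonneg _)]
      field_simp
    have h4 : (1 - ‖w‖)⁻¹ ≤ 2 := by
      rw [inv_le_comm₀ (by linarith) two_pos]; linarith
    rw [norm_mul, Complex.norm_natCast, ← h3, mul_assoc]
    gcongr
    rw [show Complex.log (1 + w) - w + w ^ 2 / 2 = Complex.log (1 + w) - (w - w ^ 2 / 2) by ring]
    refine h1.trans ?_
    calc ‖w‖ ^ (2 + 1) * (1 - ‖w‖)⁻¹ / ((2 : ℕ) + 1) ≤ ‖w‖ ^ (2 + 1) * 2 / ((2 : ℕ) + 1) := by gcongr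
      _ ≤ ‖w‖ ^ 2 * ‖w‖ := by
        push_cast
        rw [← pow_succ]
        have := pow_nonneg (norm_nonneg w) 3
        norm_num
        linarith
  have hexp : Tendsto (fun i => Complex.exp ((n i : ℂ) *
      (Complex.log (1 + b i / (Real.sqrt (n i) : ℂ)) -
      b i / (Real.sqrt (n i) : ℂ) + (b i / (Real.sqrt (n i) : ℂ)) ^ 2 / 2) - b i ^ 2 / 2)) l
      (𝓝 (Complex.exp (0 - b₀ ^ 2 / 2))) :=
    (Complex.continuous_exp.tendsto _).comp (hdiff.sub ((hb.pow 2).div_const 2))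
  rw [zero_sub, ← neg_div] at hexp
  refine hexp.congr' ?_
  filter_upwards [hsmall, hpos] with i hi hni
  have hs : (Real.sqrt (n i) : ℂ) ≠ 0 := by
    exact_mod_cast (Real.sqrt_pos.mpr (by exact_mod_cast hni)).ne'
  have hs2 : (Real.sqrt (n i) : ℂ) ^ 2 = n i := by
    rw [← Complex.ofReal_pow, Real.sq_sqrt (Nat.cast_nonneg _)]; push_cast; rfl
  have hne : 1 + b i / (Real.sqrt (n i) : ℂ) ≠ 0 := by
    intro h
    rw [eq_neg_of_add_eq_zero_right h] at hi
    norm_num at hi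
  conv_rhs => rw [← Complex.exp_log hne, ← Complex.exp_nat_mul, ← Complex.exp_add]
  congr 1
  have hb' : b i = Real.sqrt (n i) * (b i / (Real.sqrt (n i) : ℂ)) := by field_simp
  generalize b i / (Real.sqrt (n i) : ℂ) = w at hb'
  rw [hb']
  linear_combination (w - w ^ 2 / 2) * hs2

/-- This is `log (1 + x) ≤ sinh (log (1 + x))`. -/
theorem one_add_le_exp_sub {x : ℝ} (hx : 0 ≤ x) :
    1 + x ≤ Real.exp (x - x ^ 2 / (2 * (1 + x))) := by
  have hx' : 0 < 1 + x := by linarith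
  have h1 : Real.log (1 + x) ≤ x - x ^ 2 / (2 * (1 + x)) := by
    have h2 := Real.self_le_sinh_iff.mpr (Real.log_nonneg (by linarith : 1 ≤ 1 + x))
    rw [Real.sinh_log hx'] at h2
    refine h2.trans_eq ?_
    field_simp
    ring
  calc 1 + x = Real.exp (Real.log (1 + x)) := (Real.exp_log hx').symm
    _ ≤ _ := Real.exp_le_exp.mpr h1

/-- The integrands of the rescaled Gamma integrals are dominated by a function with exponential
decay in `u`. -/
theorem norm_one_add_div_sqrt_pow_le {A : ℝ} {a : ℂ} (ha : ‖a‖ ≤ A) {m : ℕ}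
    (hm : 4 * A ^ 2 ≤ ((m + 1 : ℕ) : ℝ)) {u : ℝ} (hu : 0 < u) :
    ‖(1 + (a + u) / (Real.sqrt (m + 1 : ℕ) : ℂ)) ^ m *
      Complex.exp (-(Real.sqrt (m + 1 : ℕ) * (a + u)))‖ ≤
      2 * Real.exp (2 * A ^ 2) * Real.exp (-(u - A - 1) / 2) := by
  set n : ℝ := ((m + 1 : ℕ) : ℝ) with hn
  have hA : 0 ≤ A := (norm_nonneg a).trans ha
  have hn1 : (1 : ℝ) ≤ n := by rw [hn]; exact_mod_cast Nat.succ_pos m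
  have hs1 : 1 ≤ Real.sqrt n := Real.one_le_sqrt.mpr hn1
  have hss : Real.sqrt n * Real.sqrt n = n := Real.mul_self_sqrt (by linarith)
  set v : ℝ := a.re + u with hv
  set x : ℝ := v / Real.sqrt n with hx
  have hvx : v = Real.sqrt n * x := by rw [hx]; field_simp
  have hsA : 2 * A ≤ Real.sqrt n := by
    refine Real.le_sqrt_of_sq_le ?_
    linarith
  have hre : -A ≤ a.re := (abs_le.mp ((Complex.abs_re_le_norm a).trans ha)).1
  have hre' : a.re ≤ A := (abs_le.mp ((Complex.abs_re_le_norm a).trans ha)).2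
  have him : a.im ^ 2 ≤ A ^ 2 := by
    rw [← sq_abs]
    exact pow_le_pow_left₀ (abs_nonneg _) ((Complex.abs_im_le_norm a).trans ha) 2
  have hx2 : -(1 / 2) ≤ x := by
    rw [hx, le_div_iff₀ (by linarith)]
    linarith
  have hq : 0 < 1 + x := by linarith
  -- the imaginary part of `a` only contributes a bounded factor
  have hnorm : ‖1 + (a + u) / (Real.sqrt n : ℂ)‖ ≤ (1 + x) * Real.exp (2 * A ^ 2 / n) := by
    have e1 : 1 + (a + u) / (Real.sqrt n : ℂ) = ((1 + x : ℝ) : ℂ) +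
        ((a.im / Real.sqrt n : ℝ) : ℂ) * Complex.I := by
      conv_lhs => rw [← Complex.re_add_im a]
      rw [hx, hv]
      push_cast
      ring
    rw [e1, Complex.norm_add_mul_I]
    refine Real.sqrt_le_iff.mpr ⟨by positivity, ?_⟩
    rw [mul_pow, ← Real.exp_nat_mul, div_pow, Real.sq_sqrt (by linarith)]
    have h1 : a.im ^ 2 / n ≤ A ^ 2 / n := by gcongr
    have h2 := Real.add_one_le_exp (((2 : ℕ) : ℝ) * (2 * A ^ 2 / n))
    have h3 : (1 / 2) ^ 2 ≤ (1 + x) ^ 2 := pow_le_pow_left₀ (by norm_num) (by linarith) 2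
    have h4 : 0 ≤ A ^ 2 / n := by positivity
    have h5 : ((2 : ℕ) : ℝ) * (2 * A ^ 2 / n) = 4 * (A ^ 2 / n) := by push_cast; ring
    calc (1 + x) ^ 2 + a.im ^ 2 / n ≤ (1 + x) ^ 2 + A ^ 2 / n := by gcongr
      _ ≤ (1 + x) ^ 2 * (((2 : ℕ) : ℝ) * (2 * A ^ 2 / n) + 1) := by rw [h5]; nlinarith
      _ ≤ _ := by gcongr
  have hexp : ‖Complex.exp (-(Real.sqrt n * (a + u)))‖ = Real.exp (-(n * x)) := by
    rw [Complex.norm_exp, Complex.neg_re, Complex.re_ofReal_mul]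
    congr 2
    rw [Complex.add_re, Complex.ofReal_re, ← hv, hvx, ← mul_assoc, hss]
  have hnat : ∀ y : ℝ, Real.exp y ^ m = Real.exp ((n - 1) * y) := by
    intro y
    rw [← Real.exp_nat_mul, hn]; push_cast; ring_nf
  have hmain : (1 + x) ^ m * Real.exp (-(n * x)) ≤ 2 * Real.exp (-(u - A - 1) / 2) := by
    have h2inv : (1 + x)⁻¹ ≤ 2 := by
      rw [inv_le_comm₀ hq two_pos]; linarith
    have hpow : (1 + x) ^ m = (1 + x) ^ (m + 1) * (1 + x)⁻¹ := by
      rw [pow_succ, mul_assoc, mul_inv_cancel₀ hq.ne', mul_one]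
    have hnat' : ∀ y : ℝ, Real.exp y ^ (m + 1) = Real.exp (n * y) := by
      intro y; rw [← Real.exp_nat_mul]
    rw [hpow]
    rcases le_or_gt 0 x with h0 | h0
    · have hv0 : 0 ≤ v := by rw [hvx]; positivity
      have hxv : x ≤ v := by
        rw [hx]; exact div_le_self hv0 hs1
      have h1 : (1 + x) ^ (m + 1) ≤ Real.exp (n * (x - x ^ 2 / (2 * (1 + x)))) := by
        rw [← hnat']
        exact pow_le_pow_left₀ hq.le (one_add_le_exp_sub h0) _
      have h3 : (v - 1) / 2 ≤ n * (x ^ 2 / (2 * (1 + x))) := by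
        have e : n * (x ^ 2 / (2 * (1 + x))) = v ^ 2 / (2 * (1 + x)) := by
          rw [hvx, mul_pow, sq (Real.sqrt n), hss]; ring
        rw [e]
        calc (v - 1) / 2 ≤ v ^ 2 / (2 * (1 + v)) := by
              rw [div_le_div_iff₀ two_pos (by linarith)]; nlinarith
          _ ≤ _ := by gcongr
      calc (1 + x) ^ (m + 1) * (1 + x)⁻¹ * Real.exp (-(n * x))
          ≤ Real.exp (n * (x - x ^ 2 / (2 * (1 + x)))) * 2 * Real.exp (-(n * x)) := by gcongr
        _ = 2 * Real.exp (-(n * (x ^ 2 / (2 * (1 + x))))) := by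
            rw [mul_comm _ (2 : ℝ), mul_assoc, ← Real.exp_add]; ring_nf
        _ ≤ 2 * Real.exp (-(u - A - 1) / 2) := by
            gcongr
            linarith
    · have h1 : (1 + x) ^ (m + 1) ≤ Real.exp (n * x) := by
        rw [← hnat']
        exact pow_le_pow_left₀ hq.le (by linarith [Real.add_one_le_exp x]) _
      have hvneg : v < 0 := by
        rw [hvx]; exact mul_neg_of_pos_of_neg (by linarith) h0
      calc (1 + x) ^ (m + 1) * (1 + x)⁻¹ * Real.exp (-(n * x))
          ≤ Real.exp (n * x) * 2 * Real.exp (-(n * x)) := by gcongr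
        _ = 2 * 1 := by
            rw [mul_comm _ (2 : ℝ), mul_assoc, ← Real.exp_add, add_neg_cancel, Real.exp_zero]
        _ ≤ 2 * Real.exp (-(u - A - 1) / 2) := by
            gcongr
            exact Real.one_le_exp (by linarith)
  rw [norm_mul, norm_pow, hexp]
  calc ‖1 + (a + u) / (Real.sqrt n : ℂ)‖ ^ m * Real.exp (-(n * x))
      ≤ ((1 + x) * Real.exp (2 * A ^ 2 / n)) ^ m * Real.exp (-(n * x)) := by gcongr
    _ = Real.exp ((n - 1) * (2 * A ^ 2 / n)) * ((1 + x) ^ m * Real.exp (-(n * x))) := by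
        rw [mul_pow, hnat]; ring
    _ ≤ Real.exp (2 * A ^ 2) * (2 * Real.exp (-(u - A - 1) / 2)) := by
        refine mul_le_mul (Real.exp_le_exp.mpr ?_) hmain (by positivity) (by positivity)
        have : n * (2 * A ^ 2 / n) = 2 * A ^ 2 := by field_simp
        have h4 : 0 ≤ 2 * A ^ 2 / n := by positivity
        linarith
    _ = _ := by ring

/-- The incomplete Gamma integral after the substitution `s = √n u`, `n = m + 1`, at
`ζ = n + √n a`. -/
theorem poissonTail_rescaled (m : ℕ) (a : ℂ) :
    poissonTail (m + 1) ((m + 1 : ℕ) + Real.sqrt (m + 1 : ℕ) * a) =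
      ((Real.sqrt 2 * Stirling.stirlingSeq (m + 1))⁻¹ : ℝ) *
      ∫ u in Set.Ioi (0 : ℝ), (1 + (a + u) / (Real.sqrt (m + 1 : ℕ) : ℂ)) ^ m *
        Complex.exp (-(Real.sqrt (m + 1 : ℕ) * (a + u))) := by
  set n : ℝ := ((m + 1 : ℕ) : ℝ) with hn
  have hn0 : 0 < n := by rw [hn]; exact_mod_cast Nat.succ_pos m
  have hs0 : 0 < Real.sqrt n := Real.sqrt_pos.mpr hn0
  have hsC : (Real.sqrt n : ℂ) ≠ 0 := by exact_mod_cast hs0.ne'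
  have hs2 : (Real.sqrt n : ℂ) ^ 2 = (m + 1 : ℕ) := by
    rw [← Complex.ofReal_pow, Real.sq_sqrt hn0.le, hn]; push_cast; rfl
  set ζ : ℂ := (m + 1 : ℕ) + Real.sqrt n * a with hζ
  have h1 := integral_comp_mul_left_Ioi
    (fun s : ℝ => (ζ + s) ^ m * Complex.exp (-(ζ + s))) 0 hs0
  rw [mul_zero, Complex.real_smul] at h1
  have h2 : ∀ u : ℝ, (ζ + (Real.sqrt n * u : ℝ)) ^ m * Complex.exp (-(ζ + (Real.sqrt n * u : ℝ))) =
      ((m + 1 : ℕ) : ℂ) ^ m * Complex.exp (-(m + 1 : ℕ)) *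
        ((1 + (a + u) / (Real.sqrt n : ℂ)) ^ m * Complex.exp (-(Real.sqrt n * (a + u)))) := by
    intro u
    have e1 : ζ + (Real.sqrt n * u : ℝ) = (m + 1 : ℕ) * (1 + (a + u) / (Real.sqrt n : ℂ)) := by
      rw [← hs2, hζ, ← hs2]
      push_cast
      field_simp
      ring
    have e2 : ζ + (Real.sqrt n * u : ℝ) = (m + 1 : ℕ) + Real.sqrt n * (a + u) := by
      rw [hζ]; push_cast; ring
    rw [show Complex.exp (-(ζ + (Real.sqrt n * u : ℝ))) =
      Complex.exp (-(m + 1 : ℕ)) * Complex.exp (-(Real.sqrt n * (a + u))) by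
        rw [e2, neg_add, Complex.exp_add], e1, mul_pow]
    ring
  simp_rw [h2] at h1
  rw [integral_const_mul] at h1
  rw [poissonTail_eq_integral]
  have h3 : ∫ s in Set.Ioi (0 : ℝ), (ζ + s) ^ m * Complex.exp (-(ζ + s)) =
      Real.sqrt n * (((m + 1 : ℕ) : ℂ) ^ m * Complex.exp (-(m + 1 : ℕ)) *
        ∫ u in Set.Ioi (0 : ℝ), (1 + (a + u) / (Real.sqrt n : ℂ)) ^ m *
        Complex.exp (-(Real.sqrt n * (a + u)))) := by
    rw [h1]
    push_cast
    field_simp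
  have h4 : 1 / (m.factorial : ℂ) * (Real.sqrt n * (((m + 1 : ℕ) : ℂ) ^ m *
      Complex.exp (-(m + 1 : ℕ)))) = ((Real.sqrt 2 * Stirling.stirlingSeq (m + 1))⁻¹ : ℝ) := by
    have h5 : 1 / (m.factorial : ℝ) * (Real.sqrt n * (n ^ m * Real.exp (-n))) =
        (Real.sqrt 2 * Stirling.stirlingSeq (m + 1))⁻¹ := by
      rw [Stirling.stirlingSeq, ← hn, Nat.factorial_succ, Real.sqrt_mul zero_le_two, div_pow,
        ← Real.exp_nat_mul, ← hn, mul_one, Real.exp_neg]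
      have hf : (m.factorial : ℝ) ≠ 0 := by exact_mod_cast Nat.factorial_ne_zero _
      have : Real.sqrt 2 ≠ 0 := by positivity
      push_cast
      rw [show (m : ℝ) + 1 = n by rw [hn]; push_cast; rfl, pow_succ n m]
      field_simp
    rw [← h5, hn]
    push_cast
    rfl
  rw [h3, ← h4]
  ring

theorem integral_exp_neg_sq_half (a : ℂ) :
    ∫ u in Set.Ioi (0 : ℝ), Complex.exp (-(a + u) ^ 2 / 2) =
      Real.sqrt 2 * (Complex.exp (-a ^ 2 / 2) * gaussLaplace (Real.sqrt 2 * a)) := by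
  have h1 := integral_comp_mul_left_Ioi
    (fun u : ℝ => Complex.exp (-(a + u) ^ 2 / 2)) 0 (b := Real.sqrt 2) (by positivity)
  rw [mul_zero, Complex.real_smul] at h1
  have h2 : ∀ u : ℝ, Complex.exp (-(a + (Real.sqrt 2 * u : ℝ)) ^ 2 / 2) =
      Complex.exp (-a ^ 2 / 2) * Complex.exp (-(u : ℂ) ^ 2 - Real.sqrt 2 * a * u) := by
    intro u
    rw [← Complex.exp_add]
    congr 1
    push_cast
    linear_combination (-(u : ℂ) ^ 2 / 2) * sqrt_two_sq
  simp_rw [h2] at h1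
  rw [integral_const_mul] at h1
  have : (Real.sqrt 2 : ℂ) ≠ 0 := by
    intro h
    have := sqrt_two_sq
    rw [h] at this
    norm_num at this
  rw [gaussLaplace, h1]
  push_cast
  field_simp

/-- The central limit theorem for Poisson variables, at complex arguments. -/
theorem tendsto_poissonTail {ι : Type*} {l : Filter ι} [l.IsCountablyGenerated] {n : ι → ℕ}
    (hn : Tendsto n l atTop) {a : ι → ℂ} {a₀ : ℂ} (ha : Tendsto a l (𝓝 a₀)) :
    Tendsto (fun i => poissonTail (n i) (n i + Real.sqrt (n i) * a i)) l
      (𝓝 (1 / Real.sqrt Real.pi *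
        (Complex.exp (-a₀ ^ 2 / 2) * gaussLaplace (Real.sqrt 2 * a₀)))) := by
  have hstir : Tendsto (fun i => ((Real.sqrt 2 * Stirling.stirlingSeq (n i))⁻¹ : ℝ)) l
      (𝓝 ((Real.sqrt 2 * Real.sqrt Real.pi)⁻¹)) :=
    ((Stirling.tendsto_stirlingSeq_sqrt_pi.comp hn).const_mul _).inv₀ (by positivity)
  have hstir' := (Complex.continuous_ofReal.tendsto _).comp hstir
  set A : ℝ := ‖a₀‖ + 1 with hA
  have hint : Tendsto (fun i => ∫ u in Set.Ioi (0 : ℝ),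
      (1 + (a i + u) / (Real.sqrt (n i) : ℂ)) ^ (n i - 1) *
        Complex.exp (-(Real.sqrt (n i) * (a i + u)))) l
      (𝓝 (∫ u in Set.Ioi (0 : ℝ), Complex.exp (-(a₀ + u) ^ 2 / 2))) := by
    refine tendsto_integral_filter_of_dominated_convergence
      (fun u => 2 * Real.exp (2 * A ^ 2) * Real.exp (-(u - A - 1) / 2)) ?_ ?_ ?_ ?_
    · exact Eventually.of_forall fun i => Continuous.aestronglyMeasurable (by fun_prop)
    · have h1 : ∀ᶠ i in l, ‖a i‖ ≤ A :=
        (ha.norm.eventually_lt_const (by rw [hA]; linarith)).mono fun i hi => hi.le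
      have h2 : ∀ᶠ i in l, 4 * A ^ 2 ≤ (n i : ℝ) :=
        (tendsto_natCast_atTop_atTop.comp hn).eventually_ge_atTop _
      filter_upwards [h1, h2, hn.eventually_ge_atTop 1] with i hi1 hi2 hi3
      refine (ae_restrict_mem measurableSet_Ioi).mono fun u hu => ?_
      obtain ⟨m, hm⟩ := Nat.exists_eq_add_of_le' hi3
      rw [hm] at hi2 ⊢
      exact norm_one_add_div_sqrt_pow_le hi1 hi2 hu
    · have h := (integrableOn_exp_mul_Ioi (a := -(1 / 2 : ℝ)) (by norm_num) 0).const_mul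
        (2 * Real.exp (2 * A ^ 2) * Real.exp ((A + 1) / 2))
      refine h.congr (Eventually.of_forall fun u => ?_)
      simp only
      rw [mul_assoc, ← Real.exp_add]
      ring_nf
    · refine Eventually.of_forall fun u => ?_
      have hb : Tendsto (fun i => a i + u) l (𝓝 (a₀ + u)) := ha.add_const _
      have h1 := tendsto_one_add_div_sqrt_pow hn hb
      have h2 : Tendsto (fun i => 1 + (a i + u) / (Real.sqrt (n i) : ℂ)) l (𝓝 1) := by
        simpa using (tendsto_div_sqrt hn hb).const_add 1
      have h3 := h1.div h2 one_ne_zero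
      rw [div_one] at h3
      refine h3.congr' ?_
      filter_upwards [h2.eventually_ne one_ne_zero, hn.eventually_ge_atTop 1] with i hi1 hi2
      obtain ⟨m, hm⟩ := Nat.exists_eq_add_of_le' hi2
      simp only [Pi.div_apply]
      rw [hm] at hi1 ⊢
      rw [Nat.add_sub_cancel, div_eq_iff hi1, pow_succ]
      ring
  have := hstir'.mul hint
  rw [integral_exp_neg_sq_half] at this
  have hlim : ((Real.sqrt 2 * Real.sqrt Real.pi)⁻¹ : ℝ) *
      (Real.sqrt 2 * (Complex.exp (-a₀ ^ 2 / 2) * gaussLaplace (Real.sqrt 2 * a₀))) =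
      1 / Real.sqrt Real.pi * (Complex.exp (-a₀ ^ 2 / 2) * gaussLaplace (Real.sqrt 2 * a₀)) := by
    have h2 : (Real.sqrt 2 : ℂ) ≠ 0 := by
      intro h
      have := sqrt_two_sq
      rw [h] at this
      norm_num at this
    have := sqrt_pi_ne_zero
    push_cast
    field_simp
  rw [hlim] at this
  refine this.congr' ?_
  filter_upwards [hn.eventually_ge_atTop 1] with i hi
  obtain ⟨m, hm⟩ := Nat.exists_eq_add_of_le' hi
  simp only [Function.comp_apply]
  rw [hm, Nat.add_sub_cancel]
  exact (poissonTail_rescaled m (a i)).symm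

/-! ### Convergence of the kernel at the edge -/

theorem sqrt_natCast_sq (n : ℕ) : (Real.sqrt n : ℂ) ^ 2 = n := by
  rw [← Complex.ofReal_pow, Real.sq_sqrt (Nat.cast_nonneg _)]
  push_cast
  rfl

/-- `4^n n! / (2n)! * n^n exp (-n)` in terms of Stirling's sequence, which shows that it tends to
`1 / √2`. -/
theorem evenCoeff_mul_eq {n : ℕ} (hn : 1 ≤ n) :
    evenCoeff n * ((n : ℂ) ^ n * Complex.exp (-n)) =
      (((Real.sqrt 2)⁻¹ * (Stirling.stirlingSeq n / Stirling.stirlingSeq (2 * n)) : ℝ) : ℂ) := by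
  have h : 4 ^ n * (n.factorial : ℝ) / ((2 * n).factorial : ℝ) * ((n : ℝ) ^ n * Real.exp (-n)) =
      (Real.sqrt 2)⁻¹ * (Stirling.stirlingSeq n / Stirling.stirlingSeq (2 * n)) := by
    have hn0 : (0 : ℝ) < n := by exact_mod_cast hn
    have hf : (n.factorial : ℝ) ≠ 0 := by exact_mod_cast Nat.factorial_ne_zero _
    have hg : ((2 * n).factorial : ℝ) ≠ 0 := by exact_mod_cast Nat.factorial_ne_zero _
    have h2 : Real.sqrt 2 ≠ 0 := by positivity
    have h3 : Real.sqrt (2 * n) ≠ 0 := by positivity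
    rw [Stirling.stirlingSeq, Stirling.stirlingSeq, div_pow, div_pow, ← Real.exp_nat_mul,
      ← Real.exp_nat_mul, mul_one, mul_one, Real.exp_neg]
    push_cast
    rw [Real.sqrt_mul zero_le_two (2 * (n : ℝ)), show (2 : ℝ) * n = n + n by ring, Real.exp_add,
      ← two_mul, mul_pow, pow_mul (2 : ℝ) 2 n, pow_mul' (n : ℝ) 2 n]
    norm_num
    field_simp
  rw [← h, evenCoeff]
  push_cast
  rfl

theorem tendsto_evenCoeff_mul {ι : Type*} {l : Filter ι} {n : ι → ℕ}
    (hn : Tendsto n l atTop) {v : ι → ℂ} {v₀ : ℂ} (hv : Tendsto v l (𝓝 v₀)) :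
    Tendsto (fun i => evenCoeff (n i) * ((Real.sqrt (n i) + v i) ^ (2 * n i) *
      Complex.exp (-(Real.sqrt (n i) + v i) ^ 2))) l
      (𝓝 ((Real.sqrt 2 : ℂ)⁻¹ * Complex.exp (-2 * v₀ ^ 2))) := by
  have h1 := Stirling.tendsto_stirlingSeq_sqrt_pi.comp hn
  have h2 : Tendsto (fun i => Stirling.stirlingSeq (2 * n i)) l (𝓝 (Real.sqrt Real.pi)) :=
    Stirling.tendsto_stirlingSeq_sqrt_pi.comp (hn.const_mul_atTop' two_pos)
  have h3 := ((h1.div h2 (by positivity)).const_mul (Real.sqrt 2)⁻¹)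
  rw [div_self (by positivity), mul_one] at h3
  have h4 := (Complex.continuous_ofReal.tendsto _).comp h3
  have h5 := (tendsto_one_add_div_sqrt_pow hn hv).pow 2
  have h6 : Tendsto (fun i => Complex.exp (-(v i) ^ 2)) l (𝓝 (Complex.exp (-v₀ ^ 2))) :=
    (Complex.continuous_exp.tendsto _).comp (hv.pow 2).neg
  have h7 := h4.mul (h5.mul h6)
  have e : Complex.exp (-v₀ ^ 2 / 2) ^ 2 * Complex.exp (-v₀ ^ 2) = Complex.exp (-2 * v₀ ^ 2) := by
    rw [← Complex.exp_nat_mul, ← Complex.exp_add]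
    push_cast
    ring_nf
  rw [e, Complex.ofReal_inv] at h7
  refine h7.congr' ?_
  filter_upwards [hn.eventually_ge_atTop 1] with i hi
  have hs := sqrt_natCast_sq (n i)
  have hs0 : (Real.sqrt (n i) : ℂ) ≠ 0 := by
    exact_mod_cast (Real.sqrt_pos.mpr (by exact_mod_cast hi)).ne'
  simp only [Function.comp_apply]
  have h8 := evenCoeff_mul_eq hi
  simp only [Pi.div_apply, Function.comp_apply]
  rw [← h8]
  have e1 : (Real.sqrt (n i) + v i) ^ (2 * n i) =
      (n i : ℂ) ^ n i * ((1 + v i / (Real.sqrt (n i) : ℂ)) ^ n i) ^ 2 := by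
    rw [← pow_mul, ← hs, ← pow_mul, mul_comm (n i) 2, ← mul_pow]
    congr 1
    field_simp
  have e2 : Complex.exp (-(Real.sqrt (n i) + v i) ^ 2) = Complex.exp (-n i) *
      (Complex.exp (-(Real.sqrt (n i) * v i)) ^ 2 * Complex.exp (-(v i) ^ 2)) := by
    rw [← Complex.exp_nat_mul, ← Complex.exp_add, ← Complex.exp_add, ← hs]
    push_cast
    ring_nf
  rw [e1, e2]
  ring

/-- The limit of `dampedDeriv`; twice this is the derivative of `v ↦ edgePhi v x`. -/
noncomputable def limitDeriv (x v : ℂ) : ℂ :=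
  1 / Real.sqrt Real.pi * (Complex.exp (-2 * v ^ 2 - 2 * x ^ 2) *
    (gaussLaplace (2 * (v + x)) - (Real.sqrt 2 : ℂ)⁻¹ * gaussLaplace (2 * Real.sqrt 2 * x)))

theorem tendsto_dampedDeriv {ι : Type*} {l : Filter ι} [l.IsCountablyGenerated] {n : ι → ℕ}
    (hn : Tendsto n l atTop) {x v : ι → ℂ} {x₀ v₀ : ℂ} (hx : Tendsto x l (𝓝 x₀))
    (hv : Tendsto v l (𝓝 v₀)) :
    Tendsto (fun i => dampedDeriv (n i) (Real.sqrt (n i) + x i) (Real.sqrt (n i) + v i)) l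
      (𝓝 (limitDeriv x₀ v₀)) := by
  have hn2 : Tendsto (fun i => 2 * n i) l atTop := hn.const_mul_atTop' two_pos
  have ha : Tendsto (fun i => Real.sqrt 2 * (x i + v i) +
      2 * (x i * v i) / (Real.sqrt (2 * n i : ℕ) : ℂ)) l (𝓝 (Real.sqrt 2 * (x₀ + v₀))) := by
    have := ((hx.add hv).const_mul (Real.sqrt 2 : ℂ)).add
      (tendsto_div_sqrt hn2 ((hx.mul hv).const_mul 2))
    rwa [add_zero] at this
  have hb : Tendsto (fun i => 2 * x i + x i ^ 2 / (Real.sqrt (n i) : ℂ)) l (𝓝 (2 * x₀)) := by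
    have := (hx.const_mul 2).add (tendsto_div_sqrt hn (hx.pow 2))
    rwa [add_zero] at this
  have t1 := tendsto_poissonTail hn2 ha
  have t2 := tendsto_poissonTail hn hb
  have t3 := tendsto_evenCoeff_mul hn hv
  have t4 : Tendsto (fun i => Complex.exp (-(x i - v i) ^ 2)) l
      (𝓝 (Complex.exp (-(x₀ - v₀) ^ 2))) :=
    (Complex.continuous_exp.tendsto _).comp ((hx.sub hv).pow 2).neg
  have t5 := (t4.mul t1).sub (t3.mul t2)
  have hlim : limitDeriv x₀ v₀ = Complex.exp (-(x₀ - v₀) ^ 2) *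
      (1 / Real.sqrt Real.pi * (Complex.exp (-(Real.sqrt 2 * (x₀ + v₀)) ^ 2 / 2) *
        gaussLaplace (Real.sqrt 2 * (Real.sqrt 2 * (x₀ + v₀))))) -
      (Real.sqrt 2 : ℂ)⁻¹ * Complex.exp (-2 * v₀ ^ 2) *
        (1 / Real.sqrt Real.pi * (Complex.exp (-(2 * x₀) ^ 2 / 2) *
          gaussLaplace (Real.sqrt 2 * (2 * x₀)))) := by
    have e1 : Complex.exp (-2 * v₀ ^ 2 - 2 * x₀ ^ 2) = Complex.exp (-(x₀ - v₀) ^ 2) *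
        Complex.exp (-(Real.sqrt 2 * (x₀ + v₀)) ^ 2 / 2) := by
      rw [← Complex.exp_add, mul_pow, sqrt_two_sq]; ring_nf
    have e2 : Complex.exp (-2 * v₀ ^ 2 - 2 * x₀ ^ 2) = Complex.exp (-2 * v₀ ^ 2) *
        Complex.exp (-(2 * x₀) ^ 2 / 2) := by
      rw [← Complex.exp_add]; ring_nf
    have e3 : Real.sqrt 2 * (Real.sqrt 2 * (x₀ + v₀)) = 2 * (v₀ + x₀) := by
      rw [← mul_assoc, ← sq, sqrt_two_sq, add_comm]
    rw [limitDeriv, e3, mul_sub, mul_sub, show (Real.sqrt 2 : ℂ) * (2 * x₀) =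
      2 * Real.sqrt 2 * x₀ by ring]
    congr 1
    · rw [e1]; ring
    · rw [e2]; ring
  rw [hlim]
  refine t5.congr' ?_
  filter_upwards [hn.eventually_ge_atTop 1] with i hi
  have hs := sqrt_natCast_sq (n i)
  have hs' : (Real.sqrt (2 * n i : ℕ) : ℂ) = Real.sqrt 2 * Real.sqrt (n i) := by
    push_cast
    rw [Real.sqrt_mul zero_le_two]
    push_cast
    rfl
  have hs0 : (Real.sqrt (n i) : ℂ) ≠ 0 := by
    exact_mod_cast (Real.sqrt_pos.mpr (by exact_mod_cast hi)).ne'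
  have hs2 : (Real.sqrt 2 : ℂ) ≠ 0 := by
    exact_mod_cast (Real.sqrt_pos.mpr two_pos).ne'
  rw [dampedDeriv]
  congr 2
  · ring_nf
  · congr 1
    rw [hs']
    push_cast
    have e : (Real.sqrt 2 : ℂ) * Real.sqrt (n i) * (Real.sqrt 2 * (x i + v i) +
        2 * (x i * v i) / (Real.sqrt 2 * Real.sqrt (n i))) =
        (Real.sqrt 2 : ℂ) ^ 2 * Real.sqrt (n i) * (x i + v i) + 2 * (x i * v i) := by
      field_simp
    rw [e, sqrt_two_sq]
    linear_combination (-2) * hs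
  · congr 1
    have e : (Real.sqrt (n i) : ℂ) * (2 * x i + x i ^ 2 / Real.sqrt (n i)) =
        2 * Real.sqrt (n i) * x i + x i ^ 2 := by
      field_simp
    rw [e]
    linear_combination -hs

/-- The analogue of `dampedKernel_eq_integral` in the limit. -/
theorem edgePhi_eq_integral (x y : ℂ) :
    edgePhi y x = 2 * ∫ s in (0 : ℝ)..1, limitDeriv x (x + s * (y - x)) * (y - x) := by
  have hcont : Continuous (limitDeriv x) := by unfold limitDeriv; fun_prop
  have := intervalIntegral.integral_eq_sub_of_hasDerivAt (a := 0) (b := 1)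
    (f := fun s : ℝ => edgePhi (x + s * (y - x)) x)
    (f' := fun s : ℝ => 2 * (limitDeriv x (x + s * (y - x)) * (y - x))) (fun s _ => ?_)
    (Continuous.intervalIntegrable (by fun_prop) _ _)
  · rw [← intervalIntegral.integral_const_mul, this]
    simp [edgePhi_self]
  · have h1 : HasDerivAt (fun s : ℂ => x + s * (y - x)) (y - x) s := by
      simpa using ((hasDerivAt_id (s : ℂ)).mul_const (y - x)).const_add x
    refine ((hasDerivAt_edgePhi (x + s * (y - x)) x).comp (s : ℂ) h1).comp_ofReal.congr_deriv ?_
    have hs2 : (Real.sqrt 2 : ℂ) ≠ 0 := by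
      exact_mod_cast (Real.sqrt_pos.mpr two_pos).ne'
    have hpi := sqrt_pi_ne_zero
    have h2 := sqrt_two_sq
    rw [limitDeriv]
    generalize gaussLaplace (2 * (x + s * (y - x) + x)) = g₁
    generalize gaussLaplace (2 * Real.sqrt 2 * x) = g₂
    field_simp
    linear_combination (y - x) * (Real.sqrt 2 * g₁ - g₂) * h2

theorem tendsto_dampedKernel {ι : Type*} {l : Filter ι} [l.IsCountablyGenerated] {n : ι → ℕ}
    (hn : Tendsto n l atTop) {x y : ι → ℂ} {x₀ y₀ : ℂ} (hx : Tendsto x l (𝓝 x₀))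
    (hy : Tendsto y l (𝓝 y₀)) :
    Tendsto (fun i => dampedKernel (n i) (Real.sqrt (n i) + x i) (Real.sqrt (n i) + y i)) l
      (𝓝 (-edgePhi x₀ y₀ / 2)) := by
  have hlim : -edgePhi x₀ y₀ / 2 =
      ∫ s in (0 : ℝ)..1, limitDeriv x₀ (x₀ + s * (y₀ - x₀)) * (y₀ - x₀) := by
    rw [← edgePhi_swap, edgePhi_eq_integral]; ring
  rw [hlim]
  have key : ∀ s : ℝ, Tendsto (fun p : ι × ℝ => dampedDeriv (n p.1) (Real.sqrt (n p.1) + x p.1)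
      (Real.sqrt (n p.1) + (x p.1 + p.2 * (y p.1 - x p.1))) * (y p.1 - x p.1)) (l ×ˢ 𝓝 s)
      (𝓝 (limitDeriv x₀ (x₀ + s * (y₀ - x₀)) * (y₀ - x₀))) := by
    intro s
    have hs : Tendsto (fun p : ι × ℝ => (p.2 : ℂ)) (l ×ˢ 𝓝 s) (𝓝 (s : ℂ)) :=
      (Complex.continuous_ofReal.tendsto s).comp tendsto_snd
    have hx' := hx.comp (tendsto_fst (f := l) (g := 𝓝 s))
    have hy' := hy.comp (tendsto_fst (f := l) (g := 𝓝 s))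
    exact (tendsto_dampedDeriv (hn.comp tendsto_fst) hx'
      (hx'.add (hs.mul (hy'.sub hx')))).mul (hy'.sub hx')
  rcases l.eq_or_neBot with rfl | hl
  · exact tendsto_bot
  have hunif := tendstoUniformlyOn_of_forall_tendsto_prod (F := fun (i : ι) (s : ℝ) =>
    dampedDeriv (n i) (Real.sqrt (n i) + x i)
      (Real.sqrt (n i) + (x i + s * (y i - x i))) * (y i - x i)) key (isCompact_Icc (a := 0) (b := 1))
  have hcont : Continuous (limitDeriv x₀) := by unfold limitDeriv; fun_prop
  have hcont' : Continuous fun s : ℝ => limitDeriv x₀ (x₀ + s * (y₀ - x₀)) * (y₀ - x₀) := by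
    fun_prop
  have h1 : Tendsto (fun i => ∫ s in (0 : ℝ)..1, dampedDeriv (n i) (Real.sqrt (n i) + x i)
      (Real.sqrt (n i) + (x i + s * (y i - x i))) * (y i - x i)) l
      (𝓝 (∫ s in (0 : ℝ)..1, limitDeriv x₀ (x₀ + s * (y₀ - x₀)) * (y₀ - x₀))) := by
    obtain ⟨C, hC⟩ := isCompact_Icc.exists_bound_of_continuousOn
      (hcont'.continuousOn (s := Set.Icc 0 1))
    refine intervalIntegral.tendsto_integral_filter_of_dominated_convergence (fun _ => C + 1)
      ?_ ?_ (by simp) ?_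
    · refine Eventually.of_forall fun i => Continuous.aestronglyMeasurable ?_
      have := continuous_dampedDeriv (n i) (Real.sqrt (n i) + x i)
      fun_prop
    · have := Metric.tendstoUniformlyOn_iff.mp hunif 1 one_pos
      filter_upwards [this] with i hi
      refine Eventually.of_forall fun s hs => ?_
      rw [Set.uIoc_of_le zero_le_one] at hs
      have hs' : s ∈ Set.Icc (0 : ℝ) 1 := ⟨hs.1.le, hs.2⟩
      have h2 := hi s hs'
      rw [dist_comm, dist_eq_norm] at h2
      have h3 := norm_le_norm_add_norm_sub' (dampedDeriv (n i) (Real.sqrt (n i) + x i)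
        (Real.sqrt (n i) + (x i + s * (y i - x i))) * (y i - x i))
        (limitDeriv x₀ (x₀ + s * (y₀ - x₀)) * (y₀ - x₀))
      linarith [hC s hs']
    · refine Eventually.of_forall fun s _ => ?_
      have h4 : Tendsto (fun i : ι => (i, s)) l (l ×ˢ 𝓝 s) :=
        tendsto_id.prodMk (tendsto_const_pure.mono_right (pure_le_nhds s))
      have h5 := (key s).comp h4
      simp only [Function.comp_def] at h5
      exact h5
  refine h1.congr fun i => ?_
  rw [dampedKernel_eq_integral]
  refine intervalIntegral.integral_congr fun s _ => ?_
  rw [show (Real.sqrt (n i) + y i - (Real.sqrt (n i) + x i) : ℂ) = y i - x i by ring, add_assoc]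

/-! ### Convergence of the correlation functions -/

theorem tendsto_pf {ι : Type*} {l : Filter ι} {k : ℕ}
    {A : ι → Fin k × Fin 2 → Fin k × Fin 2 → ℂ} {B : Fin k × Fin 2 → Fin k × Fin 2 → ℂ}
    (h : ∀ a b, Tendsto (fun i => A i a b) l (𝓝 (B a b))) :
    Tendsto (fun i => pf (A i)) l (𝓝 (pf B)) := by
  unfold pf
  exact (tendsto_finsetSum _ fun σ _ =>
    (tendsto_finsetProd _ fun j _ => h _ _).const_mul _).const_mul _

theorem tendsto_conjPair {ι κ : Type*} {l : Filter ι} {x : ι → κ → ℂ} {x₀ : κ → ℂ}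
    (h : ∀ j, Tendsto (fun i => x i j) l (𝓝 (x₀ j))) (a : κ × Fin 2) :
    Tendsto (fun i => conjPair (x i) a) l (𝓝 (conjPair x₀ a)) := by
  unfold conjPair
  split_ifs
  · exact h _
  · exact (Complex.continuous_conj.tendsto _).comp (h _)

/-- The limiting correlation function in terms of `edgePhi`, with all Gaussian weights collected in
front of the Pfaffian. -/
theorem limitCorrelation_eq (t : ℝ) (k : ℕ) (z : Fin k → ℂ) :
    limitCorrelation t k z =
      (∏ j, (conj (z j + Complex.I * t) - (z j + Complex.I * t)) *
        Complex.exp (((z j + Complex.I * t) - conj (z j + Complex.I * t)) ^ 2)) *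
      pf fun a b => edgePhi (conjPair (fun j => z j + Complex.I * t) a)
        (conjPair (fun j => z j + Complex.I * t) b) := by
  set x : Fin k → ℂ := fun j => z j + Complex.I * t with hx
  have hconj : ∀ j, conj (x j) = conj (z j) - Complex.I * t := by
    intro j
    simp [hx, sub_eq_add_neg]
  let W : Fin k × Fin 2 → ℂ := fun a =>
    (Real.exp (-‖x a.1‖ ^ 2) : ℂ) * Complex.exp (conjPair x a ^ 2)
  have h1 : (pfaffian fun j l => kernelEdge t (z j) (z l)) =
      pf fun a b => W a * W b * edgePhi (conjPair x a) (conjPair x b) := by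
    rw [pfaffian_eq_pf]
    refine pf_congr fun a b _ => ?_
    have h2 : kernelEdge t (z a.1) (z b.1) a.2 b.2 =
        (Real.exp (-‖x a.1‖ ^ 2 - ‖x b.1‖ ^ 2) : ℂ) *
          kappaEdge (conjPair x a) (conjPair x b) := by
      obtain ⟨i, c⟩ := a
      obtain ⟨j, d⟩ := b
      fin_cases c <;> fin_cases d <;> simp [kernelEdge, conjPair, hx, sub_eq_add_neg]
    rw [h2, kappaEdge_eq, Complex.exp_add, sub_eq_add_neg, Real.exp_add]
    simp only [W]
    push_cast
    ring
  have h3 : ∀ j, W (j, 0) * W (j, 1) = Complex.exp ((x j - conj (x j)) ^ 2) := by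
    intro j
    have h4 : ((‖x j‖ : ℝ) : ℂ) ^ 2 = x j * conj (x j) := by
      rw [Complex.mul_conj, Complex.normSq_eq_norm_sq]; push_cast; rfl
    simp only [W, conjPair_zero, conjPair_one]
    push_cast
    rw [h4, ← Complex.exp_add, ← Complex.exp_add, ← Complex.exp_add]
    ring_nf
  rw [limitCorrelation, h1, pf_weight]
  simp_rw [h3]
  rw [← mul_assoc, ← Finset.prod_mul_distrib]
  congr 1
  refine Finset.prod_congr rfl fun j _ => ?_
  congr 1
  rw [hconj]
  ring

/-- `√N (exp (i t / √N) - 1) → i t`: moving the base point along the circle is a translation in the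
tangential direction at the microscopic scale. -/
theorem tendsto_sqrt_mul_exp_sub_one (t : ℝ) :
    Tendsto (fun N : ℕ => (Real.sqrt N : ℂ) *
      (Complex.exp (Complex.I * ((t / Real.sqrt N : ℝ) : ℂ)) - 1)) atTop (𝓝 (Complex.I * t)) := by
  have hs := tendsto_sqrt_natCast_atTop (tendsto_id (α := ℕ) (x := atTop))
  have h0 : Tendsto (fun N : ℕ => t ^ 2 / Real.sqrt N) atTop (𝓝 0) := hs.const_div_atTop _
  rw [tendsto_iff_norm_sub_tendsto_zero]
  refine squeeze_zero_norm' ?_ h0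
  filter_upwards [hs.eventually_ge_atTop |t|, eventually_ge_atTop 1] with N hN hN1
  have hN : |t| ≤ Real.sqrt N := hN
  have hs0 : 0 < Real.sqrt N := Real.sqrt_pos.mpr (by exact_mod_cast hN1)
  have hsC : (Real.sqrt N : ℂ) ≠ 0 := by exact_mod_cast hs0.ne'
  set w : ℂ := Complex.I * ((t / Real.sqrt N : ℝ) : ℂ) with hw
  have hwn : ‖w‖ = |t| / Real.sqrt N := by
    rw [hw, norm_mul, Complex.norm_I, one_mul, Complex.norm_real, Real.norm_eq_abs, abs_div,
      abs_of_pos hs0]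
  have h1 := Complex.norm_exp_sub_one_sub_id_le (x := w) (by rw [hwn]; exact div_le_one_of_le₀ hN hs0.le)
  have h2 : (Real.sqrt N : ℂ) * (Complex.exp w - 1) - Complex.I * t =
      Real.sqrt N * (Complex.exp w - 1 - w) := by
    have : (Real.sqrt N : ℂ) * w = Complex.I * t := by
      rw [hw]; push_cast; field_simp
    rw [← this]; ring
  rw [norm_norm, h2, norm_mul, Complex.norm_real, Real.norm_of_nonneg hs0.le]
  calc Real.sqrt N * ‖Complex.exp w - 1 - w‖ ≤ Real.sqrt N * ‖w‖ ^ 2 := by gcongr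
    _ = t ^ 2 / Real.sqrt N := by
      rw [hwn, div_pow, sq_abs]; field_simp

/-- The scaling limit at the edge. At the base point `p = s √2 u`, `u = exp (i t / √N)`, the
microscopic coordinate of `p + ν r z` is `√N + x` with `x = u z + √N (u - 1) → z + i t`. -/
theorem tendstoUniformlyOn_rescaledCorrelation (k : ℕ) {s : ℝ} (hs : s = 1 ∨ s = -1) (t : ℝ)
    (r : ℕ → ℝ) (hr : ∀ N : ℕ, 1 ≤ N → IsMicroScale gaussianPotential N (edgePoint s t N) (r N))
    {C : Set ℂ} (hC : IsCompact C) :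
    TendstoUniformlyOn (fun (N : ℕ) (z : Fin k → ℂ) =>
      ((rescaledCorrelation gaussianPotential N k (edgePoint s t N)
        (discOuterNormal (edgePoint s t N)) (r N) z : ℝ) : ℂ))
      (limitCorrelation t k) atTop (Set.univ.pi fun _ => C) := by
  refine tendstoUniformlyOn_of_forall_tendsto_prod (fun z => ?_) (isCompact_univ_pi fun _ => hC)
  have hs2 : s ^ 2 = 1 := by rcases hs with rfl | rfl <;> norm_num
  let u : ℕ → ℂ := fun N => Complex.exp (Complex.I * ((t / Real.sqrt N : ℝ) : ℂ))
  let x : ℕ × (Fin k → ℂ) → Fin k → ℂ := fun p j =>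
    u p.1 * p.2 j + Real.sqrt p.1 * (u p.1 - 1)
  have hu1 : Tendsto u atTop (𝓝 1) := by
    have h1 := tendsto_div_sqrt (tendsto_id (α := ℕ) (x := atTop)) (tendsto_sqrt_mul_exp_sub_one t)
    have h2 := h1.add_const 1
    rw [zero_add] at h2
    refine h2.congr' ?_
    filter_upwards [eventually_ge_atTop 1] with N hN
    have hsC : (Real.sqrt N : ℂ) ≠ 0 := by
      exact_mod_cast (Real.sqrt_pos.mpr (by exact_mod_cast hN)).ne'
    simp only [id, u]
    field_simp
    ring
  have hx : ∀ j, Tendsto (fun p => x p j) (atTop ×ˢ 𝓝 z) (𝓝 (z j + Complex.I * t)) := by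
    intro j
    have h1 : Tendsto (fun p : ℕ × (Fin k → ℂ) => p.2 j) (atTop ×ˢ 𝓝 z) (𝓝 (z j)) :=
      ((continuous_apply j).tendsto z).comp tendsto_snd
    have h2 := ((hu1.comp tendsto_fst).mul h1).add
      ((tendsto_sqrt_mul_exp_sub_one t).comp tendsto_fst)
    rwa [one_mul] at h2
  have hlim : limitCorrelation t k z =
      (∏ j, 2 * ((z j + Complex.I * t) - conj (z j + Complex.I * t)) *
        Complex.exp (((z j + Complex.I * t) - conj (z j + Complex.I * t)) ^ 2)) *
      pf fun a b => -edgePhi (conjPair (fun j => z j + Complex.I * t) a)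
        (conjPair (fun j => z j + Complex.I * t) b) / 2 := by
    have h1 := pf_smul (k := k) (-(1 / 2)) fun a b =>
      edgePhi (conjPair (fun j => z j + Complex.I * t) a)
        (conjPair (fun j => z j + Complex.I * t) b)
    rw [limitCorrelation_eq, show (fun a b : Fin k × Fin 2 =>
      -edgePhi (conjPair (fun j => z j + Complex.I * t) a)
        (conjPair (fun j => z j + Complex.I * t) b) / 2) = fun a b => -(1 / 2) *
        edgePhi (conjPair (fun j => z j + Complex.I * t) a)
        (conjPair (fun j => z j + Complex.I * t) b) by funext a b; ring, h1, ← mul_assoc]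
    congr 1
    rw [← Fin.prod_const, ← Finset.prod_mul_distrib]
    exact Finset.prod_congr rfl fun j _ => by ring
  have hmain : Tendsto (fun p : ℕ × (Fin k → ℂ) =>
      (∏ j, 2 * (x p j - conj (x p j)) * Complex.exp ((x p j - conj (x p j)) ^ 2)) *
      pf fun a b => dampedKernel p.1 (Real.sqrt p.1 + conjPair (x p) a)
        (Real.sqrt p.1 + conjPair (x p) b)) (atTop ×ˢ 𝓝 z) (𝓝 (limitCorrelation t k z)) := by
    rw [hlim]
    refine Tendsto.mul (tendsto_finsetProd _ fun j _ => ?_) (tendsto_pf fun a b => ?_)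
    · have h1 := (hx j).sub ((Complex.continuous_conj.tendsto _).comp (hx j))
      exact (h1.const_mul 2).mul ((Complex.continuous_exp.tendsto _).comp (h1.pow 2))
    · exact tendsto_dampedKernel tendsto_fst (tendsto_conjPair hx a) (tendsto_conjPair hx b)
  refine hmain.congr' ?_
  have hN : ∀ᶠ p : ℕ × (Fin k → ℂ) in atTop ×ˢ 𝓝 z, max 1 k ≤ p.1 :=
    tendsto_fst.eventually (eventually_ge_atTop (max 1 k))
  filter_upwards [hN] with p hp
  obtain ⟨N, w⟩ := p
  simp only at hp ⊢
  have hN1 : 1 ≤ N := (le_max_left _ _).trans hp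
  have hrN := hr N hN1
  have hr2 := hrN.sq_eq
  have hr0 := hrN.1
  have hsqrt : r N * Real.sqrt N = Real.sqrt 2 := by
    rw [eq_comm, Real.sqrt_eq_iff_mul_self_eq zero_le_two (by positivity), mul_mul_mul_comm,
      Real.mul_self_sqrt (Nat.cast_nonneg _), ← sq, hr2]
    field_simp
  have hsqrtC : (Real.sqrt 2 : ℂ) = r N * Real.sqrt N := by rw [← hsqrt]; push_cast; rfl
  have hnorm : ‖edgePoint s t N‖ = Real.sqrt 2 := by
    rw [edgePoint, norm_mul, norm_mul, Complex.norm_exp]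
    rcases hs with rfl | rfl <;> simp [abs_of_nonneg (Real.sqrt_nonneg 2)]
  let X : Fin k → ℂ := fun j => Real.sqrt N + x (N, w) j
  have h := rescaledCorrelation_eq (k := k) hN1 ((le_max_right _ _).trans hp) (p := edgePoint s t N)
    (ν := discOuterNormal (edgePoint s t N)) hr2 hs2 w X (fun j => ?_)
  · rw [h]
    have hX : ∀ j, X j - conj (X j) = x (N, w) j - conj (x (N, w) j) := by
      intro j; simp [X]
    have hX' : ∀ a, conjPair X a = Real.sqrt N + conjPair (x (N, w)) a := by
      intro a
      unfold conjPair
      split_ifs <;> simp [X]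
    simp_rw [hX, hX']
  · have hsC : (Real.sqrt 2 : ℂ) ≠ 0 := by
      exact_mod_cast (Real.sqrt_pos.mpr two_pos).ne'
    have e1 : discOuterNormal (edgePoint s t N) = s * u N := by
      rw [discOuterNormal, hnorm, edgePoint]
      field_simp
      rfl
    have e2 : edgePoint s t N = s * (r N * Real.sqrt N) * u N := by
      rw [edgePoint, hsqrtC]
    rw [e1, e2]
    simp only [X, x]
    ring

/-! ### The edge kernel away from the real axis -/

/-- A second integration by parts, for the integral in `mul_gaussLaplace`. -/
theorem mul_integral_mul_cexp (b : ℂ) :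
    b * ∫ s in Set.Ioi (0 : ℝ), -(s : ℂ) * Complex.exp (-(s : ℂ) ^ 2 - b * s) =
      ∫ s in Set.Ioi (0 : ℝ), (2 * (s : ℂ) ^ 2 - 1) * Complex.exp (-(s : ℂ) ^ 2 - b * s) := by
  have h2 : ∫ s in Set.Ioi (0 : ℝ),
      (1 - (2 * (s : ℂ) + b) * s) * Complex.exp (-(s : ℂ) ^ 2 - b * s) =
      0 - ((0 : ℝ) : ℂ) * Complex.exp (-((0 : ℝ) : ℂ) ^ 2 - b * (0 : ℝ)) := by
    refine integral_Ioi_of_hasDerivAt_of_tendsto'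
      (f := fun s : ℝ => (s : ℂ) * Complex.exp (-(s : ℂ) ^ 2 - b * s)) (fun s _ => ?_) ?_ ?_
    · have h := ((hasDerivAt_id (s : ℂ)).mul ((((hasDerivAt_id (s : ℂ)).pow 2).neg).sub
        ((hasDerivAt_id (s : ℂ)).const_mul b)).cexp).comp_ofReal
      refine h.congr_deriv ?_
      simp
      ring
    · refine (((integrableOn_pow_mul_cexp b 0).sub ((integrableOn_pow_mul_cexp b 2).const_mul 2)).sub
        ((integrableOn_pow_mul_cexp b 1).const_mul b)).congr (Eventually.of_forall fun s => ?_)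
      simp only [Pi.sub_apply]
      ring
    · rw [tendsto_zero_iff_norm_tendsto_zero]
      refine (tendsto_exp_neg_sq_add 1 one_pos (-b.re) 1).congr' ?_
      filter_upwards [eventually_ge_atTop 0] with s hs
      rw [norm_mul, norm_exp_neg_sq_sub, Complex.norm_real, Real.norm_of_nonneg hs, pow_one]
  rw [Complex.ofReal_zero, zero_mul, sub_zero] at h2
  rw [← sub_eq_zero, ← integral_const_mul, ← integral_sub, ← h2]
  · congr 1
    funext s
    ring
  · refine ((integrableOn_pow_mul_cexp b 1).const_mul (-b)).congr (Eventually.of_forall fun s => ?_)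
    simp only
    ring
  · refine (((integrableOn_pow_mul_cexp b 2).const_mul 2).sub (integrableOn_pow_mul_cexp b 0)).congr
      (Eventually.of_forall fun s => ?_)
    simp only [Pi.sub_apply]
    ring

/-- On a half-plane `c ≤ Re b`, `b h(b)` is bounded and equals `1 + O(1 / b)`. -/
theorem exists_mul_gaussLaplace_bound (c : ℝ) : ∃ C : ℝ, 0 ≤ C ∧ ∀ b : ℂ, c ≤ b.re →
    ‖b * gaussLaplace b‖ ≤ C ∧ ‖b‖ * ‖b * gaussLaplace b - 1‖ ≤ C := by
  let B : ℕ → ℝ := fun n => ∫ s in Set.Ioi (0 : ℝ), s ^ n * Real.exp (-1 * s ^ 2 + -c * s)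
  have hB : ∀ n, 0 ≤ B n := fun n => setIntegral_nonneg measurableSet_Ioi fun s hs => by
    have : (0 : ℝ) < s := hs
    positivity
  have hexp : ∀ b : ℂ, c ≤ b.re → ∀ s ∈ Set.Ioi (0 : ℝ),
      ‖Complex.exp (-(s : ℂ) ^ 2 - b * s)‖ ≤ Real.exp (-1 * s ^ 2 + -c * s) := by
    intro b hb s hs
    have : (0 : ℝ) < s := hs
    rw [norm_exp_neg_sq_sub]
    gcongr
  have h1 : ∀ b : ℂ, c ≤ b.re →
      ‖∫ s in Set.Ioi (0 : ℝ), -(s : ℂ) * Complex.exp (-(s : ℂ) ^ 2 - b * s)‖ ≤ B 1 := by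
    intro b hb
    refine norm_integral_le_of_norm_le (integrableOn_pow_mul_exp one_pos (-c) 1)
      ((ae_restrict_mem measurableSet_Ioi).mono fun s hs => ?_)
    have hs' : (0 : ℝ) < s := hs
    rw [norm_mul, norm_neg, Complex.norm_real, Real.norm_of_nonneg hs'.le, pow_one]
    gcongr
    exact hexp b hb s hs
  have h2 : ∀ b : ℂ, c ≤ b.re →
      ‖∫ s in Set.Ioi (0 : ℝ), (2 * (s : ℂ) ^ 2 - 1) * Complex.exp (-(s : ℂ) ^ 2 - b * s)‖ ≤
        2 * B 2 + B 0 := by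
    intro b hb
    have := (((integrableOn_pow_mul_exp one_pos (-c) 2).const_mul 2).add
      (integrableOn_pow_mul_exp one_pos (-c) 0))
    refine (norm_integral_le_of_norm_le this
      ((ae_restrict_mem measurableSet_Ioi).mono fun s hs => ?_)).trans_eq ?_
    · have h : ‖2 * (s : ℂ) ^ 2 - 1‖ ≤ 2 * s ^ 2 + 1 := by
        refine (norm_sub_le _ _).trans_eq ?_
        simp
      rw [norm_mul]
      refine (mul_le_mul h (hexp b hb s hs) (norm_nonneg _) (by positivity)).trans_eq ?_
      simp only [Pi.add_apply]
      ring
    · rw [← integral_const_mul, ← integral_add]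
      · rfl
      · exact (integrableOn_pow_mul_exp one_pos (-c) 2).const_mul 2
      · exact integrableOn_pow_mul_exp one_pos (-c) 0
  refine ⟨1 + 2 * B 1 + 2 * (2 * B 2 + B 0),
    by linarith [hB 0, hB 1, hB 2], fun b hb => ⟨?_, ?_⟩⟩
  · rw [mul_gaussLaplace]
    refine (norm_add_le _ _).trans ?_
    rw [norm_one, norm_mul, Complex.norm_two]
    linarith [h1 b hb, hB 0, hB 2]
  · rw [mul_gaussLaplace, add_sub_cancel_left, norm_mul, mul_left_comm, ← norm_mul,
      mul_integral_mul_cexp, Complex.norm_two]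
    linarith [h2 b hb, hB 1]

section Limit

variable {ι : Type*} {l : Filter ι} {t : ι → ℝ} {z w : ι → ℂ} {z₀ w₀ s s' : ℂ}

/-- The dominating bound: the argument has modulus at least `t`, and real part bounded below. -/
theorem mul_norm_gaussLaplace_shift_le (hs : |s.im| = 1) (hs0 : s.re = 0) {R C t : ℝ}
    (hC : ∀ b : ℂ, -(2 * Real.sqrt 2 * R) ≤ b.re → ‖b * gaussLaplace b‖ ≤ C) (ht : 2 * R ≤ t)
    {z : ℂ} (hz : ‖z‖ ≤ R) {u : ℝ} (hu : 0 < u) :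
    ‖(t : ℂ) * gaussLaplace (2 * Real.sqrt 2 * (z + s * t + u))‖ ≤ C := by
  set b : ℂ := 2 * Real.sqrt 2 * (z + s * t + u) with hb
  have hb' : b = ((2 * Real.sqrt 2 : ℝ) : ℂ) * (z + s * t + u) := by rw [hb]; push_cast; rfl
  have hR : 0 ≤ R := (norm_nonneg _).trans hz
  have h2 : 1 ≤ Real.sqrt 2 := Real.one_le_sqrt.mpr one_le_two
  have hre : -(2 * Real.sqrt 2 * R) ≤ b.re := by
    rw [hb', Complex.re_ofReal_mul, ← mul_neg]
    gcongr
    simp only [Complex.add_re, Complex.ofReal_re, Complex.re_mul_ofReal, hs0]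
    linarith [neg_le_of_abs_le ((Complex.abs_re_le_norm z).trans hz)]
  have him : t ≤ ‖b‖ := by
    refine le_trans ?_ (Complex.abs_im_le_norm b)
    rw [hb', Complex.im_ofReal_mul, abs_mul, abs_of_nonneg (by positivity)]
    simp only [Complex.add_im, Complex.ofReal_im, Complex.im_mul_ofReal, add_zero]
    have h3 : |s.im * t| - |z.im| ≤ |z.im + s.im * t| := by
      have := abs_sub_abs_le_abs_sub (s.im * t) (-z.im)
      rw [abs_neg, sub_neg_eq_add, add_comm (s.im * t)] at this
      exact this
    rw [abs_mul, hs, one_mul, abs_of_nonneg (by linarith : 0 ≤ t)] at h3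
    nlinarith [(Complex.abs_im_le_norm z).trans hz]
  refine le_trans ?_ (hC b hre)
  rw [norm_mul, norm_mul, Complex.norm_real, Real.norm_of_nonneg (by linarith)]
  gcongr

theorem tendsto_mul_gaussLaplace_shift (hs : |s.im| = 1) (hs0 : s.re = 0)
    (ht : Tendsto t l atTop) (hz : Tendsto z l (𝓝 z₀)) {u : ℝ} (hu : 0 < u) :
    Tendsto (fun i => (t i : ℂ) * gaussLaplace (2 * Real.sqrt 2 * (z i + s * t i + u))) l
      (𝓝 (1 / (2 * Real.sqrt 2 * s))) := by
  have hsne : s ≠ 0 := by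
    rintro rfl
    simp at hs
  have h2 : (Real.sqrt 2 : ℂ) ≠ 0 := by simp
  have hβ : (2 * Real.sqrt 2 * s : ℂ) ≠ 0 := by simp [hsne]
  set b : ι → ℂ := fun i => 2 * Real.sqrt 2 * (z i + s * t i + u) with hb
  have htinv : Tendsto (fun i => ((t i : ℂ))⁻¹) l (𝓝 0) := by
    have := (Complex.continuous_ofReal.tendsto 0).comp (tendsto_inv_atTop_zero.comp ht)
    simpa [Function.comp_def] using this
  have hbt : Tendsto (fun i => b i / t i) l (𝓝 (2 * Real.sqrt 2 * s)) := by
    have h3 : Tendsto (fun i => 2 * Real.sqrt 2 * ((z i + u) * (t i : ℂ)⁻¹ + s)) l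
        (𝓝 (2 * Real.sqrt 2 * ((z₀ + u) * 0 + s))) :=
      (((hz.add_const _).mul htinv).add_const s).const_mul _
    rw [mul_zero, zero_add] at h3
    refine h3.congr' ?_
    filter_upwards [ht.eventually_gt_atTop 0] with i hi
    have : (t i : ℂ) ≠ 0 := by exact_mod_cast hi.ne'
    simp only [hb]
    field_simp
    ring
  have hinv : Tendsto (fun i => (t i : ℂ) / b i) l (𝓝 (1 / (2 * Real.sqrt 2 * s))) := by
    simpa using hbt.inv₀ hβ
  obtain ⟨C, hC0, hC⟩ := exists_mul_gaussLaplace_bound (-(2 * Real.sqrt 2 * (‖z₀‖ + 1)))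
  have hbinv : Tendsto (fun i => ‖(b i)⁻¹‖) l (𝓝 0) := by
    have := (hinv.mul htinv).norm
    rw [mul_zero, norm_zero] at this
    refine this.congr' ?_
    filter_upwards [ht.eventually_gt_atTop 0] with i hi
    have : (t i : ℂ) ≠ 0 := by exact_mod_cast hi.ne'
    congr 1
    field_simp
  have hz1 : ∀ᶠ i in l, ‖z i‖ ≤ ‖z₀‖ + 1 :=
    (hz.norm.eventually (gt_mem_nhds (lt_add_one ‖z₀‖))).mono fun _ h => h.le
  have hone : Tendsto (fun i => b i * gaussLaplace (b i)) l (𝓝 1) := by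
    rw [tendsto_iff_norm_sub_tendsto_zero]
    refine squeeze_zero' (Eventually.of_forall fun _ => norm_nonneg _) ?_
      (by simpa using hbinv.const_mul C)
    filter_upwards [hz1, hbt.eventually_ne hβ] with i hi hne
    have hbne : b i ≠ 0 := fun h => hne (by rw [h, zero_div])
    have hre : -(2 * Real.sqrt 2 * (‖z₀‖ + 1)) ≤ (b i).re := by
      have hb' : b i = ((2 * Real.sqrt 2 : ℝ) : ℂ) * (z i + s * t i + u) := by
        simp only [hb]; push_cast; rfl
      rw [hb', Complex.re_ofReal_mul, ← mul_neg]
      gcongr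
      simp only [Complex.add_re, Complex.ofReal_re, Complex.re_mul_ofReal, hs0]
      linarith [neg_le_of_abs_le ((Complex.abs_re_le_norm (z i)).trans hi)]
    rw [← div_eq_mul_inv, le_div_iff₀ (norm_pos_iff.mpr hbne), mul_comm]
    exact (hC _ hre).2
  have := hinv.mul hone
  rw [mul_one] at this
  refine this.congr' ?_
  filter_upwards [hbt.eventually_ne hβ] with i hne
  have hbne : b i ≠ 0 := fun h => hne (by rw [h, zero_div])
  rw [← mul_assoc, div_mul_cancel₀ _ hbne]

/-- As `t → ∞`, in `t` times the integral defining `edgeCore` at `z + s t` and `w + s' t`, with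
`s, s' = ±i`, the difference of the two values of `gaussLaplace` may be replaced by its limit. -/
theorem tendsto_mul_edgeCore_sub [l.IsCountablyGenerated] (hs : |s.im| = 1) (hs0 : s.re = 0)
    (hs' : |s'.im| = 1) (hs'0 : s'.re = 0)
    (ht : Tendsto t l atTop) (hz : Tendsto z l (𝓝 z₀)) (hw : Tendsto w l (𝓝 w₀)) :
    Tendsto (fun i => (t i : ℂ) * edgeCore (z i + s * t i) (w i + s' * t i) -
      (1 / (2 * Real.sqrt 2 * s') - 1 / (2 * Real.sqrt 2 * s)) *
        (gaussLaplace (2 * (z i + s * t i + (w i + s' * t i))) / 2)) l (𝓝 0) := by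
  set d : ℂ := 1 / (2 * Real.sqrt 2 * s') - 1 / (2 * Real.sqrt 2 * s) with hd
  set R : ℝ := max ‖z₀‖ ‖w₀‖ + 1 with hR
  have hR0 : 0 ≤ R := by positivity
  obtain ⟨C, hC0, hC⟩ := exists_mul_gaussLaplace_bound (-(2 * Real.sqrt 2 * R))
  let G : ι → ℝ → ℂ := fun i u =>
    Complex.exp (-4 * (u : ℂ) ^ 2 - 4 * (z i + s * t i + (w i + s' * t i)) * u) *
      ((t i : ℂ) * gaussLaplace (2 * Real.sqrt 2 * (w i + s' * t i + u)) -
        (t i : ℂ) * gaussLaplace (2 * Real.sqrt 2 * (z i + s * t i + u)) - d)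
  have hz1 : ∀ᶠ i in l, ‖z i‖ ≤ R :=
    (hz.norm.eventually (gt_mem_nhds (show ‖z₀‖ < R by
      linarith [le_max_left ‖z₀‖ ‖w₀‖]))).mono fun _ h => h.le
  have hw1 : ∀ᶠ i in l, ‖w i‖ ≤ R :=
    (hw.norm.eventually (gt_mem_nhds (show ‖w₀‖ < R by
      linarith [le_max_right ‖z₀‖ ‖w₀‖]))).mono fun _ h => h.le
  have ht1 : ∀ᶠ i in l, 2 * R ≤ t i := ht.eventually_ge_atTop _
  have hexp : ∀ᶠ i in l, ∀ u : ℝ, 0 < u →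
      ‖Complex.exp (-4 * (u : ℂ) ^ 2 - 4 * (z i + s * t i + (w i + s' * t i)) * u)‖ ≤
        Real.exp (-4 * u ^ 2 + 8 * R * u) := by
    filter_upwards [hz1, hw1] with i hzi hwi u hu
    rw [Complex.norm_exp]
    gcongr
    have : (-4 * (u : ℂ) ^ 2 - 4 * (z i + s * t i + (w i + s' * t i)) * u) =
      ((-4 * u ^ 2 : ℝ) : ℂ) - (z i + s * t i + (w i + s' * t i)) * ((4 * u : ℝ) : ℂ) := by
      push_cast; ring
    rw [this, Complex.sub_re, Complex.ofReal_re, Complex.re_mul_ofReal]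
    simp only [Complex.add_re, Complex.re_mul_ofReal, hs0, hs'0]
    nlinarith [neg_le_of_abs_le ((Complex.abs_re_le_norm _).trans hzi),
      neg_le_of_abs_le ((Complex.abs_re_le_norm _).trans hwi)]
  have hlim : Tendsto (fun i => ∫ u in Set.Ioi (0 : ℝ), G i u) l
      (𝓝 (∫ u in Set.Ioi (0 : ℝ), (0 : ℂ))) := by
    refine tendsto_integral_filter_of_dominated_convergence
      (fun u => u ^ 0 * Real.exp (-4 * u ^ 2 + 8 * R * u) * (C + C + ‖d‖)) ?_ ?_ ?_ ?_
    · exact Eventually.of_forall fun i => Continuous.aestronglyMeasurable (by fun_prop)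
    · filter_upwards [hz1, hw1, ht1, hexp] with i hzi hwi hti he
      refine (ae_restrict_mem measurableSet_Ioi).mono fun u hu => ?_
      rw [norm_mul, pow_zero, one_mul]
      gcongr
      · exact he u hu
      · refine (norm_sub_le _ _).trans ?_
        gcongr
        refine (norm_sub_le _ _).trans (add_le_add ?_ ?_)
        · exact mul_norm_gaussLaplace_shift_le hs' hs'0 (fun b hb => (hC b hb).1) hti hwi hu
        · exact mul_norm_gaussLaplace_shift_le hs hs0 (fun b hb => (hC b hb).1) hti hzi hu
    · exact (integrableOn_pow_mul_exp (by norm_num) _ 0).mul_const _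
    · refine (ae_restrict_mem measurableSet_Ioi).mono fun u hu => ?_
      have h1 : Tendsto (fun i => (t i : ℂ) * gaussLaplace (2 * Real.sqrt 2 * (w i + s' * t i + u)) -
        (t i : ℂ) * gaussLaplace (2 * Real.sqrt 2 * (z i + s * t i + u)) - d) l (𝓝 0) := by
        have := ((tendsto_mul_gaussLaplace_shift hs' hs'0 ht hw hu).sub
          (tendsto_mul_gaussLaplace_shift hs hs0 ht hz hu)).sub_const d
        rwa [← hd, sub_self] at this
      have h2 := h1.norm.const_mul (Real.exp (-4 * u ^ 2 + 8 * R * u))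
      rw [norm_zero, mul_zero] at h2
      refine squeeze_zero_norm' ?_ h2
      filter_upwards [hexp] with i he
      rw [norm_mul]
      gcongr
      exact he u hu
  rw [integral_zero] at hlim
  refine hlim.congr fun i => ?_
  rw [← integral_exp_edge, edgeCore, ← integral_const_mul, ← integral_const_mul, ← integral_sub]
  · congr 1
    funext u
    simp only [G]
    ring
  · have h := (integrable_edgePhi (z i + s * t i) (w i + s' * t i)).const_mul
      (t i * Complex.exp (2 * (z i + s * t i) ^ 2 + 2 * (w i + s' * t i) ^ 2))
    refine h.congr (Eventually.of_forall fun u => ?_)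
    simp only
    rw [mul_assoc, ← mul_assoc (Complex.exp (2 * _ + _)), ← Complex.exp_add]
    ring_nf
  · simpa using (integrable_exp_edge (z i + s * t i + (w i + s' * t i)) 0).const_mul d

end Limit

/-! ### Functions divisible by a Vandermonde determinant -/

/-- An entire function which is at most `M` on the circle of radius `ρ + 1` and has zeros `a i`
in the disc of radius `ρ` is at most `M ∏ ‖z - a i‖` in the larger disc. -/
theorem norm_le_mul_prod_of_zeros {ι : Type*} (s : Finset ι) (a : ι → ℂ)
    (ha : Set.InjOn a s) {ρ M : ℝ} (hρ : 0 ≤ ρ) (hb : ∀ i ∈ s, ‖a i‖ ≤ ρ) (g : ℂ → ℂ)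
    (hg : Differentiable ℂ g) (h0 : ∀ i ∈ s, g (a i) = 0)
    (hgM : ∀ z, ‖z‖ = ρ + 1 → ‖g z‖ ≤ M) {z : ℂ} (hz : ‖z‖ ≤ ρ + 1) :
    ‖g z‖ ≤ M * ∏ i ∈ s, ‖z - a i‖ := by
  classical
  induction s using Finset.induction_on generalizing g z with
  | empty =>
    rw [Finset.prod_empty, mul_one]
    have hne : ρ + 1 ≠ 0 := by positivity
    refine Complex.norm_le_of_forall_mem_frontier_norm_le (U := Metric.ball 0 (ρ + 1))
      Metric.isBounded_ball hg.diffContOnCl (fun w hw => hgM w ?_) ?_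
    · rw [frontier_ball _ hne] at hw
      simpa using hw
    · rw [closure_ball _ hne]
      simpa using hz
  | insert i s his ih =>
    have hmul : ∀ w, g w = (w - a i) * dslope g (a i) w := by
      intro w
      have := sub_smul_dslope g (a i) w
      rw [h0 i (Finset.mem_insert_self i s), sub_zero] at this
      exact this.symm
    have hd : Differentiable ℂ (dslope g (a i)) := by
      rw [← differentiableOn_univ, Complex.differentiableOn_dslope Filter.univ_mem]
      exact hg.differentiableOn
    rw [Finset.prod_insert his, hmul, norm_mul, mul_left_comm]
    refine mul_le_mul_of_nonneg_left (ih (ha.mono (by simp)) (fun j hj => hb j (by simp [hj])) _ hd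
      (fun j hj => ?_) (fun w hw => ?_) hz) (norm_nonneg _)
    · have h1 := h0 j (by simp [hj])
      rw [hmul] at h1
      refine (mul_eq_zero.mp h1).resolve_left (sub_ne_zero.mpr fun h => his ?_)
      rwa [← ha (by simp [hj]) (by simp) h]
    · refine le_trans ?_ (hgM w hw)
      rw [hmul, norm_mul]
      refine le_mul_of_one_le_left (norm_nonneg _) ?_
      have := norm_sub_norm_le w (a i)
      linarith [hb i (by simp)]

/-- The modulus of the Vandermonde determinant. -/
noncomputable def absVandermonde {n : ℕ} (x : Fin n → ℂ) : ℝ :=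
  ∏ i, ∏ j ∈ Finset.Ioi i, ‖x j - x i‖

theorem absVandermonde_nonneg {n : ℕ} (x : Fin n → ℂ) : 0 ≤ absVandermonde x :=
  Finset.prod_nonneg fun _ _ => Finset.prod_nonneg fun _ _ => norm_nonneg _

/-- A separately entire function which vanishes whenever two of its variables coincide is divisible
by the Vandermonde determinant, with control of the quotient. -/
theorem norm_le_mul_absVandermonde {n : ℕ} (F : (Fin n → ℂ) → ℂ)
    (hF : ∀ x i, Differentiable ℂ fun s => F (Function.update x i s))
    (h0 : ∀ x i j, i ≠ j → x i = x j → F x = 0) {ρ M : ℝ} (hρ : 0 ≤ ρ)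
    (hM : ∀ x, (∀ i, ‖x i‖ ≤ ρ + 1) → ‖F x‖ ≤ M) {x : Fin n → ℂ} (hx : ∀ i, ‖x i‖ ≤ ρ) :
    ‖F x‖ ≤ M * absVandermonde x := by
  have hM0 : 0 ≤ M := (norm_nonneg _).trans (hM 0 fun i => by simp; positivity)
  -- the factors `x i - x j` with `j < i < p` are split off for `p = 0, …, n`
  have key : ∀ p : ℕ, p ≤ n → ∀ x : Fin n → ℂ, (∀ i, i.val < p → ‖x i‖ ≤ ρ) →
      (∀ i, ‖x i‖ ≤ ρ + 1) →
      ‖F x‖ ≤ M * ∏ i ∈ Finset.univ.filter (fun i : Fin n => i.val < p),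
        ∏ j ∈ Finset.Iio i, ‖x i - x j‖ := by
    intro p
    induction p with
    | zero => intro _ x _ h2; simpa using hM x h2
    | succ p ih =>
      intro hp x h1 h2
      let i₀ : Fin n := ⟨p, hp⟩
      have hfilter : Finset.univ.filter (fun i : Fin n => i.val < p + 1) =
          insert i₀ (Finset.univ.filter fun i : Fin n => i.val < p) := by
        ext i
        simp only [Finset.mem_filter, Finset.mem_univ, true_and, Finset.mem_insert, i₀,
          Fin.ext_iff]
        omega
      rw [hfilter, Finset.prod_insert (by simp [i₀]), mul_left_comm, mul_comm]
      by_cases hinj : Set.InjOn x (Finset.Iio i₀ : Finset (Fin n))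
      · have hlt : ∀ i ∈ Finset.univ.filter (fun i : Fin n => i.val < p), i < i₀ := by
          intro i hi
          simpa [i₀, Fin.lt_def] using hi
        have := norm_le_mul_prod_of_zeros (Finset.Iio i₀) x hinj hρ
          (M := M * ∏ i ∈ Finset.univ.filter (fun i : Fin n => i.val < p),
            ∏ j ∈ Finset.Iio i, ‖x i - x j‖)
          (fun i hi => h1 i (by
            have := Finset.mem_Iio.mp hi
            rw [Fin.lt_def] at this
            exact this.trans (Nat.lt_succ_self p)))
          (fun s => F (Function.update x i₀ s)) (hF x i₀)
          (fun i hi => h0 _ i i₀ (Finset.mem_Iio.mp hi).ne (by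
            rw [Function.update_of_ne (Finset.mem_Iio.mp hi).ne, Function.update_self]))
          (fun s hs => ?_) (h2 i₀)
        · rwa [Function.update_eq_self] at this
        · have h3 := ih (by omega) (Function.update x i₀ s) (fun i hi => ?_) (fun i => ?_)
          · refine h3.trans_eq ?_
            congr 1
            refine Finset.prod_congr rfl fun i hi => Finset.prod_congr rfl fun j hj => ?_
            rw [Function.update_of_ne (hlt i hi).ne,
              Function.update_of_ne ((Finset.mem_Iio.mp hj).trans (hlt i hi)).ne]
          · rw [Function.update_of_ne (hlt i (by simpa using hi)).ne]
            exact h1 i (by omega)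
          · rcases eq_or_ne i i₀ with rfl | h
            · rw [Function.update_self, hs]
            · rw [Function.update_of_ne h]
              exact h2 i
      · simp only [Set.InjOn, not_forall] at hinj
        obtain ⟨i, _, j, _, hij, hne⟩ := hinj
        rw [h0 x i j hne hij, norm_zero]
        exact mul_nonneg (mul_nonneg hM0 (Finset.prod_nonneg fun _ _ => Finset.prod_nonneg
          fun _ _ => norm_nonneg _)) (Finset.prod_nonneg fun _ _ => norm_nonneg _)
  have h := key n le_rfl x (fun i _ => hx i) fun i => (hx i).trans (by linarith)
  refine h.trans_eq ?_
  rw [absVandermonde, Finset.filter_true_of_mem fun i _ => i.isLt]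
  congr 1
  exact Finset.prod_comm' (by simp)

/-! ### A lower bound for Gram determinants of exponentials -/

section GramBound

open scoped ComplexOrder Matrix

/-- The determinant is monotone in the Loewner order, in the form `det (κ B Bᴴ) ≤ |det M|` if
`κ B Bᴴ ≤ M`. -/
theorem pow_mul_norm_det_sq_le {n : Type*} [Fintype n] [DecidableEq n] (M B : Matrix n n ℂ)
    {κ : ℝ} (hκ : 0 ≤ κ) (h : (M - (κ : ℂ) • (B * Bᴴ)).PosSemidef) :
    κ ^ Fintype.card n * ‖B.det‖ ^ 2 ≤ ‖M.det‖ := by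
  by_cases hB : B.det = 0
  · rcases eq_or_ne (Fintype.card n) 0 with h0 | h0 <;> simp [hB]
  have hBu : IsUnit B.det := isUnit_iff_ne_zero.mpr hB
  have hBHu : IsUnit Bᴴ.det := by
    rw [Matrix.det_conjTranspose]
    exact hBu.star
  have hS := h.mul_mul_conjTranspose_same B⁻¹
  set S := B⁻¹ * (M - (κ : ℂ) • (B * Bᴴ)) * (B⁻¹)ᴴ with hSdef
  -- `M = B (κ + S) Bᴴ` with `S` positive semidefinite; the eigenvalues of `κ + S` are at least `κ`
  have hM : M = B * (Matrix.scalar n (κ : ℂ) + S) * Bᴴ := by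
    rw [hSdef, Matrix.conjTranspose_nonsing_inv, mul_add, add_mul, ← mul_assoc, ← mul_assoc,
      Matrix.mul_nonsing_inv _ hBu, one_mul, mul_assoc (M - _), Matrix.nonsing_inv_mul _ hBHu,
      mul_one, Matrix.scalar_apply, ← Matrix.smul_one_eq_diagonal, mul_smul_comm, mul_one,
      smul_mul_assoc]
    abel
  have hdet : ‖(Matrix.scalar n (κ : ℂ) + S).det‖ = ∏ i, (κ + hS.isHermitian.eigenvalues i) := by
    have h1 := Matrix.eval_charpoly S (-(κ : ℂ))
    rw [hS.isHermitian.charpoly_eq, Polynomial.eval_prod, map_neg, ← neg_add', Matrix.det_neg] at h1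
    have h2 := congrArg norm h1
    rw [norm_mul, norm_pow, norm_neg, norm_one, one_pow, one_mul, norm_prod] at h2
    rw [← h2]
    refine Finset.prod_congr rfl fun i _ => ?_
    rw [Polynomial.eval_sub, Polynomial.eval_X, Polynomial.eval_C, ← neg_add', norm_neg]
    have h3 := hS.eigenvalues_nonneg i
    have h4 : ((κ : ℂ) + ((hS.isHermitian.eigenvalues i : ℝ) : ℂ)) =
      ((κ + hS.isHermitian.eigenvalues i : ℝ) : ℂ) := by push_cast; rfl
    exact (congrArg norm h4).trans (by rw [Complex.norm_real, Real.norm_of_nonneg (by positivity)])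
  rw [hM, Matrix.det_mul, Matrix.det_mul, norm_mul, norm_mul, Matrix.det_conjTranspose, norm_star,
    hdet, mul_comm ‖B.det‖, mul_assoc, ← pow_two]
  gcongr
  rw [← Finset.card_univ, ← Finset.prod_const]
  exact Finset.prod_le_prod (fun _ _ => hκ) fun i _ =>
    le_add_of_nonneg_right (hS.eigenvalues_nonneg i)

/-- The Cauchy-Schwarz inequality on an interval. -/
theorem norm_integral_sq_le {f : ℝ → ℂ} (hf : Continuous f) {a b : ℝ} (hab : a < b) :
    ‖∫ s in a..b, f s‖ ^ 2 ≤ (b - a) * ∫ s in a..b, ‖f s‖ ^ 2 := by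
  set m := ∫ s in a..b, ‖f s‖ with hm
  have h1 : ‖∫ s in a..b, f s‖ ≤ m := intervalIntegral.norm_integral_le_integral_norm hab.le
  have h2 : 0 ≤ ∫ s in a..b, ((b - a) * ‖f s‖ - m) ^ 2 :=
    intervalIntegral.integral_nonneg hab.le fun _ _ => sq_nonneg _
  have h3 : ∫ s in a..b, ((b - a) * ‖f s‖ - m) ^ 2 =
      (b - a) ^ 2 * (∫ s in a..b, ‖f s‖ ^ 2) - (b - a) * m ^ 2 := by
    have : ∀ s, ((b - a) * ‖f s‖ - m) ^ 2 =
        (b - a) ^ 2 * ‖f s‖ ^ 2 - 2 * (b - a) * m * ‖f s‖ + m ^ 2 := fun s => by ring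
    simp_rw [this]
    rw [intervalIntegral.integral_add, intervalIntegral.integral_sub,
      intervalIntegral.integral_const_mul, intervalIntegral.integral_const_mul,
      intervalIntegral.integral_const, ← hm, smul_eq_mul]
    · ring
    all_goals exact Continuous.intervalIntegrable (by fun_prop) _ _
  rw [h3] at h2
  have hba : 0 < b - a := sub_pos.mpr hab
  have h4 : m ^ 2 ≤ (b - a) * ∫ s in a..b, ‖f s‖ ^ 2 := by
    refine le_of_mul_le_mul_left ?_ hba
    linarith
  exact (pow_le_pow_left₀ (norm_nonneg _) h1 2).trans h4

/-- The integrals of `s ↦ exp (-2 z s)` over consecutive intervals of length `ε`. -/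
noncomputable def expBlock {k : ℕ} (ε : ℝ) (z : Fin k → ℂ) : Matrix (Fin k) (Fin k) ℂ :=
  Matrix.of fun j a => ∫ s in (a : ℕ) * ε..((a : ℕ) + 1 : ℕ) * ε, Complex.exp (-2 * z j * s)

/-- The Gram matrix of the functions `s ↦ exp (-2 z s)` in `L²(0, ∞)` with weight `exp (-s²)`. -/
noncomputable def expGram {k : ℕ} (z : Fin k → ℂ) : Matrix (Fin k) (Fin k) ℂ :=
  Matrix.of fun j l => gaussLaplace (2 * (z j + conj (z l)))

theorem integrableOn_expGram {k : ℕ} (z : Fin k → ℂ) (j l : Fin k) :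
    IntegrableOn (fun s : ℝ => Complex.exp (-(s : ℂ) ^ 2 - 2 * (z j + conj (z l)) * s))
      (Set.Ioi 0) := by
  simpa using integrableOn_pow_mul_cexp (2 * (z j + conj (z l))) 0

theorem expGram_quadratic {k : ℕ} (z x : Fin k → ℂ) :
    IntegrableOn (fun s : ℝ => Real.exp (-s ^ 2) *
      ‖∑ j, conj (x j) * Complex.exp (-2 * z j * s)‖ ^ 2) (Set.Ioi 0) ∧
    star x ⬝ᵥ (expGram z *ᵥ x) = ((∫ s in Set.Ioi (0 : ℝ), Real.exp (-s ^ 2) *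
      ‖∑ j, conj (x j) * Complex.exp (-2 * z j * s)‖ ^ 2 : ℝ) : ℂ) := by
  have h1 : ∀ s : ℝ, ((Real.exp (-s ^ 2) *
      ‖∑ j, conj (x j) * Complex.exp (-2 * z j * s)‖ ^ 2 : ℝ) : ℂ) =
      ∑ j, ∑ l, conj (x j) * x l * Complex.exp (-(s : ℂ) ^ 2 - 2 * (z j + conj (z l)) * s) := by
    intro s
    push_cast
    rw [← Complex.mul_conj', map_sum, Finset.sum_mul_sum, Finset.mul_sum]
    refine Finset.sum_congr rfl fun j _ => ?_
    rw [Finset.mul_sum]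
    refine Finset.sum_congr rfl fun l _ => ?_
    rw [map_mul, Complex.conj_conj, ← Complex.exp_conj,
      show -(s : ℂ) ^ 2 - 2 * (z j + conj (z l)) * s =
        -(s : ℂ) ^ 2 + (-2 * z j * s + conj (-2 * z l * s)) by
          simp [map_ofNat (starRingEnd ℂ) 2]; ring, Complex.exp_add,
      Complex.exp_add]
    ring
  have h2 : IntegrableOn (fun s : ℝ =>
      ∑ j, ∑ l, conj (x j) * x l * Complex.exp (-(s : ℂ) ^ 2 - 2 * (z j + conj (z l)) * s))
      (Set.Ioi 0) :=
    integrable_finsetSum _ fun j _ => integrable_finsetSum _ fun l _ =>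
      (integrableOn_expGram z j l).const_mul _
  constructor
  · refine h2.re.congr (Eventually.of_forall fun s => ?_)
    simp only [← h1]
    exact Complex.ofReal_re _
  · rw [← integral_complex_ofReal]
    simp_rw [h1]
    rw [integral_finsetSum _ fun j _ => integrable_finsetSum _ fun l _ =>
      (integrableOn_expGram z j l).const_mul _]
    simp only [dotProduct, Matrix.mulVec, Pi.star_apply, RCLike.star_def]
    refine Finset.sum_congr rfl fun j _ => ?_
    rw [integral_finsetSum _ fun l _ => (integrableOn_expGram z j l).const_mul _, Finset.mul_sum]
    refine Finset.sum_congr rfl fun l _ => ?_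
    rw [integral_const_mul, expGram, Matrix.of_apply, gaussLaplace]
    ring

theorem expBlock_quadratic {k : ℕ} (ε : ℝ) (z x : Fin k → ℂ) :
    star x ⬝ᵥ ((expBlock ε z * (expBlock ε z)ᴴ) *ᵥ x) =
      ((∑ a : Fin k, ‖∫ s in (a : ℕ) * ε..((a : ℕ) + 1 : ℕ) * ε,
        ∑ j, conj (x j) * Complex.exp (-2 * z j * s)‖ ^ 2 : ℝ) : ℂ) := by
  have h : ∀ a : Fin k, (star x ᵥ* expBlock ε z) a =
      ∫ s in (a : ℕ) * ε..((a : ℕ) + 1 : ℕ) * ε,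
        ∑ j, conj (x j) * Complex.exp (-2 * z j * s) := by
    intro a
    rw [intervalIntegral.integral_finsetSum
      fun j _ => Continuous.intervalIntegrable (by fun_prop) _ _]
    simp only [Matrix.vecMul, dotProduct, Pi.star_apply, RCLike.star_def, expBlock,
      Matrix.of_apply, intervalIntegral.integral_const_mul]
  rw [← Matrix.mulVec_mulVec, Matrix.dotProduct_mulVec,
    show (expBlock ε z)ᴴ *ᵥ x = star (star x ᵥ* expBlock ε z) by rw [Matrix.star_vecMul, star_star]]
  simp only [dotProduct, Pi.star_apply, h, RCLike.star_def, Complex.mul_conj']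
  push_cast
  rfl

/-- By Cauchy-Schwarz on each of the `k` intervals, whose union is contained in `[0, 1]`, where the
weight `exp (-s²)` is at least `exp (-1)`. -/
theorem expGram_sub_posSemidef {k : ℕ} {ε : ℝ} (hε : 0 < ε) (hkε : k * ε ≤ 1) (z : Fin k → ℂ) :
    (expGram z - ((Real.exp (-1) / ε : ℝ) : ℂ) • (expBlock ε z * (expBlock ε z)ᴴ)).PosSemidef := by
  refine Matrix.PosSemidef.of_dotProduct_mulVec_nonneg ?_ fun x => ?_
  · refine Matrix.IsHermitian.sub ?_ ?_
    · ext j l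
      simp only [Matrix.conjTranspose_apply, expGram, Matrix.of_apply, gaussLaplace,
        RCLike.star_def]
      rw [← integral_conj]
      congr 1
      funext s
      rw [← Complex.exp_conj]
      simp [add_comm, map_ofNat (starRingEnd ℂ) 2]
    · rw [Matrix.IsHermitian, Matrix.conjTranspose_smul, Matrix.conjTranspose_mul,
        Matrix.conjTranspose_conjTranspose, RCLike.star_def, Complex.conj_ofReal]
  · obtain ⟨hint, hquad⟩ := expGram_quadratic z x
    set f : ℝ → ℂ := fun s => ∑ j, conj (x j) * Complex.exp (-2 * z j * s) with hf
    have hfc : Continuous f := by fun_prop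
    rw [Matrix.sub_mulVec, dotProduct_sub, hquad, Matrix.smul_mulVec, dotProduct_smul,
      expBlock_quadratic, smul_eq_mul, ← Complex.ofReal_mul, ← Complex.ofReal_sub,
      Complex.zero_le_real, sub_nonneg]
    have h1 : ∑ a : Fin k, ‖∫ s in (a : ℕ) * ε..((a : ℕ) + 1 : ℕ) * ε, f s‖ ^ 2 ≤
        ε * ∫ s in (0 : ℝ)..k * ε, ‖f s‖ ^ 2 := by
      have h2 := intervalIntegral.sum_integral_adjacent_intervals (μ := volume)
        (f := fun s => ‖f s‖ ^ 2) (a := fun a : ℕ => a * ε) (n := k)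
        fun a _ => Continuous.intervalIntegrable (by fun_prop) _ _
      rw [Nat.cast_zero, zero_mul] at h2
      rw [← h2, Finset.mul_sum, ← Fin.sum_univ_eq_sum_range
        (fun a => ε * ∫ s in (a : ℕ) * ε..(a + 1 : ℕ) * ε, ‖f s‖ ^ 2)]
      refine Finset.sum_le_sum fun a _ => ?_
      refine (norm_integral_sq_le hfc (by push_cast; nlinarith)).trans_eq ?_
      push_cast
      ring
    have h3 : Real.exp (-1) * ∫ s in (0 : ℝ)..k * ε, ‖f s‖ ^ 2 ≤
        ∫ s in Set.Ioi (0 : ℝ), Real.exp (-s ^ 2) * ‖f s‖ ^ 2 := by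
      have hk : 0 ≤ k * ε := by positivity
      rw [intervalIntegral.integral_of_le hk, ← integral_const_mul]
      have hsub : Set.Ioc (0 : ℝ) (k * ε) ⊆ Set.Ioi 0 := Set.Ioc_subset_Ioi_self
      refine (setIntegral_mono_on ?_ (hint.mono_set hsub) measurableSet_Ioc fun s hs => ?_).trans
        (setIntegral_mono_set hint ?_ (LE.le.eventuallyLE hsub))
      · have : Continuous fun s => Real.exp (-1) * ‖f s‖ ^ 2 := by fun_prop
        exact (this.integrableOn_Icc (a := 0) (b := k * ε)).mono_set Set.Ioc_subset_Icc_self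
      · have : s ^ 2 ≤ 1 := pow_le_one₀ hs.1.le (hs.2.trans hkε)
        gcongr
      · exact Eventually.of_forall fun s => by positivity
    calc Real.exp (-1) / ε * ∑ a : Fin k, ‖∫ s in (a : ℕ) * ε..((a : ℕ) + 1 : ℕ) * ε, f s‖ ^ 2
        ≤ Real.exp (-1) / ε * (ε * ∫ s in (0 : ℝ)..k * ε, ‖f s‖ ^ 2) := by gcongr
      _ = Real.exp (-1) * ∫ s in (0 : ℝ)..k * ε, ‖f s‖ ^ 2 := by field_simp
      _ ≤ _ := h3

/-- Translating an interval by `ε` multiplies the integral of `exp (-2 z s)` by `exp (-2 ε z)`, so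
the matrix is a Vandermonde matrix up to a factor in each row. -/
theorem det_expBlock {k : ℕ} (ε : ℝ) (z : Fin k → ℂ) :
    (expBlock ε z).det = (∏ j, ∫ s in (0 : ℝ)..ε, Complex.exp (-2 * z j * s)) *
      ∏ i, ∏ j ∈ Finset.Ioi i, (Complex.exp (-2 * ε * z j) - Complex.exp (-2 * ε * z i)) := by
  have h : expBlock ε z =
      Matrix.diagonal (fun j => ∫ s in (0 : ℝ)..ε, Complex.exp (-2 * z j * s)) *
        Matrix.vandermonde fun j => Complex.exp (-2 * ε * z j) := by
    ext j a
    rw [Matrix.diagonal_mul, Matrix.vandermonde_apply, expBlock, Matrix.of_apply]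
    have h1 := intervalIntegral.integral_comp_add_right (a := 0) (b := ε)
      (fun s : ℝ => Complex.exp (-2 * z j * s)) ((a : ℕ) * ε)
    rw [zero_add, show ε + (a : ℕ) * ε = ((a : ℕ) + 1 : ℕ) * ε by push_cast; ring] at h1
    rw [← h1, ← Complex.exp_nat_mul, ← intervalIntegral.integral_mul_const]
    congr 1
    funext s
    rw [← Complex.exp_add]
    congr 1
    push_cast
    ring
  rw [h, Matrix.det_mul, Matrix.det_diagonal, Matrix.det_vandermonde]

/-- The Gram determinant of exponentials is bounded below by the squared Vandermonde
determinant. -/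
theorem exists_le_norm_det_expGram (k : ℕ) {ρ : ℝ} (hρ : 0 ≤ ρ) : ∃ c : ℝ, 0 < c ∧
    ∀ z : Fin k → ℂ, (∀ j, ‖z j‖ ≤ ρ) → c * absVandermonde z ^ 2 ≤ ‖(expGram z).det‖ := by
  -- the interval length is chosen so that `exp (-2 ε z) - 1` is small and `k ε ≤ 1`
  set ε : ℝ := 1 / (8 * (ρ + 1) * (k + 1)) with hεdef
  have hε : 0 < ε := by positivity
  have hερ : ε * ρ ≤ 1 / 8 := by
    rw [hεdef, div_mul_eq_mul_div, div_le_div_iff₀ (by positivity) (by norm_num)]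
    nlinarith [mul_nonneg hρ (Nat.cast_nonneg (α := ℝ) k), Nat.cast_nonneg (α := ℝ) k]
  have hkε : k * ε ≤ 1 := by
    rw [hεdef, mul_one_div, div_le_one (by positivity)]
    nlinarith [mul_nonneg hρ (Nat.cast_nonneg (α := ℝ) k), Nat.cast_nonneg (α := ℝ) k]
  set κ : ℝ := Real.exp (-1) / ε with hκ
  have hκ0 : 0 < κ := by positivity
  refine ⟨κ ^ k * ((ε / 2) ^ k * ∏ i : Fin k, ∏ _j ∈ Finset.Ioi i, ε / 2) ^ 2,
    by positivity, fun z hz => ?_⟩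
  have h := pow_mul_norm_det_sq_le _ _ hκ0.le (expGram_sub_posSemidef hε hkε z)
  refine le_trans ?_ h
  rw [Fintype.card_fin, mul_assoc, ← mul_pow]
  have habs : 0 ≤ absVandermonde z := absVandermonde_nonneg z
  gcongr
  rw [det_expBlock, norm_mul, norm_prod, norm_prod, mul_assoc]
  refine mul_le_mul ?_ ?_ (by positivity) (by positivity)
  · rw [show (ε / 2) ^ k = ∏ _j : Fin k, ε / 2 by
      rw [Finset.prod_const, Finset.card_univ, Fintype.card_fin]]
    refine Finset.prod_le_prod (fun _ _ => by positivity) fun j _ => ?_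
    have h1 : ‖(∫ s in (0 : ℝ)..ε, Complex.exp (-2 * z j * s)) - ε‖ ≤ 1 / 2 * |ε - 0| := by
      have h2 : (∫ s in (0 : ℝ)..ε, Complex.exp (-2 * z j * s)) - ε =
          ∫ s in (0 : ℝ)..ε, (Complex.exp (-2 * z j * s) - 1) := by
        rw [intervalIntegral.integral_sub (Continuous.intervalIntegrable (by fun_prop) _ _)
          (Continuous.intervalIntegrable (by fun_prop) _ _)]
        simp
      rw [h2]
      refine intervalIntegral.norm_integral_le_of_norm_le_const fun s hs => ?_
      rw [Set.uIoc_of_le hε.le] at hs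
      have h3 : ‖-2 * z j * (s : ℂ)‖ ≤ 1 / 4 := by
        rw [norm_mul, norm_mul, norm_neg, Complex.norm_two, Complex.norm_real,
          Real.norm_of_nonneg hs.1.le]
        have := mul_le_mul (hz j) hs.2 hs.1.le hρ
        linarith
      refine (Complex.norm_exp_sub_one_le (h3.trans (by norm_num))).trans ?_
      linarith
    rw [sub_zero, abs_of_pos hε] at h1
    have h4 := norm_sub_norm_le (ε : ℂ) ((ε : ℂ) - ∫ s in (0 : ℝ)..ε, Complex.exp (-2 * z j * s))
    rw [norm_sub_rev] at h1
    rw [sub_sub_cancel, Complex.norm_real, Real.norm_of_nonneg hε.le] at h4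
    linarith
  · rw [absVandermonde]
    simp_rw [← Finset.prod_mul_distrib, norm_prod]
    refine Finset.prod_le_prod (fun _ _ => by positivity) fun i _ =>
      Finset.prod_le_prod (fun _ _ => by positivity) fun j _ => ?_
    set v : ℂ := -2 * ε * (z j - z i) with hv
    have hvn : ‖v‖ = 2 * ε * ‖z j - z i‖ := by
      rw [hv, norm_mul, norm_mul, norm_neg, Complex.norm_two, Complex.norm_real,
        Real.norm_of_nonneg hε.le]
    have hvle : ‖v‖ ≤ 1 / 2 := by
      have := (norm_sub_le (z j) (z i)).trans (add_le_add (hz j) (hz i))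
      rw [hvn]
      nlinarith
    have h1 : ‖v‖ / 2 ≤ ‖Complex.exp v - 1‖ := by
      have h2 := Complex.norm_exp_sub_one_sub_id_le (hvle.trans (by norm_num))
      have h3 := norm_sub_norm_le v (v - (Complex.exp v - 1))
      rw [sub_sub_cancel, norm_sub_rev v] at h3
      nlinarith [norm_nonneg v]
    have h4 : (1 : ℝ) / 2 ≤ ‖Complex.exp (-2 * ε * z i)‖ := by
      have h5 : ‖-2 * (ε : ℂ) * z i‖ ≤ 1 / 4 := by
        rw [norm_mul, norm_mul, norm_neg, Complex.norm_two, Complex.norm_real,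
          Real.norm_of_nonneg hε.le]
        nlinarith [hz i]
      have h6 := Complex.norm_exp_sub_one_le (h5.trans (by norm_num))
      have h7 := norm_sub_norm_le (1 : ℂ) (1 - Complex.exp (-2 * ε * z i))
      rw [sub_sub_cancel, norm_one, norm_sub_rev] at h7
      linarith
    have h8 : Complex.exp (-2 * ε * z j) - Complex.exp (-2 * ε * z i) =
        Complex.exp (-2 * ε * z i) * (Complex.exp v - 1) := by
      rw [mul_sub, ← Complex.exp_add, mul_one, hv]
      ring_nf
    rw [h8, norm_mul]
    calc ε / 2 * ‖z j - z i‖ = 1 / 2 * (‖v‖ / 2) := by rw [hvn]; ring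
      _ ≤ _ := by gcongr

end GramBound

/-! ### Convergence to the complex Ginibre edge process -/

/-- The points `z_j + i t` and `w_j - i t`, in the order of the rows of the Pfaffian. For
`w = conj z` these are the points `z_j + i t` and their conjugates. -/
noncomputable def shiftPair {k : ℕ} (t : ℝ) (z w : Fin k → ℂ) (a : Fin k × Fin 2) : ℂ :=
  if a.2 = 0 then z a.1 + Complex.I * t else w a.1 - Complex.I * t

/-- The Pfaffian of `t edgeCore` at a family of `2k` independent points. -/
noncomputable def corePfaffian {k : ℕ} (t : ℝ) (x : Fin k × Fin 2 → ℂ) : ℂ :=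
  pf fun a b => (t : ℂ) * edgeCore (x a) (x b)

/-- The determinant which `corePfaffian` at the points `shiftPair t z w` approaches as `t → ∞`. -/
noncomputable def crossGramDet {k : ℕ} (z w : Fin k → ℂ) : ℂ :=
  (Matrix.of fun j l => Complex.I / Real.sqrt 2 * (gaussLaplace (2 * (z j + w l)) / 2)).det

theorem sqrt_two_ne_zero : (Real.sqrt 2 : ℂ) ≠ 0 := by simp

theorem edgeCore_eq (z w : ℂ) : edgeCore z w = Real.sqrt Real.pi / Real.sqrt 2 *
    (Complex.exp (2 * z ^ 2 + 2 * w ^ 2) * edgePhi z w) := by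
  have h1 := sqrt_two_ne_zero
  have h2 := sqrt_pi_ne_zero
  have h3 : Complex.exp (2 * z ^ 2 + 2 * w ^ 2) * Complex.exp (-2 * z ^ 2 - 2 * w ^ 2) = 1 := by
    rw [← Complex.exp_add]; ring_nf; exact Complex.exp_zero
  rw [edgePhi_eq]
  generalize Complex.exp (2 * z ^ 2 + 2 * w ^ 2) = A at h3 ⊢
  generalize Complex.exp (-2 * z ^ 2 - 2 * w ^ 2) = B at h3 ⊢
  field_simp
  linear_combination -edgeCore z w * h3

theorem differentiable_edgeCore_left (w : ℂ) : Differentiable ℂ fun z => edgeCore z w := by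
  simp_rw [edgeCore_eq]
  have := differentiable_edgePhi_left w
  fun_prop

theorem differentiable_edgeCore_right (z : ℂ) : Differentiable ℂ fun w => edgeCore z w := by
  simp_rw [edgeCore_eq]
  have := differentiable_edgePhi_right z
  fun_prop

/-- Diagonal entries do not enter the Pfaffian, so each entry depends on the variable through at
most one argument of `edgeCore`. -/
theorem differentiable_corePfaffian {k : ℕ} (t : ℝ) (x : Fin k × Fin 2 → ℂ) (c : Fin k × Fin 2) :
    Differentiable ℂ fun s => corePfaffian t (Function.update x c s) := by
  have hent : ∀ a b, a ≠ b → Differentiable ℂ fun s : ℂ =>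
      (t : ℂ) * edgeCore (Function.update x c s a) (Function.update x c s b) := by
    intro a b hab
    refine Differentiable.const_mul ?_ _
    rcases eq_or_ne a c with rfl | ha
    · simp only [Function.update_self, Function.update_of_ne hab.symm]
      exact differentiable_edgeCore_left _
    · simp only [Function.update_of_ne ha]
      rcases eq_or_ne b c with rfl | hb
      · simp only [Function.update_self]
        exact differentiable_edgeCore_right _
      · simp only [Function.update_of_ne hb]
        exact differentiable_const _
  unfold corePfaffian pf
  refine Differentiable.const_mul (Differentiable.fun_sum fun σ _ => Differentiable.const_mul
    (Differentiable.fun_finsetProd fun j _ => hent _ _ fun h => ?_) _) _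
  simpa using σ.injective h

theorem corePfaffian_eq_zero {k : ℕ} (t : ℝ) {x : Fin k × Fin 2 → ℂ} {a b : Fin k × Fin 2}
    (hab : a ≠ b) (h : x a = x b) : corePfaffian t x = 0 :=
  pf_eq_zero hab (fun c => by rw [h]) (fun c => by rw [h])

theorem shiftPair_update_left {k : ℕ} (t : ℝ) (z w : Fin k → ℂ) (i : Fin k) (s : ℂ) :
    shiftPair t (Function.update z i s) w =
      Function.update (shiftPair t z w) (i, 0) (s + Complex.I * t) := by
  ext ⟨j, c⟩
  fin_cases c <;> rcases eq_or_ne j i with rfl | h <;> simp [shiftPair, *]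

theorem shiftPair_update_right {k : ℕ} (t : ℝ) (z w : Fin k → ℂ) (i : Fin k) (s : ℂ) :
    shiftPair t z (Function.update w i s) =
      Function.update (shiftPair t z w) (i, 1) (s - Complex.I * t) := by
  ext ⟨j, c⟩
  fin_cases c <;> rcases eq_or_ne j i with rfl | h <;> simp [shiftPair, *]

theorem differentiable_crossGramDet {k : ℕ} {z w : ℂ → Fin k → ℂ}
    (hz : ∀ j, Differentiable ℂ fun s => z s j) (hw : ∀ j, Differentiable ℂ fun s => w s j) :
    Differentiable ℂ fun s => crossGramDet (z s) (w s) := by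
  unfold crossGramDet
  simp_rw [Matrix.det_apply']
  refine Differentiable.fun_sum fun σ _ => Differentiable.const_mul
    (Differentiable.fun_finsetProd fun j _ => ?_) _
  simp only [Matrix.of_apply]
  exact ((differentiable_gaussLaplace.comp (((hz _).add (hw _)).const_mul 2)).div_const 2).const_mul _

theorem differentiable_update_apply {k : ℕ} (x : Fin k → ℂ) (i j : Fin k) :
    Differentiable ℂ fun s => Function.update x i s j := by
  rcases eq_or_ne j i with rfl | h
  · simp only [Function.update_self]
    exact differentiable_id
  · simp only [Function.update_of_ne h]
    exact differentiable_const _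

/-- The entries with both points shifted in the same direction tend to `0`; the others tend to the
entries of the matrix in `crossGramDet`. -/
theorem tendsto_corePfaffian {k : ℕ} (z w : Fin k → ℂ) :
    Tendsto (fun p : ℝ × ((Fin k → ℂ) × (Fin k → ℂ)) =>
      corePfaffian p.1 (shiftPair p.1 p.2.1 p.2.2)) (atTop ×ˢ 𝓝 (z, w))
      (𝓝 (crossGramDet z w)) := by
  have ht : Tendsto (fun p : ℝ × ((Fin k → ℂ) × (Fin k → ℂ)) => p.1)
      (atTop ×ˢ 𝓝 (z, w)) atTop := tendsto_fst
  have hz : ∀ j, Tendsto (fun p : ℝ × ((Fin k → ℂ) × (Fin k → ℂ)) => p.2.1 j)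
      (atTop ×ˢ 𝓝 (z, w)) (𝓝 (z j)) := fun j =>
    ((show Continuous fun q : (Fin k → ℂ) × (Fin k → ℂ) => q.1 j by fun_prop).tendsto
      (z, w)).comp tendsto_snd
  have hw : ∀ j, Tendsto (fun p : ℝ × ((Fin k → ℂ) × (Fin k → ℂ)) => p.2.2 j)
      (atTop ×ˢ 𝓝 (z, w)) (𝓝 (w j)) := fun j =>
    ((show Continuous fun q : (Fin k → ℂ) × (Fin k → ℂ) => q.2 j by fun_prop).tendsto
      (z, w)).comp tendsto_snd
  have h2 := sqrt_two_ne_zero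
  have h2' := sqrt_two_sq
  have hI := Complex.I_sq
  unfold crossGramDet corePfaffian
  rw [← pf_offDiagonal]
  refine tendsto_pf fun a b => ?_
  obtain ⟨i, c⟩ := a
  obtain ⟨j, d⟩ := b
  fin_cases c <;> fin_cases d
  · have h := tendsto_mul_edgeCore_sub (s := Complex.I) (s' := Complex.I) (by simp) (by simp)
      (by simp) (by simp) ht (hz i) (hz j)
    simpa [shiftPair] using h
  · have h := tendsto_mul_edgeCore_sub (s := Complex.I) (s' := -Complex.I) (by simp) (by simp)
      (by simp) (by simp) ht (hz i) (hw j)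
    have h3 : Tendsto (fun p : ℝ × ((Fin k → ℂ) × (Fin k → ℂ)) =>
        (1 / (2 * Real.sqrt 2 * -Complex.I) - 1 / (2 * Real.sqrt 2 * Complex.I)) *
          (gaussLaplace (2 * (p.2.1 i + Complex.I * p.1 + (p.2.2 j + -Complex.I * p.1))) / 2))
        (atTop ×ˢ 𝓝 (z, w))
        (𝓝 (Complex.I / Real.sqrt 2 * (gaussLaplace (2 * (z i + w j)) / 2))) := by
      have h4 : (1 / (2 * Real.sqrt 2 * -Complex.I) - 1 / (2 * Real.sqrt 2 * Complex.I)) =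
          Complex.I / Real.sqrt 2 := by
        have := Complex.I_ne_zero
        field_simp
        rw [hI]; ring
      rw [h4]
      refine (((continuous_gaussLaplace.tendsto _).comp
        (((hz i).add (hw j)).const_mul 2)).div_const 2).const_mul _ |>.congr fun p => ?_
      simp only [Function.comp_apply]
      ring_nf
    have h5 := h.add h3
    simpa [shiftPair, sub_eq_add_neg] using h5
  · have h := tendsto_mul_edgeCore_sub (s := -Complex.I) (s' := Complex.I) (by simp) (by simp)
      (by simp) (by simp) ht (hw i) (hz j)
    have h3 : Tendsto (fun p : ℝ × ((Fin k → ℂ) × (Fin k → ℂ)) =>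
        (1 / (2 * Real.sqrt 2 * Complex.I) - 1 / (2 * Real.sqrt 2 * -Complex.I)) *
          (gaussLaplace (2 * (p.2.2 i + -Complex.I * p.1 + (p.2.1 j + Complex.I * p.1))) / 2))
        (atTop ×ˢ 𝓝 (z, w))
        (𝓝 (-(Complex.I / Real.sqrt 2 * (gaussLaplace (2 * (z j + w i)) / 2)))) := by
      have h4 : (1 / (2 * Real.sqrt 2 * Complex.I) - 1 / (2 * Real.sqrt 2 * -Complex.I)) =
          -(Complex.I / Real.sqrt 2) := by
        have := Complex.I_ne_zero
        field_simp
        rw [hI]; ring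
      rw [h4, ← neg_mul]
      refine (((continuous_gaussLaplace.tendsto _).comp
        (((hz j).add (hw i)).const_mul 2)).div_const 2).const_mul _ |>.congr fun p => ?_
      simp only [Function.comp_apply]
      ring_nf
    have h5 := h.add h3
    simpa [shiftPair, sub_eq_add_neg] using h5
  · have h := tendsto_mul_edgeCore_sub (s := -Complex.I) (s' := -Complex.I) (by simp) (by simp)
      (by simp) (by simp) ht (hw i) (hw j)
    simpa [shiftPair, sub_eq_add_neg] using h

/-- The difference of `corePfaffian` and its limit is small relative to the two Vandermonde
determinants, because both functions are entire and vanish on coincident points. -/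
theorem eventually_norm_corePfaffian_sub_le (k : ℕ) {ρ : ℝ} (hρ : 0 ≤ ρ) {ε : ℝ} (hε : 0 < ε) :
    ∀ᶠ t : ℝ in atTop, ∀ z w : Fin k → ℂ, (∀ i, ‖z i‖ ≤ ρ) → (∀ i, ‖w i‖ ≤ ρ) →
      ‖corePfaffian t (shiftPair t z w) - crossGramDet z w‖ ≤
        ε * absVandermonde z * absVandermonde w := by
  have hunif := tendstoUniformlyOn_of_forall_tendsto_prod
    (F := fun (t : ℝ) (p : (Fin k → ℂ) × (Fin k → ℂ)) =>
      corePfaffian t (shiftPair t p.1 p.2)) (f := fun p => crossGramDet p.1 p.2)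
    (fun p => tendsto_corePfaffian p.1 p.2)
    (isCompact_closedBall (0 : (Fin k → ℂ) × (Fin k → ℂ)) (ρ + 1))
  filter_upwards [Metric.tendstoUniformlyOn_iff.mp hunif ε hε] with t ht
  have hsmall : ∀ z w : Fin k → ℂ, (∀ i, ‖z i‖ ≤ ρ + 1) → (∀ i, ‖w i‖ ≤ ρ + 1) →
      ‖corePfaffian t (shiftPair t z w) - crossGramDet z w‖ ≤ ε := by
    intro z w hz hw
    have h1 := ht (z, w) (by
      rw [mem_closedBall_zero_iff, Prod.norm_def, max_le_iff]
      exact ⟨(pi_norm_le_iff_of_nonneg (by linarith)).mpr hz,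
        (pi_norm_le_iff_of_nonneg (by linarith)).mpr hw⟩)
    rw [dist_comm, dist_eq_norm] at h1
    exact h1.le
  have hleft : ∀ z w : Fin k → ℂ, (∀ i, ‖z i‖ ≤ ρ) → (∀ i, ‖w i‖ ≤ ρ + 1) →
      ‖corePfaffian t (shiftPair t z w) - crossGramDet z w‖ ≤ ε * absVandermonde z := by
    intro z w hz hw
    refine norm_le_mul_absVandermonde
      (fun z => corePfaffian t (shiftPair t z w) - crossGramDet z w) (fun x i => ?_)
      (fun x i j hij h => ?_) hρ (fun x hx => hsmall x w hx hw) hz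
    · simp_rw [shiftPair_update_left]
      exact ((differentiable_corePfaffian t _ _).comp (differentiable_id.add_const _)).sub
        (differentiable_crossGramDet (differentiable_update_apply x i) fun _ =>
          differentiable_const _)
    · rw [corePfaffian_eq_zero t (a := (i, 0)) (b := (j, 0)) (by simpa using hij)
        (by simp [shiftPair, h]), crossGramDet, Matrix.det_zero_of_row_eq hij, sub_zero]
      ext l
      simp [h]
  intro z w hz hw
  refine norm_le_mul_absVandermonde
    (fun w => corePfaffian t (shiftPair t z w) - crossGramDet z w) (fun x i => ?_)
    (fun x i j hij h => ?_) hρ (fun x hx => hleft z x hz hx) hw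
  · simp_rw [shiftPair_update_right]
    exact ((differentiable_corePfaffian t _ _).comp (differentiable_id.sub_const _)).sub
      (differentiable_crossGramDet (fun _ => differentiable_const _)
        (differentiable_update_apply x i))
  · rw [corePfaffian_eq_zero t (a := (i, 1)) (b := (j, 1)) (by simpa using hij)
      (by simp [shiftPair, h]), crossGramDet, Matrix.det_zero_of_column_eq hij, sub_zero]
    intro l
    simp [h]

/-- The Gaussian factor common to the symplectic and the complex edge densities. -/
noncomputable def edgeWeight {k : ℕ} (z : Fin k → ℂ) : ℂ :=
  ∏ j, Complex.exp (-(z j + conj (z j)) ^ 2) / Real.sqrt Real.pi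

theorem edgeWeight_ne_zero {k : ℕ} (z : Fin k → ℂ) : edgeWeight z ≠ 0 :=
  Finset.prod_ne_zero_iff.mpr fun _ _ => div_ne_zero (Complex.exp_ne_zero _) sqrt_pi_ne_zero

theorem conjPair_add_eq_shiftPair {k : ℕ} (t : ℝ) (z : Fin k → ℂ) :
    conjPair (fun j => z j + Complex.I * t) = shiftPair t z fun j => conj (z j) := by
  ext ⟨j, c⟩
  fin_cases c <;> simp [conjPair, shiftPair, sub_eq_add_neg]

/-- The identity `(x - conj x)² - 2 x² - 2 (conj x)² = -(x + conj x)²` turns the Gaussian factors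
into ones which do not depend on `t`, as `x + conj x = z + conj z` for `x = z + i t`. -/
theorem limitCorrelation_eq_corePfaffian {t : ℝ} (ht : t ≠ 0) (k : ℕ) (z : Fin k → ℂ) :
    limitCorrelation t k z = edgeWeight z *
      (∏ j, (Real.sqrt 2 : ℂ) * ((conj (z j) - z j) / t - 2 * Complex.I)) *
        corePfaffian t (shiftPair t z fun j => conj (z j)) := by
  have htC : (t : ℂ) ≠ 0 := by exact_mod_cast ht
  have hπ := sqrt_pi_ne_zero
  rw [limitCorrelation_eq, conjPair_add_eq_shiftPair]
  set x := shiftPair t z fun j => conj (z j) with hx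
  have h1 : (fun a b => edgePhi (x a) (x b)) = fun a b =>
      Complex.exp (-2 * x a ^ 2) * Complex.exp (-2 * x b ^ 2) *
        (Real.sqrt 2 / (Real.sqrt Real.pi * t) * (t * edgeCore (x a) (x b))) := by
    funext a b
    rw [edgePhi_eq, sub_eq_add_neg, Complex.exp_add, ← neg_mul]
    field_simp
  rw [h1, pf_weight, pf_smul, corePfaffian, ← mul_assoc, ← mul_assoc]
  congr 1
  rw [edgeWeight, ← Fin.prod_const, ← Finset.prod_mul_distrib, ← Finset.prod_mul_distrib,
    ← Finset.prod_mul_distrib]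
  refine Finset.prod_congr rfl fun j _ => ?_
  have hx0 : x (j, 0) = z j + Complex.I * t := if_pos rfl
  have hx1 : x (j, 1) = conj (z j) - Complex.I * t := if_neg one_ne_zero
  have hc : conj (z j + Complex.I * t) = conj (z j) - Complex.I * t := by
    simp [sub_eq_add_neg]
  have h2 : Complex.exp (((z j + Complex.I * t) - (conj (z j) - Complex.I * t)) ^ 2) *
      (Complex.exp (-2 * (z j + Complex.I * t) ^ 2) *
        Complex.exp (-2 * (conj (z j) - Complex.I * t) ^ 2)) =
      Complex.exp (-(z j + conj (z j)) ^ 2) := by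
    rw [← Complex.exp_add, ← Complex.exp_add]
    ring_nf
  rw [hx0, hx1, hc, ← h2]
  field_simp
  ring

theorem det_kernelEdgeComplex {k : ℕ} (z : Fin k → ℂ) :
    (Matrix.of fun j l => kernelEdgeComplex (z j) (z l)).det = edgeWeight z * (expGram z).det := by
  let u : Fin k → ℂ := fun j => Complex.exp (-(‖z j‖ : ℂ) ^ 2 - z j ^ 2) / Real.sqrt Real.pi
  let v : Fin k → ℂ := fun j => Complex.exp (-(‖z j‖ : ℂ) ^ 2 - conj (z j) ^ 2)
  have h : (Matrix.of fun j l => kernelEdgeComplex (z j) (z l)) =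
      Matrix.diagonal u * expGram z * Matrix.diagonal v := by
    ext j l
    rw [Matrix.mul_diagonal, Matrix.diagonal_mul, Matrix.of_apply, kernelEdgeComplex, erfc_eq,
      expGram, Matrix.of_apply]
    have h1 : Complex.exp (-(‖z j‖ : ℂ) ^ 2 - (‖z l‖ : ℂ) ^ 2 + 2 * z j * conj (z l)) *
        Complex.exp (-(z j + conj (z l)) ^ 2) =
        Complex.exp (-(‖z j‖ : ℂ) ^ 2 - z j ^ 2) *
          Complex.exp (-(‖z l‖ : ℂ) ^ 2 - conj (z l) ^ 2) := by
      rw [← Complex.exp_add, ← Complex.exp_add]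
      ring_nf
    simp only [u, v]
    linear_combination (gaussLaplace (2 * (z j + conj (z l))) / Real.sqrt Real.pi) * h1
  rw [h, Matrix.det_mul, Matrix.det_mul, Matrix.det_diagonal, Matrix.det_diagonal, mul_right_comm,
    ← Finset.prod_mul_distrib, edgeWeight]
  congr 1
  refine Finset.prod_congr rfl fun j _ => ?_
  have h4 : ((‖z j‖ : ℝ) : ℂ) ^ 2 = z j * conj (z j) := by
    rw [Complex.mul_conj, Complex.normSq_eq_norm_sq]; push_cast; rfl
  simp only [u, v]
  rw [div_mul_eq_mul_div, ← Complex.exp_add, h4]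
  ring_nf

theorem crossGramDet_conj {k : ℕ} (z : Fin k → ℂ) :
    crossGramDet z (fun j => conj (z j)) =
      (Complex.I / (2 * Real.sqrt 2)) ^ k * (expGram z).det := by
  have h : (Matrix.of fun j l => Complex.I / Real.sqrt 2 *
      (gaussLaplace (2 * (z j + conj (z l))) / 2)) =
      (Complex.I / (2 * Real.sqrt 2)) • expGram z := by
    ext j l
    rw [Matrix.smul_apply, expGram, Matrix.of_apply, Matrix.of_apply, smul_eq_mul]
    have := sqrt_two_ne_zero
    field_simp
  rw [crossGramDet, h, Matrix.det_smul, Fintype.card_fin]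

theorem absVandermonde_conj {k : ℕ} (z : Fin k → ℂ) :
    absVandermonde (fun j => conj (z j)) = absVandermonde z := by
  unfold absVandermonde
  refine Finset.prod_congr rfl fun i _ => Finset.prod_congr rfl fun j _ => ?_
  rw [← map_sub, Complex.norm_conj]

theorem exists_eq_of_absVandermonde_eq_zero {k : ℕ} {z : Fin k → ℂ} (h : absVandermonde z = 0) :
    ∃ i j, i ≠ j ∧ z i = z j := by
  rw [absVandermonde, Finset.prod_eq_zero_iff] at h
  obtain ⟨i, _, hi⟩ := h
  obtain ⟨j, hj, hij⟩ := Finset.prod_eq_zero_iff.mp hi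
  exact ⟨j, i, (Finset.mem_Ioi.mp hj).ne', sub_eq_zero.mp (norm_eq_zero.mp hij)⟩

/-- The determinant of the complex Ginibre kernel vanishes only where two points coincide, and there
the Pfaffian vanishes too. -/
theorem limitCorrelation_eq_zero {k : ℕ} (t : ℝ) {z : Fin k → ℂ}
    (h : (Matrix.of fun j l => kernelEdgeComplex (z j) (z l)).det = 0) :
    limitCorrelation t k z = 0 := by
  obtain ⟨c, hc, hlow⟩ := exists_le_norm_det_expGram k (norm_nonneg z)
  have h1 := hlow z fun j => norm_le_pi_norm z j
  rw [det_kernelEdgeComplex] at h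
  rw [(mul_eq_zero.mp h).resolve_left (edgeWeight_ne_zero z), norm_zero] at h1
  have h2 : absVandermonde z = 0 := by
    have : absVandermonde z ^ 2 ≤ 0 := by
      by_contra h3
      exact absurd (mul_pos hc (not_le.mp h3)) (not_lt.mpr h1)
    exact pow_eq_zero_iff two_ne_zero |>.mp (le_antisymm this (sq_nonneg _))
  obtain ⟨i, j, hij, hz⟩ := exists_eq_of_absVandermonde_eq_zero h2
  rw [limitCorrelation_eq, pf_eq_zero (a := (i, 0)) (b := (j, 0)) (by simpa using hij)
    (fun c => by simp only [conjPair_zero, hz]) (fun c => by simp only [conjPair_zero, hz]),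
    mul_zero]

/-- The relative error in the approximation of the limiting correlation function by the complex
Ginibre determinant. It is `0` where the determinant vanishes; there the correlation function
vanishes as well. -/
noncomputable def edgeError (k : ℕ) (t : ℝ) (z : Fin k → ℂ) : ℂ :=
  if (Matrix.of fun j l => kernelEdgeComplex (z j) (z l)).det = 0 then 0
  else limitCorrelation t k z / (Matrix.of fun j l => kernelEdgeComplex (z j) (z l)).det - 1

theorem limitCorrelation_eq_det_mul (k : ℕ) (t : ℝ) (z : Fin k → ℂ) :
    limitCorrelation t k z =
      (Matrix.of fun j l => kernelEdgeComplex (z j) (z l)).det * (1 + edgeError k t z) := by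
  unfold edgeError
  split_ifs with h
  · rw [limitCorrelation_eq_zero t h, h, zero_mul]
  · rw [add_sub_cancel, mul_div_cancel₀ _ h]

theorem tendstoUniformlyOn_edgeError (k : ℕ) {C : Set ℂ} (hC : IsCompact C) :
    TendstoUniformlyOn (edgeError k) (fun _ => 0) atTop (Set.univ.pi fun _ => C) := by
  obtain ⟨ρ, hρ0, hρ⟩ := hC.isBounded.exists_pos_norm_le
  obtain ⟨c, hc, hlow⟩ := exists_le_norm_det_expGram k hρ0.le
  set q : ℝ := ‖Complex.I / (2 * (Real.sqrt 2 : ℂ))‖ ^ k with hq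
  have hq0 : 0 < q := pow_pos (norm_pos_iff.mpr (div_ne_zero Complex.I_ne_zero
    (mul_ne_zero two_ne_zero sqrt_two_ne_zero))) _
  -- the ratio of the prefactors of the Pfaffian and of the determinant
  let u : ℝ → (Fin k → ℂ) → ℂ := fun t z =>
    ∏ j, (1 + Complex.I / 2 * ((conj (z j) - z j) * (t : ℂ)⁻¹))
  have hu : TendstoUniformlyOn u (fun _ => 1) atTop (Set.univ.pi fun _ => C) := by
    refine tendstoUniformlyOn_of_forall_tendsto_prod (fun z => ?_)
      (isCompact_univ_pi fun _ => hC)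
    have htinv : Tendsto (fun p : ℝ × (Fin k → ℂ) => ((p.1 : ℂ))⁻¹) (atTop ×ˢ 𝓝 z) (𝓝 0) := by
      have := (Complex.continuous_ofReal.tendsto 0).comp
        (tendsto_inv_atTop_zero.comp (tendsto_fst (f := (atTop : Filter ℝ)) (g := 𝓝 z)))
      simpa [Function.comp_def] using this
    have : Tendsto (fun p : ℝ × (Fin k → ℂ) => u p.1 p.2) (atTop ×ˢ 𝓝 z)
        (𝓝 (∏ j, (1 + Complex.I / 2 * ((conj (z j) - z j) * 0)))) :=
      tendsto_finsetProd _ fun j _ => ((((show Continuous fun y : Fin k → ℂ =>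
        conj (y j) - y j by fun_prop).tendsto z).comp tendsto_snd).mul htinv).const_mul _
          |>.const_add _
    simpa using this
  rw [Metric.tendstoUniformlyOn_iff] at hu ⊢
  intro η hη
  -- `‖u‖ ≤ 1 + δ ≤ 2`, so that the total error is at most `δ + 2 δ < η`
  set δ : ℝ := min 1 (η / 4) with hδ
  have hδ0 : 0 < δ := by positivity
  filter_upwards [hu δ hδ0, eventually_gt_atTop 0,
    eventually_norm_corePfaffian_sub_le k hρ0.le (ε := δ * (q * c)) (by positivity)]
    with t hut ht hcore z hz
  rw [dist_zero_left, edgeError]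
  split_ifs with hdet
  · simpa using hη
  have hzρ : ∀ j, ‖z j‖ ≤ ρ := fun j => hρ _ (hz j trivial)
  have hG : (expGram z).det ≠ 0 := by
    intro h
    rw [det_kernelEdgeComplex, h, mul_zero] at hdet
    exact hdet rfl
  set D := crossGramDet z fun j => conj (z j) with hD
  have hDeq := crossGramDet_conj z
  have hD0 : D ≠ 0 := by
    rw [hD, hDeq]
    exact mul_ne_zero (pow_ne_zero _ (div_ne_zero Complex.I_ne_zero
      (mul_ne_zero two_ne_zero sqrt_two_ne_zero))) hG
  set H := corePfaffian t (shiftPair t z fun j => conj (z j)) with hH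
  have he : ‖(H - D) / D‖ ≤ δ := by
    rw [norm_div, div_le_iff₀ (norm_pos_iff.mpr hD0)]
    refine (hcore z (fun j => conj (z j)) hzρ fun j => by
      rw [Complex.norm_conj]; exact hzρ j).trans ?_
    rw [absVandermonde_conj, hD, hDeq, norm_mul, norm_pow, ← hq]
    calc δ * (q * c) * absVandermonde z * absVandermonde z
        = δ * (q * (c * absVandermonde z ^ 2)) := by ring
      _ ≤ _ := by
        gcongr
        exact hlow z hzρ
  have hratio : limitCorrelation t k z /
      (Matrix.of fun j l => kernelEdgeComplex (z j) (z l)).det - 1 =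
      (u t z - 1) + u t z * ((H - D) / D) := by
    have h1 : ∏ j, ((Real.sqrt 2 : ℂ) * ((conj (z j) - z j) / t - 2 * Complex.I)) *
        (Complex.I / (2 * Real.sqrt 2)) = u t z := by
      refine Finset.prod_congr rfl fun j _ => ?_
      have := sqrt_two_ne_zero
      have htC : (t : ℂ) ≠ 0 := by exact_mod_cast ht.ne'
      field_simp
      linear_combination (-2 * (t : ℂ)) * Complex.I_sq
    rw [Finset.prod_mul_distrib, Fin.prod_const] at h1
    have h2 : (expGram z).det = D / (Complex.I / (2 * (Real.sqrt 2 : ℂ))) ^ k := by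
      rw [hD, hDeq, mul_div_cancel_left₀]
      exact pow_ne_zero _ (div_ne_zero Complex.I_ne_zero
        (mul_ne_zero two_ne_zero sqrt_two_ne_zero))
    have h3 : u t z - 1 + u t z * ((H - D) / D) = u t z * H / D - 1 := by
      field_simp
      ring
    rw [h3, ← h1, det_kernelEdgeComplex, h2, limitCorrelation_eq_corePfaffian ht.ne', mul_assoc,
      mul_div_mul_left _ _ (edgeWeight_ne_zero z), div_div_eq_mul_div]
    ring
  have hu1 : ‖u t z - 1‖ < δ := by
    rw [← dist_eq_norm, dist_comm]
    exact hut z hz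
  have hu2 : ‖u t z‖ ≤ 2 := by
    have h1 := norm_add_le (u t z - 1) 1
    rw [sub_add_cancel, norm_one] at h1
    linarith [min_le_left 1 (η / 4)]
  rw [hratio]
  refine (norm_add_le _ _).trans_lt ?_
  rw [norm_mul]
  have h1 := mul_le_mul hu2 he (norm_nonneg _) zero_le_two
  linarith [min_le_right 1 (η / 4)]

end SymplecticGinibre

theorem corollary2p2 (k : ℕ) :
    (∀ s : ℝ, s = 1 ∨ s = -1 → ∀ (t : ℝ) (r : ℕ → ℝ),
      (∀ N : ℕ, 1 ≤ N →
        SymplecticGinibre.IsMicroScale SymplecticGinibre.gaussianPotential N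
          (SymplecticGinibre.edgePoint s t N) (r N)) →
      ∀ C : Set ℂ, IsCompact C →
        TendstoUniformlyOn
          (fun (N : ℕ) (z : Fin k → ℂ) =>
            ((SymplecticGinibre.rescaledCorrelation SymplecticGinibre.gaussianPotential N k
              (SymplecticGinibre.edgePoint s t N)
              (SymplecticGinibre.discOuterNormal (SymplecticGinibre.edgePoint s t N))
              (r N) z : ℝ) : ℂ))
          (SymplecticGinibre.limitCorrelation t k) Filter.atTop (Set.univ.pi fun _ => C)) ∧
    (∃ o : ℝ → (Fin k → ℂ) → ℂ,
      (∀ (t : ℝ) (z : Fin k → ℂ),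
        SymplecticGinibre.limitCorrelation t k z =
          (Matrix.of fun j l => SymplecticGinibre.kernelEdgeComplex (z j) (z l)).det
            * (1 + o t z)) ∧
      ∀ C : Set ℂ, IsCompact C →
        TendstoUniformlyOn o (fun _ => 0) Filter.atTop (Set.univ.pi fun _ => C)) := by
  exact ⟨fun s hs t r hr C hC =>
    SymplecticGinibre.tendstoUniformlyOn_rescaledCorrelation k hs t r hr hC,
    SymplecticGinibre.edgeError k, SymplecticGinibre.limitCorrelation_eq_det_mul k,
    fun C hC => SymplecticGinibre.tendstoUniformlyOn_edgeError k hC⟩
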